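/- For points $z_1,\dots,z_n\in\mathbb C$ put $\Delta(z_1,\dots,z_n)=\prod_{i\ne j}|z_i-z_j|$ (product over ordered pairs) and $\overline\Delta=\Delta/n^n$; let $\Delta_{\max}(n)=\sup\{\Delta(z_1,\dots,z_n): |z_i-z_j|\le 2 \text{ for all } i,j\}$ and $\overline\Delta_{\max}(n)=\Delta_{\max}(n)/n^n$. Let \[ C_*=\frac{3^{9/4}}{2^3}\exp\left(\frac{\pi^2-2\sqrt3\,\pi}{8}\right). \] For every $n=6k$ with $k\ge1$ there is a set $P_n=\{B_1,\dots,B_n\}\subset\mathbb C$ of $n$ distinct points, of diameter exactly $2$, with the following properties. Let $A_0,A_1,\dots,A_n=A_0$ be the vertices, in counterclockwise order, of a regular $n$-gon of circumradius $1/\cos(\pi/2n)$, and put $B_0=B_n$, indices being taken modulo $n$. Then: - for each $j\in\{0,\dots,5\}$ the arc $B_{jk},B_{jk+1},\dots,B_{(j+1)k}$ is the image of the arc $A_{jk},A_{jk+1},\dots,A_{(j+1)k}$ under an orientation-preserving isometry of the plane; - the closed polygon $B_1B_2\cdots B_n$, traversed counterclockwise, has at the junction vertex $B_{tk}$ the internal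 angle $\frac{(n-2)\pi}{n}+\frac{\pi}{n}$ for $t\in\{1,3,5\}$ and $\frac{(n-2)\pi}{n}-\frac{\pi}{n}$ for $t\in\{2,4,6\}$; - as $n\to\infty$ along the multiples of $6$, $\overline\Delta(P_n)\to C_*$. Numerically, $C_*\approx 1.304457$, with error less than $5\cdot10^{-7}$. Moreover, \[ \liminf_{n\to\infty}\overline\Delta_{\max}(n)\ \ge\ C_*^{1/9}>1, \] where $n$ runs over all positive integers and the $\liminf$ is taken in $[-\infty,\infty]$. -/

import Mathlib

open Filter Topology

noncomputable section

/-- The discriminant `∏_{i ≠ j} |z_i - z_j|` of a configuration of `n` points in the plane,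
the product being over ordered pairs of distinct indices (an empty product is `1`). -/
def discr {n : ℕ} (z : Fin n → ℂ) : ℝ :=
  ∏ i, ∏ j ∈ Finset.univ.erase i, ‖z i - z j‖

/-- The normalized discriminant `Δ(z) / n ^ n`. -/
def normDiscr {n : ℕ} (z : Fin n → ℂ) : ℝ :=
  discr z / (n : ℝ) ^ n

/-- The supremum of the discriminant over all configurations of `n` points with mutual distances
at most `2`. The set is nonempty and bounded above by `2 ^ (n * (n - 1))`. -/
def discrMax (n : ℕ) : ℝ :=
  sSup {d : ℝ | ∃ z : Fin n → ℂ, (∀ i j, ‖z i - z j‖ ≤ 2) ∧ discr z = d}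

/-- The normalized maximal discriminant. -/
def normDiscrMax (n : ℕ) : ℝ :=
  discrMax n / (n : ℝ) ^ n

/-- The `m`-th vertex of the regular `n`-gon with centre `0` and circumradius `r`, the vertices
being numbered counterclockwise. -/
def regularVertex (n : ℕ) (r : ℝ) (m : ℕ) : ℂ :=
  (r : ℂ) * Complex.exp ((2 * Real.pi * m / n : ℝ) * Complex.I)

/-- The prescribed internal angle at the junction vertex number `t * k` of a `6 * k`-gon: the
internal angle `(n - 2) π / n` of the regular `n`-gon, `n = 6 * k`, increased by `π / n` if `t` is
odd and decreased by `π / n` if `t` is even. -/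
def junctionAngle (k t : ℕ) : ℝ :=
  ((6 * k : ℝ) - 2) * Real.pi / (6 * k) +
    (if Odd t then Real.pi / (6 * k) else -(Real.pi / (6 * k)))

/-- `B 0, B 1, …, B (6 * k) = B 0` are the vertices, in counterclockwise order, of a closed
polygon obtained by gluing, at perturbed angles, six arcs of a regular `6 * k`-gon of circumradius
`r`. -/
structure IsSixArcPolygon (k : ℕ) (r : ℝ) (B : ℕ → ℂ) : Prop where
  /-- Indices are taken modulo `6 * k`. -/
  periodic : ∀ m, B (m + 6 * k) = B m
  /-- Each of the six arcs is carried onto the corresponding arc of the regular polygon by an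
  orientation-preserving isometry of the plane. -/
  arc : ∀ j < 6, ∃ u v : ℂ, ‖u‖ = 1 ∧
    ∀ i ≤ k, B (j * k + i) = u * regularVertex (6 * k) r (j * k + i) + v
  /-- Internal angles at the junctions: turning the edge from `B (t * k)` to its successor
  counterclockwise by the internal angle gives the edge from `B (t * k)` to its predecessor
  (the two edges have the same length). -/
  junction : ∀ t, 1 ≤ t → t ≤ 6 →
    B (t * k - 1) - B (t * k) =
      Complex.exp ((junctionAngle k t : ℂ) * Complex.I) * (B (t * k + 1) - B (t * k))

/-- The constant `C_* = 3 ^ (9 / 4) / 2 ^ 3 * exp ((π² - 2 √3 π) / 8)`. -/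
def Cstar : ℝ :=
  (3 : ℝ) ^ ((9 : ℝ) / 4) / 2 ^ 3 *
    Real.exp ((Real.pi ^ 2 - 2 * Real.sqrt 3 * Real.pi) / 8)

end

/-! Put `n = 6k` and `ε = π/(2n)` (`stepAngle`). A regular `n`-gon of circumradius `1` has diameter
`2`, attained at antipodal pairs. Cut it into six arcs, rotate arc number `j` through `(-1)^j ε`,
and translate the arcs so that consecutive ones still share a vertex. Opposite arcs are now turned
against each other by `2ε`, so every formerly antipodal pair is misaligned. The diameter falls to `2
cos ε`, and there is room to rescale by `1 / cos ε`. That all other pairs also stay within `2 cos ε`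
is `arcDist_vertex_le`; it rests on the closed formulas for distances between arcs one, two and
three places apart (`arcDist_one_sq`, `arcDist_two_sq`, `arcDist_three_sq`).

The regular `n`-gon of circumradius `1` has discriminant `n^n`. Hence the logarithm of the
normalized discriminant is the gain `n(n-1) log (1 / cos ε)`, which tends to `π²/8`, plus the sum
`glueSum 1 k` of the logarithms of all ratios of glued distance to regular distance. Single ratios
deviate from `1` to first order in `ε`. Suitable products of two of them deviate only by `sin² ε`
times a bounded coefficient (`ratioOne_mul`, `ratioTwo_mul_swap`, `ratioTwo_neg_mul_swap`,
`ratioThree_mul`). The double sum of about `k²` terms of size `k⁻²` is then a Riemann sum. Its limit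
is an explicit double integral with value `9/4 log 3 - 3 log 2 - √3 π/4`, and adding `π²/8` gives
`log C_*`.

For the liminf, an odd regular polygon rescaled to diameter at most `2` already has normalized
discriminant at least `1.4`. For `2k` points, split the `6k` vertices into three classes modulo `3`.
Each class is a perturbed regular `2k`-gon, and the best one is at least the geometric mean of the
three. Since the ratios vary slowly, the pairs in a common class carry asymptotically one third of
the full sum (`tendsto_sum_sum_residue`). The mean over three classes gives another third, and the
radius gain for `2k` points is one ninth of that for `6k`. So the exponent is `(log C_*)/9`. -/

/-! ### Riemann sums in two variables and residue classes -/

theorem intervalIntegral_natFloor_mul (k : ℕ) (hk : 0 < k) (g : ℕ → ℝ) :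
    ∫ x in (0 : ℝ)..1, g ⌊(k : ℝ) * x⌋₊ = (∑ a ∈ Finset.range k, g a) / k := by
  have hk' : (0 : ℝ) < k := by exact_mod_cast hk
  have h1 : ∀ a : ℕ, ∀ x ∈ Set.Ico (a : ℝ) (a + 1 : ℕ), g ⌊x⌋₊ = g a := by
    intro a x hx
    rw [(Nat.floor_eq_iff (le_trans (Nat.cast_nonneg a) hx.1)).2 ⟨hx.1, by simpa using hx.2⟩]
  have hae : ∀ a : ℕ, (fun x : ℝ => g ⌊x⌋₊)
      =ᵐ[MeasureTheory.volume.restrict (Set.uIoc (a : ℝ) (a + 1 : ℕ))] fun _ => g a := by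
    intro a
    rw [Set.uIoc_of_le (by push_cast; linarith), ← MeasureTheory.restrict_Ico_eq_restrict_Ioc]
    exact (MeasureTheory.ae_restrict_iff' measurableSet_Ico).2
      (Eventually.of_forall fun x hx => h1 a x hx)
  have hint : ∀ a < k, IntervalIntegrable (fun x : ℝ => g ⌊x⌋₊) MeasureTheory.volume
      ((a : ℕ) : ℝ) ((a + 1 : ℕ) : ℝ) := fun a _ =>
    (intervalIntegrable_const (c := g a)).congr_ae (hae a).symm
  have h2 := intervalIntegral.sum_integral_adjacent_intervals (f := fun x : ℝ => g ⌊x⌋₊)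
    (a := fun a : ℕ => (a : ℝ)) (n := k) hint
  have h3 : ∀ a : ℕ, ∫ x in (a : ℝ)..(a + 1 : ℕ), g ⌊x⌋₊ = g a := by
    intro a
    rw [intervalIntegral.integral_congr_ae_restrict (hae a)]
    simp
  simp only [h3] at h2
  rw [intervalIntegral.integral_comp_mul_left (fun x : ℝ => g ⌊x⌋₊) hk'.ne', mul_zero, mul_one, h2]
  simp [div_eq_inv_mul]

theorem tendsto_floor_mul_div (x : ℝ) (hx : 0 ≤ x) :
    Tendsto (fun k : ℕ => (⌊(k : ℝ) * x⌋₊ : ℝ) / k) atTop (𝓝 x) := by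
  have := (tendsto_nat_floor_mul_div_atTop hx).comp (tendsto_natCast_atTop_atTop (R := ℝ))
  refine this.congr fun k => ?_
  simp [mul_comm]

/-- A double sum over `k × k` whose terms are `k⁻²` times a bounded, asymptotically
scale-invariant quantity converges to the double integral of the limit. -/
theorem tendsto_sum_sum_integral {f : ℕ → ℕ → ℕ → ℝ} {φ : ℝ → ℝ → ℝ} {C : ℝ}
    (hb : ∀ᶠ k : ℕ in atTop, ∀ a < k, ∀ b < k, |(k : ℝ) ^ 2 * f k a b| ≤ C)
    (hl : ∀ x ∈ Set.Ioo (0 : ℝ) 1, ∀ y ∈ Set.Ioo (0 : ℝ) 1,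
      Tendsto (fun k : ℕ => (k : ℝ) ^ 2 * f k ⌊(k : ℝ) * x⌋₊ ⌊(k : ℝ) * y⌋₊) atTop (𝓝 (φ x y))) :
    Tendsto (fun k : ℕ => ∑ a ∈ Finset.range k, ∑ b ∈ Finset.range k, f k a b) atTop
      (𝓝 (∫ x in (0 : ℝ)..1, ∫ y in (0 : ℝ)..1, φ x y)) := by
  have hfl : ∀ k : ℕ, 0 < k → ∀ x ∈ Set.Ioo (0 : ℝ) 1, ⌊(k : ℝ) * x⌋₊ < k := by
    intro k hk x hx
    have hk' : (0 : ℝ) < k := by exact_mod_cast hk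
    rw [Nat.floor_lt (by nlinarith [hx.1])]
    nlinarith [hx.2]
  -- At `x = 1` the floor equals `k`, outside the range of the hypotheses; this endpoint is a null
  -- set.
  have hne : ∀ᵐ x : ℝ ∂MeasureTheory.volume, x ∈ Set.uIoc (0 : ℝ) 1 → x ∈ Set.Ioo (0 : ℝ) 1 := by
    have : ∀ᵐ x : ℝ ∂MeasureTheory.volume, x ≠ 1 := by
      simp [MeasureTheory.ae_iff]
    filter_upwards [this] with x hx h
    rw [Set.uIoc_of_le zero_le_one] at h
    exact ⟨h.1, lt_of_le_of_ne h.2 hx⟩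
  have hmeas : ∀ (k : ℕ) (g : ℕ → ℝ), MeasureTheory.AEStronglyMeasurable
      (fun x : ℝ => g ⌊(k : ℝ) * x⌋₊)
      (MeasureTheory.volume.restrict (Set.uIoc (0 : ℝ) 1)) := fun k g =>
    ((measurable_of_countable g).comp
      (Nat.measurable_floor.comp (measurable_const_mul (k : ℝ)))).aestronglyMeasurable
  set G : ℕ → ℕ → ℝ := fun k a => ∫ y in (0 : ℝ)..1, (k : ℝ) ^ 2 * f k a ⌊(k : ℝ) * y⌋₊ with hG
  have inner : ∀ x ∈ Set.Ioo (0 : ℝ) 1,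
      Tendsto (fun k : ℕ => G k ⌊(k : ℝ) * x⌋₊) atTop (𝓝 (∫ y in (0 : ℝ)..1, φ x y)) := by
    intro x hx
    refine intervalIntegral.tendsto_integral_filter_of_dominated_convergence (fun _ => C) ?_ ?_
      intervalIntegrable_const ?_
    · exact Eventually.of_forall fun k =>
        hmeas k (fun b => (k : ℝ) ^ 2 * f k ⌊(k : ℝ) * x⌋₊ b)
    · filter_upwards [hb, eventually_gt_atTop 0] with k hk hk0
      filter_upwards [hne] with y hy hy'
      exact hk _ (hfl k hk0 x hx) _ (hfl k hk0 y (hy hy'))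
    · filter_upwards [hne] with y hy hy'
      exact hl x hx y (hy hy')
  have outer : Tendsto (fun k : ℕ => ∫ x in (0 : ℝ)..1, G k ⌊(k : ℝ) * x⌋₊) atTop
      (𝓝 (∫ x in (0 : ℝ)..1, ∫ y in (0 : ℝ)..1, φ x y)) := by
    refine intervalIntegral.tendsto_integral_filter_of_dominated_convergence (fun _ => C) ?_ ?_
      intervalIntegrable_const ?_
    · exact Eventually.of_forall fun k => hmeas k (G k)
    · filter_upwards [hb, eventually_gt_atTop 0] with k hk hk0
      filter_upwards [hne] with x hx hx'
      have := intervalIntegral.norm_integral_le_of_norm_le_const_ae (a := (0 : ℝ)) (b := 1)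
        (f := fun y => (k : ℝ) ^ 2 * f k ⌊(k : ℝ) * x⌋₊ ⌊(k : ℝ) * y⌋₊) (C := C) (by
          filter_upwards [hne] with y hy hy'
          exact hk _ (hfl k hk0 x (hx hx')) _ (hfl k hk0 y (hy hy')))
      rwa [sub_zero, abs_one, mul_one] at this
    · filter_upwards [hne] with x hx hx'
      exact inner x (hx hx')
  refine outer.congr' ?_
  filter_upwards [eventually_gt_atTop 0] with k hk
  have hk' : (k : ℝ) ≠ 0 := by exact_mod_cast hk.ne'
  rw [intervalIntegral_natFloor_mul k hk (G k), Finset.sum_div]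
  refine Finset.sum_congr rfl fun a _ => ?_
  rw [hG]
  simp only
  rw [intervalIntegral_natFloor_mul k hk (fun b => (k : ℝ) ^ 2 * f k a b), ← Finset.mul_sum]
  field_simp

/-- The restriction of a slowly varying double sum to a residue class of `a + b` modulo `q`
retains the proportion `1 / q` of the sum. -/
theorem tendsto_sum_sum_residue {f : ℕ → ℕ → ℕ → ℝ} {φ : ℝ → ℝ → ℝ} {C : ℝ}
    (hb : ∀ᶠ k : ℕ in atTop, ∀ a < k, ∀ b < k, |(k : ℝ) ^ 2 * f k a b| ≤ C)
    (hl : ∀ x ∈ Set.Ioo (0 : ℝ) 1, ∀ y ∈ Set.Ioo (0 : ℝ) 1, ∀ a b : ℕ → ℕ,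
      Tendsto (fun k : ℕ => (a k : ℝ) / k) atTop (𝓝 x) →
      Tendsto (fun k : ℕ => (b k : ℝ) / k) atTop (𝓝 y) →
      Tendsto (fun k : ℕ => (k : ℝ) ^ 2 * f k (a k) (b k)) atTop (𝓝 (φ x y)))
    (q : ℕ) [NeZero q] (c : ℕ → ZMod q) :
    Tendsto (fun k : ℕ => ∑ a ∈ Finset.range k, ∑ b ∈ Finset.range k,
      if (a + b : ZMod q) = c k then f k a b else 0) atTop
      (𝓝 ((∫ x in (0 : ℝ)..1, ∫ y in (0 : ℝ)..1, φ x y) / q)) := by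
  set S : ℕ → ZMod q → ℝ := fun k c => ∑ a ∈ Finset.range k, ∑ b ∈ Finset.range k,
      if (a + b : ZMod q) = c then f k a b else 0 with hS
  set D : ℕ → ℝ := fun k => ∑ a ∈ Finset.range k, ∑ b ∈ Finset.range k,
      |if b + 1 < k then f k a (b + 1) - f k a b else 0| with hD
  have hq : (q : ℝ) ≠ 0 := by exact_mod_cast NeZero.ne q
  -- Replacing `b` by `b + 1` does not change the limit of `b / k`, so the scaled differences tend
  -- to `0` pointwise and the Riemann sum lemma applies with limit `0`.
  have hDlim : Tendsto D atTop (𝓝 0) := by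
    have := tendsto_sum_sum_integral (φ := fun _ _ => 0) (C := 2 * C)
      (f := fun k a b => |if b + 1 < k then f k a (b + 1) - f k a b else 0|) ?_ ?_
    · simpa using this
    · filter_upwards [hb, eventually_gt_atTop 0] with k hk hk0 a ha b hb'
      have h0 := hk a ha b hb'
      rw [abs_mul, abs_abs, ← abs_mul]
      split_ifs with h
      · have h1 := hk a ha (b + 1) h
        rw [mul_sub]
        exact (abs_sub _ _).trans (by linarith)
      · rw [mul_zero, abs_zero]
        linarith [abs_nonneg ((k : ℝ) ^ 2 * f k a b)]
    · intro x hx y hy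
      have ex := tendsto_floor_mul_div x hx.1.le
      have ey := tendsto_floor_mul_div y hy.1.le
      have ey' : Tendsto (fun k : ℕ => ((⌊(k : ℝ) * y⌋₊ + 1 : ℕ) : ℝ) / k) atTop (𝓝 y) := by
        have := ey.add tendsto_one_div_atTop_nhds_zero_nat
        rw [add_zero] at this
        refine this.congr fun k => ?_
        push_cast
        ring
      have h1 := ((hl x hx y hy _ _ ex ey').sub (hl x hx y hy _ _ ex ey)).abs
      rw [sub_self, abs_zero] at h1
      refine squeeze_zero (fun k => by positivity) (fun k => ?_) h1
      split_ifs
      · rw [← mul_sub, abs_mul, abs_of_nonneg (by positivity : (0 : ℝ) ≤ (k : ℝ) ^ 2)]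
      · simp
  -- Shifting `b` by one carries class `c` to class `c + 1`. The cost is `D k` plus two boundary
  -- terms of size `C / k²` in each of the `k` rows.
  have hstep : ∀ᶠ k : ℕ in atTop, ∀ c : ZMod q, |S k (c + 1) - S k c| ≤ D k + 2 * C / k := by
    filter_upwards [hb, eventually_gt_atTop 0] with k hk hk0 c
    obtain ⟨m, rfl⟩ : ∃ m, k = m + 1 := ⟨k - 1, by omega⟩
    have hm : (0 : ℝ) < ((m + 1 : ℕ) : ℝ) := by positivity
    have hfb : ∀ a < m + 1, ∀ b < m + 1, |f (m + 1) a b| ≤ C / ((m + 1 : ℕ) : ℝ) ^ 2 := by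
      intro a ha b hb'
      have := hk a ha b hb'
      rw [abs_mul, abs_of_nonneg (by positivity : (0 : ℝ) ≤ ((m + 1 : ℕ) : ℝ) ^ 2)] at this
      rw [le_div_iff₀ (by positivity)]
      linarith
    have hrow : ∀ a < m + 1,
        |(∑ b ∈ Finset.range (m + 1), if (a + b : ZMod q) = c + 1 then f (m + 1) a b else 0) -
          ∑ b ∈ Finset.range (m + 1), if (a + b : ZMod q) = c then f (m + 1) a b else 0| ≤
        (∑ b ∈ Finset.range (m + 1),
          |if b + 1 < m + 1 then f (m + 1) a (b + 1) - f (m + 1) a b else 0|) +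
          2 * (C / ((m + 1 : ℕ) : ℝ) ^ 2) := by
      intro a ha
      -- The term `b = 0` of class `c + 1` and the term `b = m` of class `c` have no partner under
      -- the shift.
      rw [Finset.sum_range_succ', Finset.sum_range_succ _ m, Finset.sum_range_succ _ m]
      have e1 : ∀ b : ℕ, ((a : ZMod q) + ((b + 1 : ℕ) : ZMod q) = c + 1) ↔ (a + b : ZMod q) = c := by
        intro b
        rw [Nat.cast_add, Nat.cast_one, ← add_assoc, add_left_inj]
      simp only [e1]
      have e2 : |(∑ b ∈ Finset.range m, if (a + b : ZMod q) = c then f (m + 1) a (b + 1) else 0) -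
          ∑ b ∈ Finset.range m, if (a + b : ZMod q) = c then f (m + 1) a b else 0| ≤
          ∑ b ∈ Finset.range m,
          |if b + 1 < m + 1 then f (m + 1) a (b + 1) - f (m + 1) a b else 0| := by
        rw [← Finset.sum_sub_distrib]
        refine (Finset.abs_sum_le_sum_abs _ _).trans (Finset.sum_le_sum fun b hb' => ?_)
        have hb2 : b + 1 < m + 1 := Nat.succ_lt_succ (Finset.mem_range.1 hb')
        rw [if_pos hb2]
        split_ifs
        · exact le_rfl
        · simp
      have e3 : ∀ (p : Prop) [Decidable p] (b : ℕ), b < m + 1 →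
          |if p then f (m + 1) a b else 0| ≤ C / ((m + 1 : ℕ) : ℝ) ^ 2 := by
        intro p _ b hb'
        split_ifs
        · exact hfb a ha b hb'
        · rw [abs_zero]
          exact (abs_nonneg _).trans (hfb a ha b hb')
      have e4 := e3 ((a : ZMod q) + ((0 : ℕ) : ZMod q) = c + 1) 0 (by omega)
      have e5 := e3 ((a : ZMod q) + (m : ZMod q) = c) m (by omega)
      have e6 := abs_nonneg (if m + 1 < m + 1 then f (m + 1) a (m + 1) - f (m + 1) a m else 0)
      rw [abs_le] at *
      constructor <;> linarith [e2.1, e2.2, e4.1, e4.2, e5.1, e5.2]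
    rw [hS, hD]
    simp only
    rw [← Finset.sum_sub_distrib]
    refine (Finset.abs_sum_le_sum_abs _ _).trans ((Finset.sum_le_sum fun a ha =>
      hrow a (by simpa using ha)).trans (le_of_eq ?_))
    rw [Finset.sum_add_distrib, Finset.sum_const, Finset.card_range, nsmul_eq_mul]
    field_simp
  have herr : Tendsto (fun k : ℕ => (q : ℝ) * (D k + 2 * C / k)) atTop (𝓝 0) := by
    have := (hDlim.add (tendsto_const_div_atTop_nhds_zero_nat (2 * C))).const_mul (q : ℝ)
    simpa using this
  have hdiff : ∀ᶠ k : ℕ in atTop, ∀ (i : ℕ) (c : ZMod q),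
      |S k (c + i) - S k c| ≤ i * (D k + 2 * C / k) := by
    filter_upwards [hstep] with k hk i c
    induction i with
    | zero => simp
    | succ i ih =>
      have h1 := hk (c + i)
      have h2 := abs_add_le (S k (c + i + 1) - S k (c + i)) (S k (c + i) - S k c)
      rw [sub_add_sub_cancel] at h2
      push_cast
      rw [← add_assoc]
      linarith
  have htot : ∀ k, ∑ c, S k c = ∑ a ∈ Finset.range k, ∑ b ∈ Finset.range k, f k a b := by
    intro k
    rw [hS]
    simp only
    rw [Finset.sum_comm]
    refine Finset.sum_congr rfl fun a _ => ?_
    rw [Finset.sum_comm]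
    refine Finset.sum_congr rfl fun b _ => ?_
    simp
  have hsum := (tendsto_sum_sum_integral hb (fun x hx y hy => hl x hx y hy _ _
    (tendsto_floor_mul_div x hx.1.le) (tendsto_floor_mul_div y hy.1.le))).div_const (q : ℝ)
  -- All `q` class sums differ by at most `q` shifts, so each is close to their average, which is
  -- the full sum divided by `q`.
  have hfin : Tendsto (fun k => S k (c k) -
      (∑ a ∈ Finset.range k, ∑ b ∈ Finset.range k, f k a b) / q) atTop (𝓝 0) := by
    refine squeeze_zero_norm' ?_ herr
    filter_upwards [hdiff, hstep] with k hk hk1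
    have hnn : 0 ≤ D k + 2 * C / k := (abs_nonneg _).trans (hk1 0)
    rw [← htot]
    have e : S k (c k) - (∑ d, S k d) / q = (∑ d, (S k (c k) - S k d)) / q := by
      rw [Finset.sum_sub_distrib, Finset.sum_const, Finset.card_univ, ZMod.card, nsmul_eq_mul]
      field_simp
    rw [e, Real.norm_eq_abs, abs_div, Nat.abs_cast, div_le_iff₀ (by positivity)]
    refine (Finset.abs_sum_le_sum_abs _ _).trans ?_
    have : ∀ d ∈ (Finset.univ : Finset (ZMod q)),
        |S k (c k) - S k d| ≤ q * (D k + 2 * C / k) := by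
      intro d _
      have h1 := hk (c k - d).val d
      rw [ZMod.natCast_zmod_val, add_sub_cancel] at h1
      refine h1.trans (mul_le_mul_of_nonneg_right ?_ hnn)
      exact_mod_cast (ZMod.val_lt _).le
    refine (Finset.sum_le_card_nsmul _ _ _ this).trans (le_of_eq ?_)
    rw [Finset.card_univ, ZMod.card, nsmul_eq_mul]
    ring
  have := hfin.add hsum
  rw [zero_add] at this
  exact this.congr fun k => by simp [hS]

/-! ### Distances between rotated and translated arcs -/

open Complex in
/-- The primitive sixth root of unity `exp (π i / 3)`. -/
noncomputable def sixthRoot : ℂ := exp ((Real.pi / 3 : ℝ) * I)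

theorem sixthRoot_sq : sixthRoot ^ 2 = sixthRoot - 1 := by
  have h : sixthRoot = 1 / 2 + (√3 / 2 : ℝ) * Complex.I := by
    rw [sixthRoot, Complex.exp_mul_I, ← Complex.ofReal_cos, ← Complex.ofReal_sin,
      Real.cos_pi_div_three, Real.sin_pi_div_three]
    push_cast
    ring
  have h3 : ((√3 : ℝ) : ℂ) ^ 2 = 3 := by
    rw [← Complex.ofReal_pow, Real.sq_sqrt (by norm_num)]
    norm_num
  rw [h]
  push_cast
  linear_combination Complex.I ^ 2 / 4 * h3 + 3 / 4 * Complex.I_sq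

theorem sixthRoot_pow_three : sixthRoot ^ 3 = -1 := by
  linear_combination (sixthRoot + 1) * sixthRoot_sq

theorem sixthRoot_pow_six : sixthRoot ^ 6 = 1 := by
  linear_combination (sixthRoot ^ 3 - 1) * sixthRoot_pow_three

theorem norm_sixthRoot : ‖sixthRoot‖ = 1 := Complex.norm_exp_ofReal_mul_I _

/-- A point at angle `θ` of the unit circle, moved by the rotation through `δ` and the translation
that make consecutive arcs of opposite `δ` fit together. -/
noncomputable def arcPoint (δ θ : ℝ) : ℂ :=
  Complex.exp (δ * Complex.I) * Complex.exp (θ * Complex.I) -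
    2 * Complex.I * Complex.sin δ * (1 + sixthRoot) / 3

theorem arcPoint_zero (θ : ℝ) : arcPoint 0 θ = Complex.exp (θ * Complex.I) := by
  simp [arcPoint]

/-- The distance between the point at angle `θ` of an arc and the point at angle `θ'` of the arc
that follows it `l` places later. -/
noncomputable def arcDist (l : ℕ) (δ θ θ' : ℝ) : ℝ :=
  ‖arcPoint δ θ - sixthRoot ^ l * arcPoint ((-1) ^ l * δ) θ'‖

theorem sq_norm_add_exp (p q u v : ℝ) :
    ‖(p : ℂ) * Complex.exp (u * Complex.I) + q * Complex.exp (v * Complex.I)‖ ^ 2 =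
      p ^ 2 + q ^ 2 + 2 * p * q * Real.cos (u - v) := by
  rw [Complex.sq_norm, Complex.normSq_apply]
  simp only [Complex.add_re, Complex.add_im, Complex.re_ofReal_mul, Complex.im_ofReal_mul,
    Complex.exp_ofReal_mul_I_re, Complex.exp_ofReal_mul_I_im, Real.cos_sub]
  linear_combination p ^ 2 * Real.sin_sq_add_cos_sq u + q ^ 2 * Real.sin_sq_add_cos_sq v

theorem two_I_mul_sin (z : ℂ) :
    2 * Complex.I * Complex.sin z = Complex.exp (z * Complex.I) - (Complex.exp (z * Complex.I))⁻¹ := by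
  rw [Complex.sin, ← Complex.exp_neg, neg_mul]
  linear_combination (Complex.exp (-(z * Complex.I)) - Complex.exp (z * Complex.I)) * Complex.I_sq

theorem two_mul_cos (z : ℂ) :
    2 * Complex.cos z = Complex.exp (z * Complex.I) + (Complex.exp (z * Complex.I))⁻¹ := by
  rw [Complex.cos, ← Complex.exp_neg, neg_mul]
  ring

theorem arcDist_zero_sq (δ θ θ' : ℝ) :
    arcDist 0 δ θ θ' ^ 2 = 4 * Real.sin ((θ - θ') / 2) ^ 2 := by
  have h : arcPoint δ θ - sixthRoot ^ 0 * arcPoint ((-1) ^ 0 * δ) θ' =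
      Complex.exp (δ * Complex.I) * (((1 : ℝ) : ℂ) * Complex.exp (θ * Complex.I) +
        ((-1 : ℝ) : ℂ) * Complex.exp (θ' * Complex.I)) := by
    rw [pow_zero, pow_zero, one_mul, one_mul, arcPoint, arcPoint]
    push_cast
    ring
  rw [arcDist, h, norm_mul, Complex.norm_exp_ofReal_mul_I, one_mul, sq_norm_add_exp]
  have : θ - θ' = 2 * ((θ - θ') / 2) := by ring
  rw [this, Real.cos_two_mul, ← this]
  linear_combination -4 * Real.sin_sq_add_cos_sq ((θ - θ') / 2)

/-- Opposite arcs undergo the same translation, which drops out. What remains is the distance of two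
points of the unit circle turned against each other by `2δ`. -/
theorem arcDist_three_sq (δ θ θ' : ℝ) :
    arcDist 3 δ θ θ' ^ 2 = 4 * Real.cos (δ + (θ - θ') / 2) ^ 2 := by
  have h : arcPoint δ θ - sixthRoot ^ 3 * arcPoint ((-1) ^ 3 * δ) θ' =
      ((1 : ℝ) : ℂ) * Complex.exp ((δ + θ : ℝ) * Complex.I) +
        ((1 : ℝ) : ℂ) * Complex.exp ((-δ + θ' : ℝ) * Complex.I) := by
    rw [sixthRoot_pow_three, arcPoint, arcPoint]
    push_cast
    simp only [Complex.exp_add, add_mul, Complex.sin_neg, neg_mul, one_mul,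
      show (-1 : ℂ) ^ 3 = -1 by norm_num]
    ring
  rw [arcDist, h, sq_norm_add_exp]
  have : δ + θ - (-δ + θ') = 2 * (δ + (θ - θ') / 2) := by ring
  rw [this, Real.cos_two_mul]
  ring

/-- The two points see the common junction along chords of lengths `2 sin A` and `2 sin B`. Gluing
changes the angle between the chords by `2δ`, and the formula is the law of cosines. -/
theorem arcDist_one_sq (δ A B : ℝ) :
    arcDist 1 δ (Real.pi / 3 - 2 * A) (2 * B) ^ 2 =
      4 * (Real.sin A ^ 2 + Real.sin B ^ 2 +
        2 * Real.sin A * Real.sin B * Real.cos (A + B - 2 * δ)) := by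
  have h : arcPoint δ (Real.pi / 3 - 2 * A) - sixthRoot ^ 1 * arcPoint ((-1) ^ 1 * δ) (2 * B) =
      -2 * Complex.I * sixthRoot * ((Real.sin A : ℂ) * Complex.exp ((δ - A : ℝ) * Complex.I) +
        (Real.sin B : ℂ) * Complex.exp ((B - δ : ℝ) * Complex.I)) := by
    have e1 : Complex.exp ((Real.pi / 3 - 2 * A : ℝ) * Complex.I) =
        sixthRoot * (Complex.exp (A * Complex.I) ^ 2)⁻¹ := by
      rw [sixthRoot, ← Complex.exp_nat_mul, ← Complex.exp_neg, ← Complex.exp_add]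
      congr 1
      push_cast
      ring
    have e2 : Complex.exp ((2 * B : ℝ) * Complex.I) = Complex.exp (B * Complex.I) ^ 2 := by
      rw [← Complex.exp_nat_mul]
      congr 1
      push_cast
      ring
    have e3 : Complex.exp ((δ - A : ℝ) * Complex.I) =
        Complex.exp (δ * Complex.I) * (Complex.exp (A * Complex.I))⁻¹ := by
      rw [← Complex.exp_neg, ← Complex.exp_add]
      congr 1
      push_cast
      ring
    have e4 : Complex.exp ((B - δ : ℝ) * Complex.I) =
        Complex.exp (B * Complex.I) * (Complex.exp (δ * Complex.I))⁻¹ := by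
      rw [← Complex.exp_neg, ← Complex.exp_add]
      congr 1
      push_cast
      ring
    have e5 : Complex.exp (((-1) ^ 1 * δ : ℝ) * Complex.I) = (Complex.exp (δ * Complex.I))⁻¹ := by
      rw [← Complex.exp_neg]
      congr 1
      push_cast
      ring
    have e6 : Complex.sin (((-1) ^ 1 * δ : ℝ) : ℂ) = - Complex.sin δ := by
      rw [← Complex.sin_neg]
      push_cast
      ring_nf
    have sA := two_I_mul_sin A
    have sB := two_I_mul_sin B
    have sD := two_I_mul_sin δ
    rw [arcPoint, arcPoint, e1, e2, e3, e4, e5, e6, Complex.ofReal_sin, Complex.ofReal_sin]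
    have nA := Complex.exp_ne_zero (A * Complex.I)
    have nB := Complex.exp_ne_zero (B * Complex.I)
    have nD := Complex.exp_ne_zero (δ * Complex.I)
    -- The identity is rational in the three exponentials and `w`, and holds modulo `w² = w - 1`.
    generalize Complex.exp (A * Complex.I) = X at *
    generalize Complex.exp (B * Complex.I) = Y at *
    generalize Complex.exp (δ * Complex.I) = E at *
    have hw := sixthRoot_sq
    generalize sixthRoot = w at *
    have : E * (w * (X ^ 2)⁻¹) - w * (E⁻¹ * Y ^ 2) - (E - E⁻¹) * w =
        -w * ((X - X⁻¹) * (E * X⁻¹) + (Y - Y⁻¹) * (Y * E⁻¹)) := by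
      field_simp
      ring
    linear_combination this - (2 * Complex.I * Complex.sin δ) / 3 * hw - w * sD
      + w * (E * X⁻¹) * sA + w * (Y * E⁻¹) * sB
  rw [arcDist, h, norm_mul, mul_pow, sq_norm_add_exp, norm_mul, norm_sixthRoot]
  have : δ - A - (B - δ) = -(A + B - 2 * δ) := by ring
  have h2 : ‖-2 * Complex.I‖ = 2 := by simp
  rw [this, Real.cos_neg, h2]
  ring

/-- Arcs two places apart are rotated through the same angle, and their translations differ by `-2i
sin δ`, because `(1 + w)(1 - w²) = 3`. The difference of the points is thus the rotated old chord,
of length `2 cos (A + B)` for the angles in use, plus a fixed vector. -/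
theorem arcDist_two_sq (δ A B : ℝ) :
    arcDist 2 δ (2 * A) (Real.pi / 3 - 2 * B) ^ 2 =
      4 * (Real.cos (A + B) ^ 2 + Real.sin δ ^ 2 -
        2 * Real.cos (A + B) * Real.sin δ * Real.sin (A - B + δ)) := by
  have h : arcPoint δ (2 * A) - sixthRoot ^ 2 * arcPoint ((-1) ^ 2 * δ) (Real.pi / 3 - 2 * B) =
      2 * ((Real.cos (A + B) : ℂ) * Complex.exp ((A - B + δ : ℝ) * Complex.I) +
        (Real.sin δ : ℂ) * Complex.exp ((-(Real.pi / 2) : ℝ) * Complex.I)) := by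
    have e1 : Complex.exp ((Real.pi / 3 - 2 * B : ℝ) * Complex.I) =
        sixthRoot * (Complex.exp (B * Complex.I) ^ 2)⁻¹ := by
      rw [sixthRoot, ← Complex.exp_nat_mul, ← Complex.exp_neg, ← Complex.exp_add]
      congr 1
      push_cast
      ring
    have e2 : Complex.exp ((2 * A : ℝ) * Complex.I) = Complex.exp (A * Complex.I) ^ 2 := by
      rw [← Complex.exp_nat_mul]
      congr 1
      push_cast
      ring
    have e3 : Complex.exp ((A - B + δ : ℝ) * Complex.I) = Complex.exp (A * Complex.I) *
        (Complex.exp (B * Complex.I))⁻¹ * Complex.exp (δ * Complex.I) := by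
      rw [← Complex.exp_neg, ← Complex.exp_add, ← Complex.exp_add]
      congr 1
      push_cast
      ring
    have e4 : Complex.exp ((-(Real.pi / 2) : ℝ) * Complex.I) = -Complex.I := by
      rw [Complex.exp_mul_I, ← Complex.ofReal_cos, ← Complex.ofReal_sin]
      simp
    have e5 : Complex.exp (((A : ℂ) + B) * Complex.I) =
        Complex.exp (A * Complex.I) * Complex.exp (B * Complex.I) := by
      rw [← Complex.exp_add]
      congr 1
      ring
    have cS := two_mul_cos ((A : ℂ) + B)
    rw [show (-1 : ℝ) ^ 2 * δ = δ by ring, arcPoint, arcPoint, e1, e2, e3, e4, Complex.ofReal_cos,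
      Complex.ofReal_sin]
    rw [e5] at cS
    push_cast
    have nA := Complex.exp_ne_zero (A * Complex.I)
    have nB := Complex.exp_ne_zero (B * Complex.I)
    generalize Complex.exp (A * Complex.I) = X at *
    generalize Complex.exp (B * Complex.I) = Y at *
    generalize Complex.exp (δ * Complex.I) = E at *
    have hw := sixthRoot_sq
    have hw3 := sixthRoot_pow_three
    generalize sixthRoot = w at *
    have : E * X ^ 2 + E * (Y ^ 2)⁻¹ = (X * Y + (X * Y)⁻¹) * (X * Y⁻¹ * E) := by
      field_simp
    linear_combination this - (X * Y⁻¹ * E) * cS - E * (Y ^ 2)⁻¹ * hw3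
      + (2 * Complex.I * Complex.sin δ) / 3 * (hw3 + hw)
  rw [arcDist, h, norm_mul, mul_pow, sq_norm_add_exp]
  have : A - B + δ - -(Real.pi / 2) = A - B + δ + Real.pi / 2 := by ring
  rw [this, Real.cos_add_pi_div_two]
  simp
  ring

theorem arcDist_nonneg (l : ℕ) (δ θ θ' : ℝ) : 0 ≤ arcDist l δ θ θ' := norm_nonneg _

/-- Going round the other way from the second arc, whose own rotation is `(-1)^l δ`, closes up since
`w⁶ = 1`. -/
theorem arcDist_symm {l m : ℕ} (h : l + m = 6) (δ θ θ' : ℝ) :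
    arcDist l δ θ θ' = arcDist m ((-1) ^ l * δ) θ' θ := by
  have h1 : arcPoint δ θ - sixthRoot ^ l * arcPoint ((-1) ^ l * δ) θ' =
      -sixthRoot ^ l * (arcPoint ((-1) ^ l * δ) θ' - sixthRoot ^ m * arcPoint δ θ) := by
    have : sixthRoot ^ l * sixthRoot ^ m = 1 := by rw [← pow_add, h, sixthRoot_pow_six]
    linear_combination -arcPoint δ θ * this
  have h2 : (-1 : ℝ) ^ m * ((-1) ^ l * δ) = δ := by
    rw [← mul_assoc, ← pow_add, add_comm, h]
    norm_num
  rw [arcDist, arcDist, h1, h2, norm_mul, norm_neg, norm_pow, norm_sixthRoot, one_pow, one_mul]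

/-- Consecutive arcs share their junction. The factor `1/3` in the translation is forced here by `(1
+ w)² = 3w`. The case `A = B = 0` of `arcDist_one_sq` says the same. -/
theorem arcPoint_continuation (δ : ℝ) :
    arcPoint δ (Real.pi / 3) = sixthRoot * arcPoint (-δ) 0 := by
  have h := arcDist_one_sq δ 0 0
  simp only [mul_zero, sub_zero, Real.sin_zero] at h
  have h0 : arcDist 1 δ (Real.pi / 3) 0 = 0 := by
    have : arcDist 1 δ (Real.pi / 3) 0 ^ 2 = 0 := by rw [h]; ring
    exact pow_eq_zero_iff two_ne_zero |>.1 this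
  rw [arcDist, norm_eq_zero, sub_eq_zero, pow_one, pow_one, neg_one_mul] at h0
  exact h0

/-! ### Distinct vertices and the diameter bound -/

/-- A quarter of the central angle of one edge of the regular `6 * k`-gon. -/
noncomputable def stepAngle (k : ℕ) : ℝ := Real.pi / (2 * (6 * k))

theorem stepAngle_pos {k : ℕ} (hk : 0 < k) : 0 < stepAngle k := by
  have : (0 : ℝ) < k := by exact_mod_cast hk
  rw [stepAngle]
  positivity

theorem stepAngle_mul {k : ℕ} (hk : 0 < k) : 2 * stepAngle k * k = Real.pi / 6 := by
  have : (0 : ℝ) < k := by exact_mod_cast hk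
  rw [stepAngle]
  field_simp

theorem stepAngle_le {k : ℕ} (hk : 0 < k) : stepAngle k ≤ Real.pi / 12 := by
  have h1 : (1 : ℝ) ≤ k := by exact_mod_cast hk
  nlinarith [stepAngle_mul hk, stepAngle_pos hk]

/-- The angle of the `a`-th vertex of an arc of the regular `6 * k`-gon. -/
noncomputable def vertexAngle (k a : ℕ) : ℝ := 4 * stepAngle k * a

theorem vertexAngle_eq_sub {k a : ℕ} (hk : 0 < k) :
    vertexAngle k a = Real.pi / 3 - 2 * (2 * stepAngle k * (k - a)) := by
  rw [vertexAngle]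
  linear_combination 2 * stepAngle_mul hk

theorem vertexAngle_eq {k a : ℕ} : vertexAngle k a = 2 * (2 * stepAngle k * a) := by
  rw [vertexAngle]
  ring

theorem two_mul_step_mem {k : ℕ} (hk : 0 < k) {t : ℝ} (h0 : 0 ≤ t) (h1 : t ≤ k) :
    0 ≤ 2 * stepAngle k * t ∧ 2 * stepAngle k * t ≤ Real.pi / 6 := by
  have := stepAngle_pos hk
  refine ⟨by positivity, ?_⟩
  rw [← stepAngle_mul hk]
  gcongr

/-- By product-to-sum formulas, left side minus right side equals `sin² ε - sin² (x - ε)`. This is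
used for arcs two places apart. -/
theorem two_mul_cos_add_mul_sin_le {ε x : ℝ} (h0 : 0 ≤ ε) (h1 : 2 * ε ≤ x) (h2 : x ≤ Real.pi / 3) :
    Real.cos x ^ 2 + Real.sin ε ^ 2 + 2 * Real.cos x * Real.sin ε * Real.sin (x - ε) ≤
      Real.cos ε ^ 2 := by
  have hpi := Real.pi_pos
  have h3 : Real.sin ε ≤ Real.sin (x - ε) :=
    Real.sin_le_sin_of_le_of_le_pi_div_two (by linarith) (by linarith) (by linarith)
  have h4 : 0 ≤ Real.sin ε := Real.sin_nonneg_of_nonneg_of_le_pi h0 (by linarith)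
  have e1 : 2 * Real.cos x * Real.sin ε = Real.sin (x + ε) - Real.sin (x - ε) := by
    rw [Real.sin_add, Real.sin_sub]
    ring
  have e2 : Real.cos x ^ 2 - Real.cos ε ^ 2 = -(Real.sin (x - ε) * Real.sin (x + ε)) := by
    rw [Real.sin_add, Real.sin_sub]
    linear_combination Real.cos ε ^ 2 * Real.sin_sq_add_cos_sq x -
      Real.cos x ^ 2 * Real.sin_sq_add_cos_sq ε
  rw [e1]
  nlinarith

/-- The left side is affine in `cos (A - B)` with slope `cos (A + B - 2δ) - cos (A + B)`. Bounding
first `δ` by `ε` and then `cos (A - B)` by `1` gives a perfect square `(sin (A + B - ε) + sin ε)²`.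
At the extreme `A + B = π/3` its root is `cos (π/6 - ε)`, and this is at most `cos ε`. -/
theorem sq_add_sq_add_mul_cos_le {ε δ A B : ℝ} (hδ : δ = ε ∨ δ = -ε) (h0 : 0 ≤ ε)
    (h1 : ε ≤ Real.pi / 12) (hA : 0 ≤ A) (hA' : A ≤ Real.pi / 6) (hB : 0 ≤ B)
    (hB' : B ≤ Real.pi / 6) (hAB : 2 * ε ≤ A + B) :
    Real.sin A ^ 2 + Real.sin B ^ 2 + 2 * Real.sin A * Real.sin B * Real.cos (A + B - 2 * δ) ≤
      Real.cos ε ^ 2 := by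
  have hpi := Real.pi_pos
  have sA : 0 ≤ Real.sin A := Real.sin_nonneg_of_nonneg_of_le_pi hA (by linarith)
  have sB : 0 ≤ Real.sin B := Real.sin_nonneg_of_nonneg_of_le_pi hB (by linarith)
  have hc : Real.cos (A + B - 2 * δ) ≤ Real.cos (A + B - 2 * ε) := by
    rcases hδ with rfl | rfl
    · exact le_rfl
    · exact Real.cos_le_cos_of_nonneg_of_le_pi (by linarith) (by linarith) (by linarith)
  have ht : Real.cos (A + B) ≤ Real.cos (A + B - 2 * ε) :=
    Real.cos_le_cos_of_nonneg_of_le_pi (by linarith) (by linarith) (by linarith)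
  have e1 : Real.sin A ^ 2 + Real.sin B ^ 2 = 1 - Real.cos (A + B) * Real.cos (A - B) := by
    rw [Real.cos_add, Real.cos_sub]
    linear_combination Real.cos B ^ 2 * Real.sin_sq_add_cos_sq A
      + (1 - Real.sin A ^ 2) * Real.sin_sq_add_cos_sq B
  have e2 : 2 * Real.sin A * Real.sin B = Real.cos (A - B) - Real.cos (A + B) := by
    rw [Real.cos_add, Real.cos_sub]
    ring
  have h2 : Real.sin A ^ 2 + Real.sin B ^ 2 +
      2 * Real.sin A * Real.sin B * Real.cos (A + B - 2 * δ) ≤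
      (1 - Real.cos (A + B)) * (1 + Real.cos (A + B - 2 * ε)) := by
    have := mul_le_mul_of_nonneg_left hc (by positivity : 0 ≤ 2 * Real.sin A * Real.sin B)
    have h3 := mul_nonneg (sub_nonneg.2 (Real.cos_le_one (A - B))) (sub_nonneg.2 ht)
    rw [e2] at this ⊢
    rw [e1]
    nlinarith
  have e3 : (1 - Real.cos (A + B)) * (1 + Real.cos (A + B - 2 * ε)) =
      (Real.sin (A + B - ε) + Real.sin ε) ^ 2 := by
    have u1 : Real.sin (A + B - ε) + Real.sin ε =
        2 * Real.sin ((A + B) / 2) * Real.cos ((A + B) / 2 - ε) := by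
      have key : ∀ x y : ℝ, Real.sin (x + y) + Real.sin (x - y) = 2 * Real.sin x * Real.cos y := by
        intro x y
        rw [Real.sin_add, Real.sin_sub]
        ring
      rw [← key]
      congr 2 <;> ring
    have u2 : A + B - 2 * ε = 2 * ((A + B) / 2 - ε) := by ring
    have u3 : Real.cos (A + B) = 1 - 2 * Real.sin ((A + B) / 2) ^ 2 := by
      rw [← Real.cos_two_mul_eq_one_sub]
      congr 1
      ring
    rw [u1, u2, u3, Real.cos_two_mul]
    ring
  have h4 : Real.sin (A + B - ε) ≤ Real.sin (Real.pi / 3 - ε) :=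
    Real.sin_le_sin_of_le_of_le_pi_div_two (by linarith) (by linarith) (by linarith)
  have h5 : Real.sin (Real.pi / 3 - ε) + Real.sin ε = Real.cos (Real.pi / 6 - ε) := by
    rw [Real.sin_sub, Real.cos_sub, Real.sin_pi_div_three, Real.cos_pi_div_three,
      Real.sin_pi_div_six, Real.cos_pi_div_six]
    ring
  have h6 : Real.cos (Real.pi / 6 - ε) ≤ Real.cos ε :=
    Real.cos_le_cos_of_nonneg_of_le_pi h0 (by linarith) (by linarith)
  have h7 : 0 ≤ Real.sin (A + B - ε) :=
    Real.sin_nonneg_of_nonneg_of_le_pi (by linarith) (by linarith)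
  have h8 : 0 ≤ Real.sin ε := Real.sin_nonneg_of_nonneg_of_le_pi h0 (by linarith)
  rw [e3] at h2
  exact h2.trans (pow_le_pow_left₀ (by linarith) (by linarith) 2)

section
variable {k : ℕ} {a b : ℕ} {δ : ℝ}

theorem arcDist_one_vertex_sq (hk : 0 < k) :
    arcDist 1 δ (vertexAngle k a) (vertexAngle k b) ^ 2 =
      4 * (Real.sin (2 * stepAngle k * (k - a)) ^ 2 + Real.sin (2 * stepAngle k * b) ^ 2 +
        2 * Real.sin (2 * stepAngle k * (k - a)) * Real.sin (2 * stepAngle k * b) *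
          Real.cos (2 * stepAngle k * (k - a) + 2 * stepAngle k * b - 2 * δ)) := by
  rw [vertexAngle_eq_sub hk (a := a), vertexAngle_eq (a := b), arcDist_one_sq]

theorem arcDist_two_vertex_sq (hk : 0 < k) :
    arcDist 2 δ (vertexAngle k a) (vertexAngle k b) ^ 2 =
      4 * (Real.cos (2 * stepAngle k * a + 2 * stepAngle k * (k - b)) ^ 2 + Real.sin δ ^ 2 -
        2 * Real.cos (2 * stepAngle k * a + 2 * stepAngle k * (k - b)) * Real.sin δ *
          Real.sin (2 * stepAngle k * a - 2 * stepAngle k * (k - b) + δ)) := by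
  rw [vertexAngle_eq_sub hk (a := b), vertexAngle_eq (a := a), arcDist_two_sq]

theorem arcDist_three_vertex_sq :
    arcDist 3 δ (vertexAngle k a) (vertexAngle k b) ^ 2 =
      4 * Real.cos (δ + 2 * stepAngle k * (a - b)) ^ 2 := by
  rw [vertexAngle_eq (a := a), vertexAngle_eq (a := b), arcDist_three_sq]
  ring_nf

/-- Needed both for the glued polygon and, with `δ = 0`, for the regular one, whose distances are
the denominators of the ratios. -/
theorem arcDist_vertex_pos (hk : 0 < k) (ha : a < k) (hb : b < k) (hδ : |δ| ≤ stepAngle k)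
    {l : ℕ} (hl : l < 6) (hne : l ≠ 0 ∨ a ≠ b) :
    0 < arcDist l δ (vertexAngle k a) (vertexAngle k b) := by
  have hpi := Real.pi_pos
  have hε := stepAngle_pos hk
  have hε' := stepAngle_le hk
  have hm := stepAngle_mul hk
  have low : ∀ {a b : ℕ} {δ : ℝ} (l : ℕ), a < k → b < k → |δ| ≤ stepAngle k → l < 4 →
      (l ≠ 0 ∨ a ≠ b) → 0 < arcDist l δ (vertexAngle k a) (vertexAngle k b) := by
    intro a b δ l ha hb hδ hl hne
    have ha1 : (a : ℝ) + 1 ≤ k := by exact_mod_cast ha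
    have hb1 : (b : ℝ) + 1 ≤ k := by exact_mod_cast hb
    have ha0 : (0 : ℝ) ≤ a := Nat.cast_nonneg a
    have hb0 : (0 : ℝ) ≤ b := Nat.cast_nonneg b
    have hd := abs_le.1 hδ
    refine (arcDist_nonneg _ _ _ _).lt_of_ne' ?_
    rw [← pow_ne_zero_iff two_ne_zero]
    refine ne_of_gt ?_
    interval_cases l
    · have hab : (a : ℝ) - b ≠ 0 := by
        rw [sub_ne_zero]
        simpa using hne
      rw [arcDist_zero_sq]
      refine mul_pos (by norm_num) (pow_pos ?_ 2 |>.trans_eq (sq_abs _))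
      rw [abs_pos]
      have e : (vertexAngle k a - vertexAngle k b) / 2 = 2 * stepAngle k * (a - b) := by
        rw [vertexAngle, vertexAngle]
        ring
      rw [e]
      intro h
      rw [Real.sin_eq_zero_iff_of_lt_of_lt (by nlinarith) (by nlinarith)] at h
      simp [hε.ne', hab] at h
    · obtain ⟨u1, u2⟩ := two_mul_step_mem hk (t := (k : ℝ) - a) (by linarith) (by linarith)
      obtain ⟨v1, v2⟩ := two_mul_step_mem hk (t := (b : ℝ)) (by linarith) (by linarith)
      rw [arcDist_one_vertex_sq hk]
      have s1 : 0 < Real.sin (2 * stepAngle k * (k - a)) :=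
        Real.sin_pos_of_pos_of_lt_pi (by nlinarith) (by linarith)
      have s2 : 0 ≤ Real.sin (2 * stepAngle k * b) :=
        Real.sin_nonneg_of_nonneg_of_le_pi (by linarith) (by linarith)
      have s3 : 0 ≤ Real.cos (2 * stepAngle k * (k - a) + 2 * stepAngle k * b - 2 * δ) :=
        Real.cos_nonneg_of_neg_pi_div_two_le_of_le (by linarith) (by linarith)
      positivity
    · obtain ⟨u1, u2⟩ := two_mul_step_mem hk (t := (a : ℝ)) (by linarith) (by linarith)
      obtain ⟨v1, v2⟩ := two_mul_step_mem hk (t := (k : ℝ) - b) (by linarith) (by linarith)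
      rw [arcDist_two_vertex_sq hk]
      set x := 2 * stepAngle k * a + 2 * stepAngle k * (k - b)
      set y := 2 * stepAngle k * a - 2 * stepAngle k * (k - b) + δ
      have c1 : Real.cos (Real.pi / 3) ≤ Real.cos x :=
        Real.cos_le_cos_of_nonneg_of_le_pi (by linarith) (by linarith) (by linarith)
      have c2 : Real.sin δ < Real.sin (Real.pi / 6) :=
        Real.sin_lt_sin_of_lt_of_le_pi_div_two (by linarith) (by linarith) (by linarith)
      have c3 : Real.sin (-(Real.pi / 6)) < Real.sin δ :=
        Real.sin_lt_sin_of_lt_of_le_pi_div_two (by linarith) (by linarith) (by linarith)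
      rw [Real.cos_pi_div_three] at c1
      rw [Real.sin_neg] at c3
      rw [Real.sin_pi_div_six] at c2 c3
      -- Completing the square: the first base is positive because `cos x ≥ 1/2 > |sin δ|`.
      have e : Real.cos x ^ 2 + Real.sin δ ^ 2 - 2 * Real.cos x * Real.sin δ * Real.sin y =
          (Real.cos x - Real.sin δ * Real.sin y) ^ 2 + (Real.sin δ * Real.cos y) ^ 2 := by
        linear_combination -Real.sin δ ^ 2 * Real.sin_sq_add_cos_sq y
      have c4 : |Real.sin δ * Real.sin y| < 1 / 2 := by
        rw [abs_mul]
        have := abs_lt.2 ⟨c3, c2⟩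
        nlinarith [Real.abs_sin_le_one y, abs_nonneg (Real.sin δ)]
      have c5 : 0 < Real.cos x - Real.sin δ * Real.sin y := by linarith [(abs_lt.1 c4).2]
      rw [e]
      positivity
    · rw [arcDist_three_vertex_sq]
      have : 0 < Real.cos (δ + 2 * stepAngle k * (a - b)) :=
        Real.cos_pos_of_mem_Ioo ⟨by nlinarith, by nlinarith⟩
      positivity
  rcases lt_or_ge l 4 with h | h
  · exact low l ha hb hδ h hne
  · rw [arcDist_symm (m := 6 - l) (by omega)]
    refine low _ hb ha ?_ (by omega) (Or.inl (by omega))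
    rwa [abs_mul, abs_pow, abs_neg, abs_one, one_pow, one_mul]

theorem arcDist_vertex_le (hk : 0 < k) (ha : a < k) (hb : b < k)
    (hδ : δ = stepAngle k ∨ δ = -stepAngle k) {l : ℕ} (hl : l < 6) :
    arcDist l δ (vertexAngle k a) (vertexAngle k b) ≤ 2 * Real.cos (stepAngle k) := by
  have hpi := Real.pi_pos
  have hε := stepAngle_pos hk
  have hε' := stepAngle_le hk
  have hm := stepAngle_mul hk
  have hcos : Real.cos (Real.pi / 3) ≤ Real.cos (stepAngle k) :=
    Real.cos_le_cos_of_nonneg_of_le_pi (by linarith) (by linarith) (by linarith)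
  rw [Real.cos_pi_div_three] at hcos
  have low : ∀ {a b : ℕ} {δ : ℝ} (l : ℕ), a < k → b < k →
      (δ = stepAngle k ∨ δ = -stepAngle k) → l < 4 →
      arcDist l δ (vertexAngle k a) (vertexAngle k b) ≤ 2 * Real.cos (stepAngle k) := by
    intro a b δ l ha hb hδ hl
    have ha1 : (a : ℝ) + 1 ≤ k := by exact_mod_cast ha
    have hb1 : (b : ℝ) + 1 ≤ k := by exact_mod_cast hb
    have ha0 : (0 : ℝ) ≤ a := Nat.cast_nonneg a
    have hb0 : (0 : ℝ) ≤ b := Nat.cast_nonneg b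
    refine (pow_le_pow_iff_left₀ (arcDist_nonneg _ _ _ _) (by linarith) two_ne_zero).1 ?_
    rw [mul_pow]
    interval_cases l
    · rw [arcDist_zero_sq]
      have e : (vertexAngle k a - vertexAngle k b) / 2 = 2 * stepAngle k * (a - b) := by
        rw [vertexAngle, vertexAngle]
        ring
      have s1 : Real.sin (2 * stepAngle k * (a - b)) ≤ Real.sin (Real.pi / 6) :=
        Real.sin_le_sin_of_le_of_le_pi_div_two (by nlinarith) (by linarith) (by nlinarith)
      have s2 : Real.sin (-(Real.pi / 6)) ≤ Real.sin (2 * stepAngle k * (a - b)) :=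
        Real.sin_le_sin_of_le_of_le_pi_div_two (by linarith) (by nlinarith) (by nlinarith)
      rw [Real.sin_neg] at s2
      rw [Real.sin_pi_div_six] at s1 s2
      rw [e]
      nlinarith
    · obtain ⟨u1, u2⟩ := two_mul_step_mem hk (t := (k : ℝ) - a) (by linarith) (by linarith)
      obtain ⟨v1, v2⟩ := two_mul_step_mem hk (t := (b : ℝ)) (by linarith) (by linarith)
      rw [arcDist_one_vertex_sq hk]
      have := sq_add_sq_add_mul_cos_le hδ hε.le hε' u1 u2 v1 v2 (by nlinarith)
      linarith
    · obtain ⟨u1, u2⟩ := two_mul_step_mem hk (t := (a : ℝ)) (by linarith) (by linarith)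
      obtain ⟨v1, v2⟩ := two_mul_step_mem hk (t := (k : ℝ) - b) (by linarith) (by linarith)
      -- Since `b < k` is strict, the second point is at least one edge away from the end of its
      -- arc. This supplies the condition `2ε ≤ A + B`.
      have v3 : 2 * stepAngle k ≤ 2 * stepAngle k * (k - b) := by nlinarith
      rw [arcDist_two_vertex_sq hk]
      generalize 2 * stepAngle k * (a : ℝ) = A at *
      generalize 2 * stepAngle k * ((k : ℝ) - b) = B at *
      generalize stepAngle k = ε at *
      have key := two_mul_cos_add_mul_sin_le hε.le (x := A + B) (by linarith) (by linarith)
      have c0 : 0 ≤ Real.cos (A + B) :=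
        Real.cos_nonneg_of_neg_pi_div_two_le_of_le (by linarith) (by linarith)
      have s0 : 0 ≤ Real.sin ε := Real.sin_nonneg_of_nonneg_of_le_pi hε.le (by linarith)
      have hs : -(Real.sin δ * Real.sin (A - B + δ)) ≤ Real.sin ε * Real.sin (A + B - ε) := by
        rcases hδ with rfl | rfl
        · rw [← mul_neg, ← Real.sin_neg]
          refine mul_le_mul_of_nonneg_left ?_ s0
          exact Real.sin_le_sin_of_le_of_le_pi_div_two (by linarith) (by linarith) (by linarith)
        · rw [Real.sin_neg, neg_mul, neg_neg]
          refine mul_le_mul_of_nonneg_left ?_ s0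
          exact Real.sin_le_sin_of_le_of_le_pi_div_two (by linarith) (by linarith) (by linarith)
      have hs2 : Real.sin δ ^ 2 = Real.sin ε ^ 2 := by
        rcases hδ with rfl | rfl
        · rfl
        · rw [Real.sin_neg, neg_sq]
      rw [hs2]
      nlinarith [mul_le_mul_of_nonneg_left hs c0]
    · rw [arcDist_three_vertex_sq]
      have h1 : |Real.cos (δ + 2 * stepAngle k * (a - b))| ≤ Real.cos (stepAngle k) := by
        have hc : 0 ≤ Real.cos (δ + 2 * stepAngle k * (a - b)) := by
          refine Real.cos_nonneg_of_neg_pi_div_two_le_of_le ?_ ?_ <;>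
          rcases hδ with rfl | rfl <;> nlinarith
        rw [abs_of_nonneg hc, ← Real.cos_abs (δ + _)]
        refine Real.cos_le_cos_of_nonneg_of_le_pi hε.le ?_ ?_
        · rw [abs_le]
          constructor <;> rcases hδ with rfl | rfl <;> nlinarith
        · have hz : ∃ z : ℤ, δ + 2 * stepAngle k * (a - b) = stepAngle k * (2 * z + 1) := by
            rcases hδ with rfl | rfl
            · exact ⟨a - b, by push_cast; ring⟩
            · exact ⟨a - b - 1, by push_cast; ring⟩
          obtain ⟨z, hz⟩ := hz
          rw [hz, abs_mul, abs_of_pos hε]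
          have : (1 : ℝ) ≤ |2 * (z : ℝ) + 1| := by
            have : (1 : ℤ) ≤ |2 * z + 1| := Int.one_le_abs (by omega)
            exact_mod_cast this
          nlinarith
      have := pow_le_pow_left₀ (abs_nonneg _) h1 2
      rw [sq_abs] at this
      linarith
  rcases lt_or_ge l 4 with h | h
  · exact low l ha hb hδ h
  · rw [arcDist_symm (m := 6 - l) (by omega)]
    refine low _ hb ha ?_ (by omega)
    rcases Nat.even_or_odd l with hl' | hl'
    · rwa [hl'.neg_one_pow, one_mul]
    · rw [hl'.neg_one_pow, neg_one_mul, neg_inj, neg_eq_iff_eq_neg]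
      exact hδ.symm

end

/-! ### The six-arc polygon: junctions, diameter, angles -/

/-- The `m`-th vertex of the polygon glued from six arcs of the regular `6 * k`-gon of
circumradius `1`, rotated alternately through `δ` and `-δ`. -/
noncomputable def gluedVertex (k : ℕ) (δ : ℝ) (m : ℕ) : ℂ :=
  sixthRoot ^ (m / k) * arcPoint ((-1) ^ (m / k) * δ) (vertexAngle k (m % k))

/-- The vertices of the six-arc polygon of diameter `2`. -/
noncomputable def sixArcVertex (k m : ℕ) : ℂ :=
  ((1 / Real.cos (Real.pi / (2 * (6 * k))) : ℝ) : ℂ) * gluedVertex k (stepAngle k) m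

section
variable {k : ℕ} {δ : ℝ}

theorem gluedVertex_mul_add {a : ℕ} (ha : a < k) (j : ℕ) :
    gluedVertex k δ (j * k + a) = sixthRoot ^ j * arcPoint ((-1) ^ j * δ) (vertexAngle k a) := by
  have h1 : (j * k + a) / k = j := by
    rw [mul_comm, Nat.mul_add_div (by omega), Nat.div_eq_of_lt ha, add_zero]
  have h2 : (j * k + a) % k = a := by
    rw [mul_comm, Nat.mul_add_mod, Nat.mod_eq_of_lt ha]
  rw [gluedVertex, h1, h2]

/-- A junction belongs to both adjacent arcs, so the formula of an arc remains valid at its last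
vertex `a = k`. -/
theorem gluedVertex_mul_add_of_le (hk : 0 < k) {a : ℕ} (ha : a ≤ k) (j : ℕ) :
    gluedVertex k δ (j * k + a) = sixthRoot ^ j * arcPoint ((-1) ^ j * δ) (vertexAngle k a) := by
  rcases ha.lt_or_eq with h | rfl
  · exact gluedVertex_mul_add h j
  · have h1 := gluedVertex_mul_add (k := a) (δ := δ) hk (j + 1)
    have h2 : vertexAngle a a = Real.pi / 3 := by
      rw [vertexAngle_eq_sub hk]
      ring
    have h3 : vertexAngle a 0 = 0 := by simp [vertexAngle]
    have h4 : (-1 : ℝ) ^ (j + 1) * δ = -((-1) ^ j * δ) := by ring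
    rw [add_zero, add_mul, one_mul, h3, h4] at h1
    rw [h1, h2, arcPoint_continuation, pow_succ, mul_assoc]

theorem gluedVertex_add_six_mul (hk : 0 < k) (m : ℕ) :
    gluedVertex k δ (m + 6 * k) = gluedVertex k δ m := by
  rw [gluedVertex, gluedVertex, Nat.add_mul_div_right _ _ hk, Nat.add_mul_mod_self_right, pow_add,
    pow_add, sixthRoot_pow_six]
  norm_num

theorem regularVertex_eq (hk : 0 < k) (r : ℝ) (j a : ℕ) :
    regularVertex (6 * k) r (j * k + a) =
      r * (sixthRoot ^ j * Complex.exp (vertexAngle k a * Complex.I)) := by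
  rw [regularVertex, sixthRoot, ← Complex.exp_nat_mul, ← Complex.exp_add]
  congr 2
  rw [vertexAngle, stepAngle]
  have : (k : ℂ) ≠ 0 := by exact_mod_cast hk.ne'
  push_cast
  field_simp
  ring

theorem gluedVertex_zero (hk : 0 < k) (m : ℕ) :
    gluedVertex k 0 m = regularVertex (6 * k) 1 m := by
  have h : m = m / k * k + m % k := (Nat.div_add_mod' m k).symm
  rw [h, gluedVertex_mul_add (Nat.mod_lt _ hk), regularVertex_eq hk, mul_zero, arcPoint_zero]
  simp

theorem norm_gluedVertex_sub {a b : ℕ} (ha : a < k) (hb : b < k) (j l : ℕ) :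
    ‖gluedVertex k δ (j * k + a) - gluedVertex k δ ((j + l) * k + b)‖ =
      arcDist l ((-1) ^ j * δ) (vertexAngle k a) (vertexAngle k b) := by
  have h : sixthRoot ^ j * arcPoint ((-1) ^ j * δ) (vertexAngle k a) -
      sixthRoot ^ (j + l) * arcPoint ((-1) ^ (j + l) * δ) (vertexAngle k b) =
      sixthRoot ^ j * (arcPoint ((-1) ^ j * δ) (vertexAngle k a) -
        sixthRoot ^ l * arcPoint ((-1) ^ l * ((-1) ^ j * δ)) (vertexAngle k b)) := by
    rw [show (-1 : ℝ) ^ (j + l) * δ = (-1) ^ l * ((-1) ^ j * δ) by ring]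
    ring
  rw [gluedVertex_mul_add ha, gluedVertex_mul_add hb, h, norm_mul, norm_pow, norm_sixthRoot,
    one_pow, one_mul, arcDist]

/-- A symmetric relation between vertices may be checked on pairs of arcs in increasing order. -/
theorem forall_lt_six_mul {P : ℕ → ℕ → Prop} (hk : 0 < k)
    (hsymm : ∀ p p', P p p' → P p' p)
    (h : ∀ j l a b, j + l < 6 → a < k → b < k → P (j * k + a) ((j + l) * k + b)) :
    ∀ p < 6 * k, ∀ p' < 6 * k, P p p' := by
  have key : ∀ p p', p' < 6 * k → p / k ≤ p' / k → P p p' := by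
    intro p p' hp' hle
    have h6 : p' / k < 6 := (Nat.div_lt_iff_lt_mul hk).2 hp'
    have := h (p / k) (p' / k - p / k) (p % k) (p' % k) (by omega) (Nat.mod_lt _ hk)
      (Nat.mod_lt _ hk)
    rwa [Nat.add_sub_cancel' hle, Nat.div_add_mod', Nat.div_add_mod'] at this
  intro p hp p' hp'
  rcases le_total (p / k) (p' / k) with hle | hle
  · exact key p p' hp' hle
  · exact hsymm _ _ (key p' p hp hle)

theorem abs_neg_one_pow_mul (j : ℕ) (δ : ℝ) : |(-1) ^ j * δ| = |δ| := by
  rw [abs_mul, abs_pow, abs_neg, abs_one, one_pow, one_mul]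

theorem gluedVertex_ne (hk : 0 < k) (hδ : |δ| ≤ stepAngle k) :
    ∀ p < 6 * k, ∀ p' < 6 * k, p ≠ p' → 0 < ‖gluedVertex k δ p - gluedVertex k δ p'‖ := by
  refine forall_lt_six_mul hk (fun p p' h hne => ?_) fun j l a b hjl ha hb hne => ?_
  · rw [norm_sub_rev]
    exact h hne.symm
  · rw [norm_gluedVertex_sub ha hb]
    refine arcDist_vertex_pos hk ha hb (by rwa [abs_neg_one_pow_mul]) (by omega) ?_
    by_contra! hc
    obtain ⟨rfl, rfl⟩ := hc
    exact hne (by rw [add_zero])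

theorem norm_gluedVertex_sub_le (hk : 0 < k) :
    ∀ p < 6 * k, ∀ p' < 6 * k,
      ‖gluedVertex k (stepAngle k) p - gluedVertex k (stepAngle k) p'‖ ≤
        2 * Real.cos (stepAngle k) := by
  refine forall_lt_six_mul hk (fun p p' h => ?_) fun j l a b hjl ha hb => ?_
  · rwa [norm_sub_rev]
  · rw [norm_gluedVertex_sub ha hb]
    refine arcDist_vertex_le hk ha hb ?_ (by omega)
    rcases Nat.even_or_odd j with hj | hj
    · left
      rw [hj.neg_one_pow, one_mul]
    · right
      rw [hj.neg_one_pow, neg_one_mul]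

theorem cos_stepAngle_pos (hk : 0 < k) : 0 < Real.cos (stepAngle k) := by
  have := stepAngle_pos hk
  have := stepAngle_le hk
  exact Real.cos_pos_of_mem_Ioo ⟨by linarith [Real.pi_pos], by linarith [Real.pi_pos]⟩

theorem norm_sixArcVertex_sub (hk : 0 < k) (p p' : ℕ) :
    ‖sixArcVertex k p - sixArcVertex k p'‖ =
      ‖gluedVertex k (stepAngle k) p - gluedVertex k (stepAngle k) p'‖ /
        Real.cos (stepAngle k) := by
  have := cos_stepAngle_pos hk
  rw [sixArcVertex, sixArcVertex, ← mul_sub, norm_mul, Complex.norm_real, ← stepAngle,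
    Real.norm_of_nonneg (by positivity)]
  ring

theorem norm_sixArcVertex_sub_le (hk : 0 < k) {p p' : ℕ} (hp : p < 6 * k) (hp' : p' < 6 * k) :
    ‖sixArcVertex k p - sixArcVertex k p'‖ ≤ 2 := by
  rw [norm_sixArcVertex_sub hk, div_le_iff₀ (cos_stepAngle_pos hk)]
  exact norm_gluedVertex_sub_le hk p hp p' hp'

/-- Opposite junctions are misaligned by exactly `ε`, so the diameter bound is attained. -/
theorem norm_sixArcVertex_sub_opposite (hk : 0 < k) :
    ‖sixArcVertex k 0 - sixArcVertex k (3 * k)‖ = 2 := by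
  have h := norm_gluedVertex_sub (δ := stepAngle k) hk hk 0 3
  have h2 := arcDist_three_sq (stepAngle k) (vertexAngle k 0) (vertexAngle k 0)
  have hc := cos_stepAngle_pos hk
  rw [sub_self, zero_div, add_zero, ← Real.sqrt_inj (by positivity) (by positivity),
    Real.sqrt_sq (arcDist_nonneg _ _ _ _),
    show 4 * Real.cos (stepAngle k) ^ 2 = (2 * Real.cos (stepAngle k)) ^ 2 by ring,
    Real.sqrt_sq (by positivity)] at h2
  rw [pow_zero, one_mul, zero_mul, zero_add, zero_add, add_zero, h2] at h
  rw [norm_sixArcVertex_sub hk, h]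
  field_simp

theorem diam_sixArcVertex (hk : 0 < k) :
    Metric.diam (Set.range fun i : Fin (6 * k) => sixArcVertex k i) = 2 := by
  refine le_antisymm (Metric.diam_le_of_forall_dist_le zero_le_two ?_) ?_
  · rintro _ ⟨i, rfl⟩ _ ⟨j, rfl⟩
    rw [dist_eq_norm]
    exact norm_sixArcVertex_sub_le hk i.2 j.2
  · rw [← norm_sixArcVertex_sub_opposite hk, ← dist_eq_norm]
    exact Metric.dist_le_diam_of_mem (Set.finite_range _).isBounded
      ⟨⟨0, by omega⟩, rfl⟩ ⟨⟨3 * k, by omega⟩, rfl⟩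

theorem sixArcVertex_injective (hk : 0 < k) :
    Function.Injective fun i : Fin (6 * k) => sixArcVertex k i := by
  intro i j h
  by_contra hne
  have h1 := gluedVertex_ne hk (abs_of_pos (stepAngle_pos hk)).le i i.2 j j.2
    (fun h => hne (Fin.ext h))
  have h2 := norm_sixArcVertex_sub hk i j
  rw [sub_eq_zero.2 h, norm_zero] at h2
  have := div_pos h1 (cos_stepAngle_pos hk)
  linarith

theorem isSixArcPolygon_sixArcVertex (hk : 0 < k) :
    IsSixArcPolygon k (1 / Real.cos (Real.pi / (2 * (6 * k)))) (sixArcVertex k) := by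
  set r : ℝ := 1 / Real.cos (Real.pi / (2 * (6 * k)))
  have hvert : ∀ j a, a ≤ k → sixArcVertex k (j * k + a) =
      r * (sixthRoot ^ j * arcPoint ((-1) ^ j * stepAngle k) (vertexAngle k a)) := by
    intro j a ha
    rw [sixArcVertex, gluedVertex_mul_add_of_le hk ha]
  refine ⟨fun m => ?_, fun j _ => ?_, fun t ht _ => ?_⟩
  · rw [sixArcVertex, sixArcVertex, gluedVertex_add_six_mul hk]
  · refine ⟨Complex.exp (((-1) ^ j * stepAngle k : ℝ) * Complex.I),
      -(r * sixthRoot ^ j * (2 * Complex.I * Complex.sin ((-1) ^ j * stepAngle k : ℝ) *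
        (1 + sixthRoot) / 3)), Complex.norm_exp_ofReal_mul_I _, fun i hi => ?_⟩
    rw [hvert j i hi, regularVertex_eq hk, arcPoint]
    ring
  · obtain ⟨s, rfl⟩ : ∃ s, t = s + 1 := ⟨t - 1, by omega⟩
    have e0 : (s + 1) * k - 1 = s * k + (k - 1) := by
      rw [add_mul, one_mul]
      omega
    have e1 : (s + 1) * k = s * k + k := by ring
    have e2 : sixArcVertex k ((s + 1) * k) =
        r * (sixthRoot ^ (s + 1) * arcPoint ((-1) ^ (s + 1) * stepAngle k) (vertexAngle k 0)) := by
      rw [← hvert _ _ (Nat.zero_le _), add_zero]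
    have d1 : sixArcVertex k ((s + 1) * k - 1) - sixArcVertex k ((s + 1) * k) =
        r * sixthRoot ^ s * Complex.exp (((-1) ^ s * stepAngle k : ℝ) * Complex.I) *
          (Complex.exp (vertexAngle k (k - 1) * Complex.I) -
            Complex.exp (vertexAngle k k * Complex.I)) := by
      rw [e0, hvert _ _ (by omega), e1, hvert _ _ le_rfl, arcPoint, arcPoint]
      ring
    have d2 : sixArcVertex k ((s + 1) * k + 1) - sixArcVertex k ((s + 1) * k) =
        r * sixthRoot ^ (s + 1) *
          Complex.exp (((-1) ^ (s + 1) * stepAngle k : ℝ) * Complex.I) *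
          (Complex.exp (vertexAngle k 1 * Complex.I) -
            Complex.exp (vertexAngle k 0 * Complex.I)) := by
      rw [hvert _ _ (by omega), e2, arcPoint, arcPoint]
      ring
    have hk' : (k : ℝ) ≠ 0 := by exact_mod_cast hk.ne'
    -- The arcs meeting here are rotated through `±ε` and `∓ε`, so the regular internal angle `π -
    -- 4ε` changes by `2ε = π / (6k)`, with the sign of the earlier arc.
    have hj : junctionAngle k (s + 1) =
        Real.pi - 4 * stepAngle k + 2 * ((-1) ^ s * stepAngle k) := by
      have hp : Real.pi / (6 * k) = 2 * stepAngle k := by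
        rw [stepAngle]
        field_simp
      have hq : ((6 * k : ℝ) - 2) * Real.pi / (6 * k) = Real.pi - 4 * stepAngle k := by
        rw [stepAngle]
        field_simp
        ring
      rw [junctionAngle, hp, hq]
      rcases Nat.even_or_odd s with h | h
      · rw [if_pos h.add_one, h.neg_one_pow]
        ring
      · rw [if_neg (by simpa using h.add_one), h.neg_one_pow]
        ring
    have f1 : Complex.exp (vertexAngle k k * Complex.I) = sixthRoot := by
      rw [sixthRoot, vertexAngle_eq_sub hk, sub_self, mul_zero, mul_zero, sub_zero]
    have f2 : Complex.exp (vertexAngle k (k - 1) * Complex.I) =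
        sixthRoot * (Complex.exp (vertexAngle k 1 * Complex.I))⁻¹ := by
      rw [← f1, ← Complex.exp_neg, ← Complex.exp_add, vertexAngle, vertexAngle, vertexAngle,
        Nat.cast_sub (by omega)]
      congr 1
      push_cast
      ring
    have f3 : Complex.exp (vertexAngle k 0 * Complex.I) = 1 := by simp [vertexAngle]
    have f4 : Complex.exp ((junctionAngle k (s + 1) : ℂ) * Complex.I) =
        -((Complex.exp (vertexAngle k 1 * Complex.I))⁻¹ *
          Complex.exp (((-1) ^ s * stepAngle k : ℝ) * Complex.I) ^ 2) := by
      rw [hj, ← Complex.exp_neg, ← Complex.exp_nat_mul, ← Complex.exp_add, ← neg_one_mul (Complex.exp _),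
        ← Complex.exp_pi_mul_I, ← Complex.exp_add, vertexAngle]
      congr 1
      push_cast
      ring
    have f5 : Complex.exp (((-1) ^ (s + 1) * stepAngle k : ℝ) * Complex.I) =
        (Complex.exp (((-1) ^ s * stepAngle k : ℝ) * Complex.I))⁻¹ := by
      rw [← Complex.exp_neg]
      congr 1
      push_cast
      ring
    have n1 := Complex.exp_ne_zero (vertexAngle k 1 * Complex.I)
    have n2 := Complex.exp_ne_zero (((-1) ^ s * stepAngle k : ℝ) * Complex.I)
    rw [d1, d2, f1, f2, f3, f4, f5]
    field_simp
    ring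

end

/-! ### The discriminant as a perturbation of that of a regular polygon -/

theorem sum_range_mul_eq {M : Type*} [AddCommMonoid M] (f : ℕ → M) (n k : ℕ) :
    ∑ p ∈ Finset.range (n * k), f p =
      ∑ j ∈ Finset.range n, ∑ a ∈ Finset.range k, f (j * k + a) := by
  induction n with
  | zero => simp
  | succ n ih => rw [Finset.sum_range_succ, add_mul, one_mul, Finset.sum_range_add, ih]

/-- After a rotation this is `∏ |1 - ζ^d|` over `0 < d < n`, the value at `1` of `1 + X + ⋯ +
X^(n-1)`. -/
theorem prod_norm_regularVertex_sub (n : ℕ) (i : Fin n) :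
    ∏ j ∈ Finset.univ.erase i, ‖regularVertex n 1 i - regularVertex n 1 j‖ = n := by
  obtain ⟨m, rfl⟩ : ∃ m, n = m + 1 := ⟨n - 1, by have := i.2; omega⟩
  set ζ : ℂ := Complex.exp (2 * Real.pi * Complex.I / (m + 1 : ℕ)) with hζ
  have hprim : IsPrimitiveRoot ζ (m + 1) := Complex.isPrimitiveRoot_exp _ (by omega)
  have hv : ∀ p : ℕ, regularVertex (m + 1) 1 p = ζ ^ p := by
    intro p
    rw [regularVertex, hζ, ← Complex.exp_nat_mul, Complex.ofReal_one, one_mul]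
    congr 1
    push_cast
    ring
  have hnorm : ‖ζ‖ = 1 := hprim.norm'_eq_one (by omega)
  have hmod : ∀ p : ℕ, ζ ^ (p % (m + 1)) = ζ ^ p := fun p => by
    conv_rhs => rw [← Nat.div_add_mod p (m + 1), pow_add, pow_mul, hprim.pow_eq_one, one_pow,
      one_mul]
  simp only [hv]
  have h1 : ∏ j ∈ Finset.univ.erase i, ‖ζ ^ (i : ℕ) - ζ ^ (j : ℕ)‖ =
      ∏ d ∈ Finset.univ.erase (0 : Fin (m + 1)), ‖1 - ζ ^ (d : ℕ)‖ := by
    symm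
    refine Finset.prod_bij (fun d _ => i + d) (fun d hd => ?_) (fun a _ b _ h => add_left_cancel h)
      (fun j hj => ⟨j - i, ?_, ?_⟩) (fun d _ => ?_)
    · simpa using hd
    · simpa [sub_eq_zero] using hj
    · abel
    · rw [Fin.val_add, hmod, pow_add, ← mul_one_sub, norm_mul, norm_pow, hnorm, one_pow, one_mul]
  have h2 := hprim.prod_one_sub_pow_eq_order
  rw [h1]
  have h3 : ∏ d ∈ Finset.univ.erase (0 : Fin (m + 1)), ‖1 - ζ ^ (d : ℕ)‖ =
      ∏ d : Fin m, ‖1 - ζ ^ ((d : ℕ) + 1)‖ := by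
    have : Finset.univ.erase (0 : Fin (m + 1)) = Finset.univ.image Fin.succ := by
      ext j
      simp
    rw [this, Finset.prod_image (fun a _ b _ h => Fin.succ_injective m h)]
    simp
  rw [h3, Fin.prod_univ_eq_prod_range (fun d => ‖1 - ζ ^ (d + 1)‖) m, ← norm_prod, h2]
  norm_cast

/-- Separates the three sources of the discriminant: the regular polygon, the scale, and the
logarithmic distortions `ρ`. -/
theorem discr_eq_of_norm_sub {n : ℕ} {z : Fin n → ℂ} {r : ℝ} {ρ : Fin n → Fin n → ℝ}
    (hρ : ∀ i, ρ i i = 0)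
    (h : ∀ i j, i ≠ j →
      ‖z i - z j‖ = r * ‖regularVertex n 1 i - regularVertex n 1 j‖ * Real.exp (ρ i j)) :
    discr z = (n : ℝ) ^ n * r ^ (n * (n - 1)) * Real.exp (∑ i, ∑ j, ρ i j) := by
  have h1 : ∀ i : Fin n, ∏ j ∈ Finset.univ.erase i, ‖z i - z j‖ =
      r ^ (n - 1) * n * Real.exp (∑ j, ρ i j) := by
    intro i
    rw [Finset.prod_congr rfl fun j hj => h i j (Finset.ne_of_mem_erase hj).symm,
      Finset.prod_mul_distrib, Finset.prod_mul_distrib, prod_norm_regularVertex_sub,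
      Finset.prod_const, Finset.card_erase_of_mem (Finset.mem_univ i), Finset.card_univ,
      Fintype.card_fin, ← Real.exp_sum, ← Finset.add_sum_erase _ _ (Finset.mem_univ i), hρ,
      zero_add]
  rw [discr, Finset.prod_congr rfl fun i _ => h1 i, Finset.prod_mul_distrib,
    Finset.prod_mul_distrib, Finset.prod_const, Finset.prod_const, ← Real.exp_sum,
    Finset.card_univ, Fintype.card_fin, ← pow_mul, mul_comm (n - 1) n]
  ring

/-- The logarithm of the factor by which gluing changes the distance of two vertices. -/
noncomputable def glueLog (k p p' : ℕ) : ℝ :=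
  Real.log (‖gluedVertex k (stepAngle k) p - gluedVertex k (stepAngle k) p'‖ /
    ‖gluedVertex k 0 p - gluedVertex k 0 p'‖)

/-- Here `0 / 0 = 0` and `log 0 = 0`, so diagonal pairs may stay in the sums. -/
theorem glueLog_self (k p : ℕ) : glueLog k p p = 0 := by simp [glueLog]

theorem glueLog_comm (k p p' : ℕ) : glueLog k p p' = glueLog k p' p := by
  rw [glueLog, glueLog, norm_sub_rev, norm_sub_rev (gluedVertex k 0 p)]

/-- The sum of `glueLog` over the ordered pairs of vertices whose numbers agree modulo `q`. -/
noncomputable def glueSum (q k : ℕ) : ℝ :=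
  ∑ p ∈ Finset.range (6 * k), ∑ p' ∈ Finset.range (6 * k),
    if (p : ZMod q) = p' then glueLog k p p' else 0

theorem norm_regularVertex_sub_subsequence {q n N : ℕ} (hN : q * n = N) (hq : 0 < q) (c i j : ℕ) :
    ‖regularVertex N 1 (i * q + c) - regularVertex N 1 (j * q + c)‖ =
      ‖regularVertex n 1 i - regularVertex n 1 j‖ := by
  have hq' : (q : ℂ) ≠ 0 := by exact_mod_cast hq.ne'
  have h : ∀ i : ℕ, regularVertex N 1 (i * q + c) =
      Complex.exp ((2 * Real.pi * c / N : ℝ) * Complex.I) * regularVertex n 1 i := by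
    intro i
    rcases Nat.eq_zero_or_pos n with rfl | hn
    · subst hN
      simp [regularVertex]
    have hn' : (n : ℂ) ≠ 0 := by exact_mod_cast hn.ne'
    rw [regularVertex, regularVertex, Complex.ofReal_one, one_mul, one_mul, ← Complex.exp_add,
      ← hN]
    congr 1
    push_cast
    field_simp
    ring
  rw [h, h, ← mul_sub, norm_mul, Complex.norm_exp_ofReal_mul_I, one_mul]

/-- Each class modulo `q` is a perturbed regular `n`-gon, and the distortions of all classes add up
to `glueSum q k`. The case `q = 1` is the whole polygon; `q = 3` serves the even numbers of points.
-/
theorem prod_discr_sixArcVertex {k q n : ℕ} (hk : 0 < k) (hq : 0 < q) (hn : n * q = 6 * k) :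
    ∏ c ∈ Finset.range q, discr (fun i : Fin n => sixArcVertex k (i * q + c)) =
      ((n : ℝ) ^ n * (1 / Real.cos (stepAngle k)) ^ (n * (n - 1))) ^ q *
        Real.exp (glueSum q k) := by
  have hc := cos_stepAngle_pos hk
  have hlt : ∀ c < q, ∀ i < n, i * q + c < 6 * k := by
    intro c hc i hi
    rw [← hn]
    calc i * q + c < i * q + q := by omega
      _ = (i + 1) * q := by ring
      _ ≤ n * q := Nat.mul_le_mul_right _ hi
  have h1 : ∀ c ∈ Finset.range q, discr (fun i : Fin n => sixArcVertex k (i * q + c)) =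
      (n : ℝ) ^ n * (1 / Real.cos (stepAngle k)) ^ (n * (n - 1)) *
        Real.exp (∑ i ∈ Finset.range n, ∑ j ∈ Finset.range n,
          glueLog k (i * q + c) (j * q + c)) := by
    intro c hcq
    rw [Finset.mem_range] at hcq
    rw [discr_eq_of_norm_sub (r := 1 / Real.cos (stepAngle k))
      (ρ := fun i j => glueLog k (i * q + c) (j * q + c)) (fun i => glueLog_self _ _),
      Finset.sum_range]
    · simp only [Finset.sum_range]
    · intro i j hij
      have hne : (i : ℕ) * q + c ≠ j * q + c := by
        intro h
        exact hij (Fin.ext (Nat.eq_of_mul_eq_mul_right hq (by omega)))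
      have p1 := gluedVertex_ne hk (abs_of_pos (stepAngle_pos hk)).le _ (hlt c hcq i i.2) _
        (hlt c hcq j j.2) hne
      have p0 := gluedVertex_ne hk (δ := 0) (by rw [abs_zero]; exact (stepAngle_pos hk).le) _
        (hlt c hcq i i.2) _ (hlt c hcq j j.2) hne
      rw [norm_sixArcVertex_sub hk, glueLog, Real.exp_log (div_pos p1 p0),
        ← norm_regularVertex_sub_subsequence (by rw [mul_comm, hn]) hq c,
        ← gluedVertex_zero hk, ← gluedVertex_zero hk]
      field_simp
  have h2 : glueSum q k = ∑ c ∈ Finset.range q, ∑ i ∈ Finset.range n, ∑ j ∈ Finset.range n,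
      glueLog k (i * q + c) (j * q + c) := by
    rw [glueSum, ← hn, sum_range_mul_eq, Finset.sum_comm]
    refine Finset.sum_congr rfl fun c hc => Finset.sum_congr rfl fun i _ => ?_
    rw [sum_range_mul_eq]
    refine Finset.sum_congr rfl fun j _ => ?_
    rw [Finset.sum_eq_single c]
    · simp
    · intro d hd hdc
      rw [if_neg]
      intro h
      push_cast at h
      simp only [CharP.cast_eq_zero, mul_zero, zero_add] at h
      rw [ZMod.natCast_eq_natCast_iff'] at h
      rw [Nat.mod_eq_of_lt (Finset.mem_range.1 hc), Nat.mod_eq_of_lt (Finset.mem_range.1 hd)] at h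
      exact hdc h.symm
    · intro h
      exact absurd hc h
  rw [Finset.prod_congr rfl h1, Finset.prod_mul_distrib, Finset.prod_const, Finset.card_range,
    ← Real.exp_sum, h2]

/-! ### Reduction to pairs of arcs -/

/-- The contribution to `glueSum q k` of a pair of arcs at distance `l`. -/
noncomputable def arcPairSum (q k l : ℕ) (δ : ℝ) : ℝ :=
  ∑ a ∈ Finset.range k, ∑ b ∈ Finset.range k,
    if (a : ZMod q) = l * k + b then
      Real.log (arcDist l δ (vertexAngle k a) (vertexAngle k b) /
        arcDist l 0 (vertexAngle k a) (vertexAngle k b)) else 0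

theorem arcPairSum_symm {q k l m : ℕ} (hq : q ∣ 6 * k) (h : l + m = 6) (δ : ℝ) :
    arcPairSum q k l δ = arcPairSum q k m ((-1) ^ l * δ) := by
  have h6 : (l * k + m * k : ZMod q) = 0 := by
    have := (ZMod.natCast_eq_zero_iff (6 * k) q).2 hq
    rw [← h] at this
    push_cast at this
    linear_combination this
  rw [arcPairSum, arcPairSum, Finset.sum_comm]
  refine Finset.sum_congr rfl fun a _ => Finset.sum_congr rfl fun b _ => ?_
  rw [arcDist_symm h δ, arcDist_symm h 0, mul_zero]
  refine if_congr ?_ rfl rfl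
  constructor <;> intro e
  · linear_combination -e - h6
  · linear_combination -e - h6

/-- Each arc moves rigidly, so distances within it do not change. -/
theorem arcPairSum_zero (q k : ℕ) (δ : ℝ) : arcPairSum q k 0 δ = 0 := by
  refine Finset.sum_eq_zero fun a _ => Finset.sum_eq_zero fun b _ => ?_
  have h : ∀ δ, arcDist 0 δ (vertexAngle k a) (vertexAngle k b) =
      arcDist 0 0 (vertexAngle k a) (vertexAngle k b) := by
    intro δ
    rw [← Real.sqrt_sq (arcDist_nonneg 0 δ _ _), arcDist_zero_sq, ← arcDist_zero_sq 0,
      Real.sqrt_sq (arcDist_nonneg _ _ _ _)]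
  rw [h δ]
  split_ifs
  · rcases eq_or_ne (arcDist 0 0 (vertexAngle k a) (vertexAngle k b)) 0 with h0 | h0
    · simp [h0]
    · rw [div_self h0, Real.log_one]
  · rfl

/-- The ordered pairs of arcs at cyclic distance `1`, `2`, `3` number `12`, `12`, `6`. In each group
the first arc is rotated through `ε` half of the time and through `-ε` the other half. -/
theorem glueSum_eq_arcPairSum {q k : ℕ} (hq : q ∣ 6 * k) :
    glueSum q k = 6 * (arcPairSum q k 1 (stepAngle k) + arcPairSum q k 1 (-stepAngle k) +
      arcPairSum q k 2 (stepAngle k) + arcPairSum q k 2 (-stepAngle k)) +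
      3 * (arcPairSum q k 3 (stepAngle k) + arcPairSum q k 3 (-stepAngle k)) := by
  set S : ℕ → ℕ → ℝ := fun j j' => ∑ a ∈ Finset.range k, ∑ b ∈ Finset.range k,
    if ((j * k + a : ℕ) : ZMod q) = (j' * k + b : ℕ) then
      glueLog k (j * k + a) (j' * k + b) else 0 with hS
  have h1 : glueSum q k = ∑ j ∈ Finset.range 6, ∑ j' ∈ Finset.range 6, S j j' := by
    rw [glueSum, sum_range_mul_eq]
    refine Finset.sum_congr rfl fun j _ => ?_
    simp only [sum_range_mul_eq _ 6 k]
    rw [Finset.sum_comm]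
  have h2 : ∀ j l, S j (j + l) = arcPairSum q k l ((-1) ^ j * stepAngle k) := by
    intro j l
    refine Finset.sum_congr rfl fun a ha => Finset.sum_congr rfl fun b hb => ?_
    rw [Finset.mem_range] at ha hb
    rw [glueLog, norm_gluedVertex_sub ha hb, norm_gluedVertex_sub ha hb, mul_zero]
    refine if_congr ?_ rfl rfl
    push_cast
    constructor <;> intro e <;> linear_combination e
  have h3 : ∀ j j', S j j' = S j' j := by
    intro j j'
    rw [hS]
    simp only
    rw [Finset.sum_comm]
    refine Finset.sum_congr rfl fun a _ => Finset.sum_congr rfl fun b _ => ?_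
    rw [glueLog_comm]
    exact if_congr eq_comm rfl rfl
  have e4 := arcPairSum_symm (l := 4) (m := 2) hq rfl
  have e5 := arcPairSum_symm (l := 5) (m := 1) hq rfl
  have e3 := arcPairSum_symm (l := 3) (m := 3) hq rfl (stepAngle k)
  have hneg : (-1 : ℝ) ^ 3 * stepAngle k = -stepAngle k := by ring
  rw [hneg] at e3
  have s0 : ∀ j, S j j = 0 := fun j => by rw [← arcPairSum_zero, ← h2, add_zero]
  rw [h1]
  simp only [Finset.sum_range_succ, Finset.sum_range_zero, s0]
  rw [h3 1 0, h3 2 0, h3 3 0, h3 4 0, h3 5 0, h3 2 1, h3 3 1, h3 4 1, h3 5 1, h3 3 2, h3 4 2,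
    h3 5 2, h3 4 3, h3 5 3, h3 5 4]
  have f : ∀ j l m, j + l = m → S j m = arcPairSum q k l ((-1) ^ j * stepAngle k) := by
    rintro j l _ rfl
    exact h2 j l
  rw [f 0 1 1 rfl, f 0 2 2 rfl, f 0 3 3 rfl, f 0 4 4 rfl, f 0 5 5 rfl, f 1 1 2 rfl, f 1 2 3 rfl,
    f 1 3 4 rfl, f 1 4 5 rfl, f 2 1 3 rfl, f 2 2 4 rfl, f 2 3 5 rfl, f 3 1 4 rfl, f 3 2 5 rfl,
    f 4 1 5 rfl, e4, e4, e5]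
  norm_num
  rw [e3]
  ring

/-! ### Terms of order `k⁻²` with a scaling limit -/

/-- `f k a b` is bounded by a multiple of `k⁻²`, and `k² f k a b` has the limit `φ x y` as
`a / k → x` and `b / k → y`. -/
structure IsScaled (f : ℕ → ℕ → ℕ → ℝ) (φ : ℝ → ℝ → ℝ) : Prop where
  bound : ∃ C : ℝ, ∀ᶠ k : ℕ in atTop, ∀ a < k, ∀ b < k, |(k : ℝ) ^ 2 * f k a b| ≤ C
  limit : ∀ x ∈ Set.Ioo (0 : ℝ) 1, ∀ y ∈ Set.Ioo (0 : ℝ) 1, ∀ a b : ℕ → ℕ,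
      Tendsto (fun k : ℕ => (a k : ℝ) / k) atTop (𝓝 x) →
      Tendsto (fun k : ℕ => (b k : ℝ) / k) atTop (𝓝 y) →
      Tendsto (fun k : ℕ => (k : ℝ) ^ 2 * f k (a k) (b k)) atTop (𝓝 (φ x y))

namespace IsScaled
variable {f g : ℕ → ℕ → ℕ → ℝ} {φ ψ : ℝ → ℝ → ℝ}

theorem add (hf : IsScaled f φ) (hg : IsScaled g ψ) :
    IsScaled (fun k a b => f k a b + g k a b) (fun x y => φ x y + ψ x y) := by
  obtain ⟨C, hC⟩ := hf.bound
  obtain ⟨D, hD⟩ := hg.bound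
  refine ⟨⟨C + D, ?_⟩, fun x hx y hy a b ha hb => ?_⟩
  · filter_upwards [hC, hD] with k h1 h2 a ha b hb
    rw [mul_add]
    exact (abs_add_le _ _).trans (add_le_add (h1 a ha b hb) (h2 a ha b hb))
  · simp only [mul_add]
    exact (hf.limit x hx y hy a b ha hb).add (hg.limit x hx y hy a b ha hb)

theorem const_mul (hf : IsScaled f φ) (c : ℝ) :
    IsScaled (fun k a b => c * f k a b) (fun x y => c * φ x y) := by
  obtain ⟨C, hC⟩ := hf.bound
  refine ⟨⟨|c| * C, ?_⟩, fun x hx y hy a b ha hb => ?_⟩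
  · filter_upwards [hC] with k h1 a ha b hb
    rw [mul_left_comm, abs_mul]
    exact mul_le_mul_of_nonneg_left (h1 a ha b hb) (abs_nonneg c)
  · simp only [mul_left_comm _ c]
    exact (hf.limit x hx y hy a b ha hb).const_mul c

/-- Since `f` is uniformly small, `t / (1 + t) ≤ log (1 + t) ≤ t` squeezes the logarithm to the same
scaling limit. -/
theorem log_one_add (hf : IsScaled f φ) : IsScaled (fun k a b => Real.log (1 + f k a b)) φ := by
  obtain ⟨C, hC⟩ := hf.bound
  have key : ∀ {t : ℝ}, |t| ≤ 1 / 2 → t / (1 + t) ≤ Real.log (1 + t) ∧ Real.log (1 + t) ≤ t := by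
    intro t ht
    have h1 := abs_le.1 ht
    have h2 : (0 : ℝ) < 1 + t := by linarith
    constructor
    · have := Real.one_sub_inv_le_log_of_pos h2
      have e : 1 - (1 + t)⁻¹ = t / (1 + t) := by
        field_simp
        ring
      rwa [e] at this
    · have := Real.log_le_sub_one_of_pos h2
      linarith
  refine ⟨⟨2 * C, ?_⟩, fun x hx y hy a b ha hb => ?_⟩
  · have h0 : Tendsto (fun k : ℕ => C / (k : ℝ) ^ 2) atTop (𝓝 0) :=
      tendsto_const_nhds.div_atTop ((tendsto_pow_atTop two_ne_zero).comp
        tendsto_natCast_atTop_atTop)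
    filter_upwards [hC, h0.eventually_le_const (show (0 : ℝ) < 1 / 2 by norm_num),
      eventually_gt_atTop 0] with k h1 h2 hk a ha b hb
    have hk' : (0 : ℝ) < (k : ℝ) ^ 2 := by positivity
    have h3 := h1 a ha b hb
    rw [abs_mul, abs_of_pos hk'] at h3 ⊢
    have h4 : |f k a b| ≤ 1 / 2 := by
      refine le_trans ?_ h2
      rw [le_div_iff₀ hk']
      linarith
    have h5 := abs_le.1 h4
    obtain ⟨h6, h7⟩ := key h4
    have h8 : |Real.log (1 + f k a b)| ≤ 2 * |f k a b| := by
      rw [abs_le]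
      refine ⟨le_trans ?_ h6, h7.trans (by linarith [le_abs_self (f k a b), abs_nonneg (f k a b)])⟩
      rw [le_div_iff₀ (by linarith)]
      nlinarith [neg_abs_le (f k a b), abs_nonneg (f k a b)]
    nlinarith
  · have h1 := hf.limit x hx y hy a b ha hb
    have h0 : Tendsto (fun k : ℕ => f k (a k) (b k)) atTop (𝓝 0) := by
      have := h1.mul (tendsto_inv_atTop_zero.comp ((tendsto_pow_atTop (α := ℝ) two_ne_zero).comp
        tendsto_natCast_atTop_atTop))
      rw [mul_zero] at this
      refine this.congr' ?_
      filter_upwards [eventually_gt_atTop 0] with k hk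
      have hk' : (k : ℝ) ≠ 0 := by positivity
      simp only [Function.comp_apply]
      field_simp
    have h2 := h1.div (h0.const_add 1) (by norm_num)
    rw [add_zero, div_one] at h2
    have h3 : ∀ᶠ k : ℕ in atTop, |f k (a k) (b k)| ≤ 1 / 2 := by
      have := h0.abs
      rw [abs_zero] at this
      exact this.eventually_le_const (by norm_num)
    refine tendsto_of_tendsto_of_tendsto_of_le_of_le' h2 h1 ?_ ?_
    · filter_upwards [h3] with k hk
      rw [Pi.div_apply, mul_div_assoc]
      exact mul_le_mul_of_nonneg_left (key hk).1 (by positivity)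
    · filter_upwards [h3] with k hk
      exact mul_le_mul_of_nonneg_left (key hk).2 (by positivity)

theorem tendsto_sum_residue (hf : IsScaled f φ) (q : ℕ) [NeZero q] (c : ℕ → ZMod q) :
    Tendsto (fun k : ℕ => ∑ a ∈ Finset.range k, ∑ b ∈ Finset.range k,
      if (a + b : ZMod q) = c k then f k a b else 0) atTop
      (𝓝 ((∫ x in (0 : ℝ)..1, ∫ y in (0 : ℝ)..1, φ x y) / q)) := by
  obtain ⟨C, hC⟩ := hf.bound
  exact tendsto_sum_sum_residue hC hf.limit q c

end IsScaled

theorem stepAngle_eq_div (k : ℕ) : stepAngle k = Real.pi / 12 / k := by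
  rw [stepAngle, div_div]
  ring_nf

theorem tendsto_stepAngle : Tendsto stepAngle atTop (𝓝 0) := by
  simp only [funext stepAngle_eq_div]
  exact tendsto_const_div_atTop_nhds_zero_nat _

theorem tendsto_mul_sin_stepAngle :
    Tendsto (fun k : ℕ => (k : ℝ) * Real.sin (stepAngle k)) atTop (𝓝 (Real.pi / 12)) := by
  have h := (Real.hasDerivAt_sin 0).tendsto_slope_zero
  simp only [zero_add, Real.sin_zero, sub_zero, Real.cos_zero, smul_eq_mul] at h
  have h1 : Tendsto stepAngle atTop (𝓝[≠] 0) :=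
    tendsto_nhdsWithin_iff.2 ⟨tendsto_stepAngle, by
      filter_upwards [eventually_gt_atTop 0] with k hk
      exact (stepAngle_pos hk).ne'⟩
  have h2 := (h.comp h1).const_mul (Real.pi / 12)
  rw [mul_one] at h2
  refine h2.congr' ?_
  filter_upwards [eventually_gt_atTop 0] with k hk
  have hk' : (k : ℝ) ≠ 0 := by positivity
  have := Real.pi_pos
  simp only [Function.comp_apply, stepAngle_eq_div]
  field_simp

theorem tendsto_two_mul_stepAngle_mul {x : ℝ} (i : ℝ) {a : ℕ → ℕ}
    (ha : Tendsto (fun k : ℕ => (a k : ℝ) / k) atTop (𝓝 x)) :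
    Tendsto (fun k : ℕ => 2 * stepAngle k * (a k + i)) atTop (𝓝 (Real.pi / 6 * x)) := by
  have h := (ha.const_mul (Real.pi / 6)).add (tendsto_stepAngle.const_mul (2 * i))
  rw [mul_zero, add_zero] at h
  refine h.congr fun k => ?_
  rw [stepAngle_eq_div]
  ring

/-- Logarithms of ratios that deviate from `1` by `sin² ε` times a bounded continuous function of
the angles are scaled, with limit given by the value at `ε = 0`. -/
theorem isScaled_log {G : ℝ → ℝ → ℝ → ℝ} (i j : ℝ) {M : ℝ}
    (hM : ∀ k : ℕ, 0 < k → ∀ a < k, ∀ b < k,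
      |G (stepAngle k) (2 * stepAngle k * (a + i)) (2 * stepAngle k * (b + j))| ≤ M)
    (hG : ∀ A ∈ Set.Ioo 0 (Real.pi / 6), ∀ B ∈ Set.Ioo 0 (Real.pi / 6),
      ContinuousAt (fun p : ℝ × ℝ × ℝ => G p.1 p.2.1 p.2.2) (0, A, B)) :
    IsScaled (fun k a b => Real.log (1 + Real.sin (stepAngle k) ^ 2 *
        G (stepAngle k) (2 * stepAngle k * (a + i)) (2 * stepAngle k * (b + j))))
      (fun x y => (Real.pi / 12) ^ 2 * G 0 (Real.pi / 6 * x) (Real.pi / 6 * y)) := by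
  refine IsScaled.log_one_add ⟨⟨(Real.pi / 12) ^ 2 * M, ?_⟩, fun x hx y hy a b ha hb => ?_⟩
  · filter_upwards [eventually_gt_atTop 0] with k hk a ha b hb
    have h1 := hM k hk a ha b hb
    have h2 : ((k : ℝ) * Real.sin (stepAngle k)) ^ 2 ≤ (Real.pi / 12) ^ 2 := by
      have hk' : (0 : ℝ) < k := by exact_mod_cast hk
      have h3 := Real.sin_le (stepAngle_pos hk).le
      have h4 : 0 ≤ Real.sin (stepAngle k) :=
        Real.sin_nonneg_of_nonneg_of_le_pi (stepAngle_pos hk).le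
          (by linarith [stepAngle_le hk, Real.pi_pos])
      refine pow_le_pow_left₀ (by positivity) ?_ 2
      have h5 := stepAngle_mul hk
      nlinarith
    rw [← mul_assoc, ← mul_pow, abs_mul, abs_of_nonneg (sq_nonneg _)]
    exact mul_le_mul h2 h1 (abs_nonneg _) (by positivity)
  · have hpi := Real.pi_pos
    have h1 := hG (Real.pi / 6 * x) ⟨mul_pos (by positivity) hx.1, by nlinarith [hx.2]⟩
      (Real.pi / 6 * y) ⟨mul_pos (by positivity) hy.1, by nlinarith [hy.2]⟩
    have h2 := h1.tendsto.comp (tendsto_stepAngle.prodMk_nhds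
      ((tendsto_two_mul_stepAngle_mul i ha).prodMk_nhds (tendsto_two_mul_stepAngle_mul j hb)))
    have h3 := (tendsto_mul_sin_stepAngle.pow 2).mul h2
    refine h3.congr fun k => ?_
    simp only [Function.comp_apply]
    ring

/-! ### Distance ratios and cancellation of the first order -/

/-- The squared ratio by which gluing changes distances across one junction. -/
noncomputable def ratioOne (δ A B : ℝ) : ℝ :=
  (Real.sin A ^ 2 + Real.sin B ^ 2 + 2 * Real.sin A * Real.sin B * Real.cos (A + B - 2 * δ)) /
    Real.sin (A + B) ^ 2

/-- The squared ratio by which gluing changes distances across two junctions. -/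
noncomputable def ratioTwo (δ A B : ℝ) : ℝ :=
  (Real.cos (A + B) ^ 2 + Real.sin δ ^ 2 -
    2 * Real.cos (A + B) * Real.sin δ * Real.sin (A - B + δ)) / Real.cos (A + B) ^ 2

/-- The squared ratio by which gluing changes distances between opposite arcs. -/
noncomputable def ratioThree (δ y : ℝ) : ℝ := Real.cos (δ + y) ^ 2 / Real.cos y ^ 2

theorem log_div_eq_half (x y : ℝ) : Real.log (x / y) = 1 / 2 * Real.log (x ^ 2 / y ^ 2) := by
  rw [← div_pow, Real.log_pow]
  push_cast
  ring

section
variable {q k : ℕ}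

/-- Indices are counted away from the junction on both sides. Reversing the first arc by `k - 1 - a`
leaves `a + 1` edges on that side, hence the offsets `1` and `0`. -/
theorem ratioOne_eq (hk : 0 < k) {a : ℕ} (ha : a < k) (b : ℕ) (δ : ℝ) :
    arcDist 1 δ (vertexAngle k (k - 1 - a)) (vertexAngle k b) ^ 2 /
      arcDist 1 0 (vertexAngle k (k - 1 - a)) (vertexAngle k b) ^ 2 =
      ratioOne δ (2 * stepAngle k * (a + 1)) (2 * stepAngle k * (b + 0)) := by
  have ha' : a + 1 ≤ k := ha
  have e : k - 1 - a = k - (a + 1) := by omega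
  rw [arcDist_one_vertex_sq hk, arcDist_one_vertex_sq hk, e, Nat.cast_sub ha',
    mul_div_mul_left _ _ (by norm_num : (4 : ℝ) ≠ 0), ratioOne]
  push_cast
  rw [sub_sub_cancel, add_zero, mul_zero, sub_zero]
  have : ∀ A B : ℝ, Real.sin A ^ 2 + Real.sin B ^ 2 +
      2 * Real.sin A * Real.sin B * Real.cos (A + B) = Real.sin (A + B) ^ 2 := by
    intro A B
    rw [Real.cos_add, Real.sin_add]
    linear_combination (-Real.sin B ^ 2) * Real.sin_sq_add_cos_sq A -
      Real.sin A ^ 2 * Real.sin_sq_add_cos_sq B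
  rw [this]

theorem ratioTwo_eq (hk : 0 < k) (a : ℕ) {b : ℕ} (hb : b < k) (δ : ℝ) :
    arcDist 2 δ (vertexAngle k a) (vertexAngle k (k - 1 - b)) ^ 2 /
      arcDist 2 0 (vertexAngle k a) (vertexAngle k (k - 1 - b)) ^ 2 =
      ratioTwo δ (2 * stepAngle k * (a + 0)) (2 * stepAngle k * (b + 1)) := by
  have hb' : b + 1 ≤ k := hb
  have e : k - 1 - b = k - (b + 1) := by omega
  rw [arcDist_two_vertex_sq hk, arcDist_two_vertex_sq hk, e, Nat.cast_sub hb',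
    mul_div_mul_left _ _ (by norm_num : (4 : ℝ) ≠ 0), ratioTwo]
  push_cast
  simp only [sub_sub_cancel, add_zero, Real.sin_zero]
  congr 3
  ring

theorem ratioThree_eq (hk : 0 < k) (a : ℕ) {b : ℕ} (hb : b < k) (δ : ℝ) :
    arcDist 3 δ (vertexAngle k a) (vertexAngle k (k - 1 - b)) ^ 2 /
      arcDist 3 0 (vertexAngle k a) (vertexAngle k (k - 1 - b)) ^ 2 =
      ratioThree δ (2 * stepAngle k * (a + 0) + 2 * stepAngle k * (b + 1) - Real.pi / 6) := by
  have hb' : b + 1 ≤ k := hb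
  have e : k - 1 - b = k - (b + 1) := by omega
  have e2 : 2 * stepAngle k * ((a : ℝ) - ((k : ℝ) - (b + 1 : ℕ))) =
      2 * stepAngle k * (a + 0) + 2 * stepAngle k * (b + 1) - Real.pi / 6 := by
    rw [← stepAngle_mul hk]
    push_cast
    ring
  rw [arcDist_three_vertex_sq, arcDist_three_vertex_sq, e, Nat.cast_sub hb',
    mul_div_mul_left _ _ (by norm_num : (4 : ℝ) ≠ 0), e2, ratioThree, zero_add]

theorem sq_arcDist_div_pos (hk : 0 < k) {a b l : ℕ} (ha : a < k) (hb : b < k) {δ : ℝ}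
    (hδ : |δ| = stepAngle k) (hl : l < 6) (hl0 : l ≠ 0) :
    0 < arcDist l δ (vertexAngle k a) (vertexAngle k b) ^ 2 /
      arcDist l 0 (vertexAngle k a) (vertexAngle k b) ^ 2 := by
  have h1 := arcDist_vertex_pos hk ha hb hδ.le hl (Or.inl hl0)
  have h0 := arcDist_vertex_pos hk ha hb (δ := 0)
    (by rw [abs_zero]; exact (stepAngle_pos hk).le) hl (Or.inl hl0)
  positivity

theorem arcPairSum_one (hk : 0 < k) (δ : ℝ) :
    arcPairSum q k 1 δ = ∑ a ∈ Finset.range k, ∑ b ∈ Finset.range k,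
      if (a + b : ZMod q) = -1 then 1 / 2 * Real.log
        (ratioOne δ (2 * stepAngle k * (a + 1)) (2 * stepAngle k * (b + 0))) else 0 := by
  rw [arcPairSum, ← Finset.sum_range_reflect]
  refine Finset.sum_congr rfl fun a ha => Finset.sum_congr rfl fun b _ => ?_
  have ha' : a + 1 ≤ k := Finset.mem_range.1 ha
  rw [log_div_eq_half, ratioOne_eq hk ha']
  refine if_congr ?_ rfl rfl
  rw [show k - 1 - a = k - (a + 1) by omega, Nat.cast_sub ha']
  push_cast
  constructor <;> intro h <;> linear_combination -h

/-- Reversing the second arc turns the congruence into `a + b ≡ 3k - 1`, and `3 ≡ 0` modulo `q`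
makes the class independent of `k`. -/
theorem arcPairSum_two (hk : 0 < k) (hq : q ∣ 3) (δ : ℝ) :
    arcPairSum q k 2 δ = ∑ a ∈ Finset.range k, ∑ b ∈ Finset.range k,
      if (a + b : ZMod q) = -1 then 1 / 2 * Real.log
        (ratioTwo δ (2 * stepAngle k * (a + 0)) (2 * stepAngle k * (b + 1))) else 0 := by
  have h3 : (3 : ZMod q) = 0 := by
    have := (ZMod.natCast_eq_zero_iff 3 q).2 hq
    exact_mod_cast this
  refine Finset.sum_congr rfl fun a _ => ?_
  rw [← Finset.sum_range_reflect]
  refine Finset.sum_congr rfl fun b hb => ?_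
  have hb' : b + 1 ≤ k := Finset.mem_range.1 hb
  rw [log_div_eq_half, ratioTwo_eq hk a hb']
  refine if_congr ?_ rfl rfl
  rw [show k - 1 - b = k - (b + 1) by omega, Nat.cast_sub hb']
  push_cast
  constructor <;> intro h
  · linear_combination h + k * h3
  · linear_combination h - k * h3

/-- Here the congruence becomes `a + b ≡ 4k - 1 ≡ k - 1`. The class varies with `k`, which is why
the residue theorem allows a moving class `c k`. -/
theorem arcPairSum_three (hk : 0 < k) (hq : q ∣ 3) (δ : ℝ) :
    arcPairSum q k 3 δ = ∑ a ∈ Finset.range k, ∑ b ∈ Finset.range k,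
      if (a + b : ZMod q) = k - 1 then 1 / 2 * Real.log
        (ratioThree δ (2 * stepAngle k * (a + 0) + 2 * stepAngle k * (b + 1) - Real.pi / 6))
          else 0 := by
  have h3 : (3 : ZMod q) = 0 := by
    have := (ZMod.natCast_eq_zero_iff 3 q).2 hq
    exact_mod_cast this
  refine Finset.sum_congr rfl fun a _ => ?_
  rw [← Finset.sum_range_reflect]
  refine Finset.sum_congr rfl fun b hb => ?_
  have hb' : b + 1 ≤ k := Finset.mem_range.1 hb
  rw [log_div_eq_half, ratioThree_eq hk a hb']
  refine if_congr ?_ rfl rfl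
  rw [show k - 1 - b = k - (b + 1) by omega, Nat.cast_sub hb']
  push_cast
  constructor <;> intro h
  · linear_combination h + k * h3
  · linear_combination h - k * h3

/-- The condition is symmetric in `a` and `b`, so terms may be averaged with their swaps; this is
what cancels the first order at distance two. -/
theorem sum_residue_swap (f : ℕ → ℕ → ℝ) (c : ZMod q) :
    ∑ a ∈ Finset.range k, ∑ b ∈ Finset.range k, (if (a + b : ZMod q) = c then f a b else 0) =
      ∑ a ∈ Finset.range k, ∑ b ∈ Finset.range k,
        if (a + b : ZMod q) = c then 1 / 2 * (f a b + f b a) else 0 := by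
  have h : ∑ a ∈ Finset.range k, ∑ b ∈ Finset.range k,
      (if (a + b : ZMod q) = c then f a b else 0) =
      ∑ a ∈ Finset.range k, ∑ b ∈ Finset.range k, if (a + b : ZMod q) = c then f b a else 0 := by
    rw [Finset.sum_comm]
    refine Finset.sum_congr rfl fun a _ => Finset.sum_congr rfl fun b _ => ?_
    rw [add_comm]
  have h2 : ∑ a ∈ Finset.range k, ∑ b ∈ Finset.range k,
        (if (a + b : ZMod q) = c then 1 / 2 * (f a b + f b a) else 0) =
      1 / 2 * (∑ a ∈ Finset.range k, ∑ b ∈ Finset.range k,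
          (if (a + b : ZMod q) = c then f a b else 0) +
        ∑ a ∈ Finset.range k, ∑ b ∈ Finset.range k,
          if (a + b : ZMod q) = c then f b a else 0) := by
    simp only [← Finset.sum_add_distrib, Finset.mul_sum]
    refine Finset.sum_congr rfl fun a _ => Finset.sum_congr rfl fun b _ => ?_
    split_ifs <;> ring
  rw [h2, ← h]
  ring

end

/-- The second order coefficient for distances across one junction. -/
noncomputable def coeffOne (e A B : ℝ) : ℝ :=
  -4 * (2 * Real.sin A * Real.sin B / Real.sin (A + B) ^ 2) * Real.cos (A + B) +
    4 * (2 * Real.sin A * Real.sin B / Real.sin (A + B) ^ 2) ^ 2 *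
      (Real.cos (A + B) ^ 2 * Real.sin e ^ 2 - Real.sin (A + B) ^ 2 * Real.cos e ^ 2)

/-- The second order coefficient for distances across two junctions, shorter side first. -/
noncomputable def coeffTwo (e A B : ℝ) : ℝ :=
  2 / Real.cos (A + B) ^ 2 + Real.sin e ^ 2 / Real.cos (A + B) ^ 4 +
    (1 + Real.sin e ^ 2 / Real.cos (A + B) ^ 2) *
      (4 * Real.cos (B - A - 2 * e) / Real.cos (A + B)) +
    4 / Real.cos (A + B) ^ 2 * (Real.sin e ^ 2 * Real.cos (B - A - 2 * e) ^ 2 -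
      Real.cos e ^ 2 * Real.sin (B - A - 2 * e) ^ 2)

/-- The second order coefficient for distances across two junctions, longer side first. -/
noncomputable def coeffTwo' (e A B : ℝ) : ℝ :=
  2 / Real.cos (A + B) ^ 2 + Real.sin e ^ 2 / Real.cos (A + B) ^ 4 -
    (1 + Real.sin e ^ 2 / Real.cos (A + B) ^ 2) * (3 - 4 * Real.sin e ^ 2) *
      (4 * Real.cos (B - A - 2 * e) / Real.cos (A + B)) +
    4 / Real.cos (A + B) ^ 2 * (Real.sin (3 * e) ^ 2 * Real.cos (B - A - 2 * e) ^ 2 -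
      Real.cos (3 * e) ^ 2 * Real.sin (B - A - 2 * e) ^ 2)

/-- The second order coefficient for distances between opposite arcs. -/
noncomputable def coeffThree (e A B : ℝ) : ℝ :=
  -2 / Real.cos (A + B - Real.pi / 6) ^ 2 + Real.sin e ^ 2 / Real.cos (A + B - Real.pi / 6) ^ 4

/-- Each ratio is `1` plus a multiple of `cos (A + B - 2δ) - cos (A + B)`, whose linear part in `δ`
is odd and cancels between `e` and `-e`. -/
theorem ratioOne_mul {e A B : ℝ} (h : Real.sin (A + B) ≠ 0) :
    ratioOne e A B * ratioOne (-e) A B = 1 + Real.sin e ^ 2 * coeffOne e A B := by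
  have key : ∀ δ, ratioOne δ A B = 1 + 2 * Real.sin A * Real.sin B / Real.sin (A + B) ^ 2 *
      (Real.cos (A + B - 2 * δ) - Real.cos (A + B)) := by
    intro δ
    have : Real.sin A ^ 2 + Real.sin B ^ 2 + 2 * Real.sin A * Real.sin B * Real.cos (A + B) =
        Real.sin (A + B) ^ 2 := by
      rw [Real.cos_add, Real.sin_add]
      linear_combination (-Real.sin B ^ 2) * Real.sin_sq_add_cos_sq A -
        Real.sin A ^ 2 * Real.sin_sq_add_cos_sq B
    rw [ratioOne]
    field_simp
    linear_combination this
  rw [key, key, coeffOne, mul_neg, sub_neg_eq_add, Real.cos_sub, Real.cos_add (A + B) (2 * e),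
    Real.cos_two_mul_eq_one_sub, Real.sin_two_mul]
  ring

/-- Isolates the only term of first order, the one with `u + v`; for swapped pairs that sum has
another factor `sin e`. -/
theorem ratioTwo_mul {e x : ℝ} (hx : Real.cos x ≠ 0) (u v : ℝ) :
    (Real.cos x ^ 2 + Real.sin e ^ 2 + 2 * Real.cos x * Real.sin e * u) / Real.cos x ^ 2 *
      ((Real.cos x ^ 2 + Real.sin e ^ 2 + 2 * Real.cos x * Real.sin e * v) / Real.cos x ^ 2) =
    1 + Real.sin e ^ 2 * (2 / Real.cos x ^ 2 + Real.sin e ^ 2 / Real.cos x ^ 4 +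
      4 / Real.cos x ^ 2 * (u * v)) + (1 + Real.sin e ^ 2 / Real.cos x ^ 2) *
        (2 * Real.sin e / Real.cos x * (u + v)) := by
  field_simp
  ring

theorem sin_add_add_sin_sub (e y : ℝ) :
    Real.sin (e + y) + Real.sin (e - y) = 2 * Real.sin e * Real.cos y := by
  rw [Real.sin_add, Real.sin_sub]
  ring

theorem sin_add_mul_sin_sub (e y : ℝ) : Real.sin (e + y) * Real.sin (e - y) =
    Real.sin e ^ 2 * Real.cos y ^ 2 - Real.cos e ^ 2 * Real.sin y ^ 2 := by
  rw [Real.sin_add, Real.sin_sub]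
  ring

/-- The product of the two ratios that are exchanged by interchanging the sides of a pair of
junctions. -/
theorem ratioTwo_mul_swap {e A B : ℝ} (h : Real.cos (A + B) ≠ 0) :
    ratioTwo e A B * ratioTwo e (B - 2 * e) (A + 2 * e) =
      1 + Real.sin e ^ 2 * coeffTwo e A B := by
  -- Because of the offset of one edge, swapping the indices sends `(A, B)` to `(B - 2e, A + 2e)`.
  -- The two sines then have arguments `-(e + y)` and `-(e - y)`, where `y = B - A - 2e`.
  have e1 : B - 2 * e + (A + 2 * e) = A + B := by ring
  have e2 : A - B + e = -(e + (B - A - 2 * e)) := by ring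
  have e3 : B - 2 * e - (A + 2 * e) + e = -(e - (B - A - 2 * e)) := by ring
  have s1 := sin_add_mul_sin_sub e (B - A - 2 * e)
  have s2 := sin_add_add_sin_sub e (B - A - 2 * e)
  rw [ratioTwo, ratioTwo, e1, e2, e3, Real.sin_neg, Real.sin_neg, mul_neg, mul_neg, sub_neg_eq_add,
    sub_neg_eq_add, ratioTwo_mul h, s1, s2, coeffTwo]
  ring

/-- For the opposite rotation the arguments are `-(3e ± y)`. The extra factor comes from `sin 3e =
sin e (3 - 4 sin² e)`. -/
theorem ratioTwo_neg_mul_swap {e A B : ℝ} (h : Real.cos (A + B) ≠ 0) :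
    ratioTwo (-e) A B * ratioTwo (-e) (B - 2 * e) (A + 2 * e) =
      1 + Real.sin e ^ 2 * coeffTwo' e A B := by
  have e1 : B - 2 * e + (A + 2 * e) = A + B := by ring
  have e2 : A - B + -e = -(3 * e + (B - A - 2 * e)) := by ring
  have e3 : B - 2 * e - (A + 2 * e) + -e = -(3 * e - (B - A - 2 * e)) := by ring
  have s1 := sin_add_mul_sin_sub (3 * e) (B - A - 2 * e)
  have s2 := sin_add_add_sin_sub (3 * e) (B - A - 2 * e)
  have hr : ∀ s c t : ℝ, c ^ 2 + s ^ 2 - 2 * c * -s * -t = c ^ 2 + s ^ 2 + 2 * c * s * (-t) := by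
    intros
    ring
  rw [ratioTwo, ratioTwo, e1, e2, e3, Real.sin_neg, Real.sin_neg, Real.sin_neg]
  simp only [neg_sq]
  rw [hr, hr, ratioTwo_mul h, neg_mul_neg, s1, ← neg_add, s2, Real.sin_three_mul, coeffTwo',
    Real.sin_three_mul]
  ring

theorem ratioThree_mul {e A B : ℝ} (h : Real.cos (A + B - Real.pi / 6) ≠ 0) :
    ratioThree e (A + B - Real.pi / 6) * ratioThree (-e) (A + B - Real.pi / 6) =
      1 + Real.sin e ^ 2 * coeffThree e A B := by
  have key : Real.cos (e + (A + B - Real.pi / 6)) * Real.cos (-e + (A + B - Real.pi / 6)) =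
      Real.cos (A + B - Real.pi / 6) ^ 2 - Real.sin e ^ 2 := by
    rw [Real.cos_add, Real.cos_add, Real.cos_neg, Real.sin_neg]
    linear_combination Real.cos (A + B - Real.pi / 6) ^ 2 * Real.sin_sq_add_cos_sq e -
      Real.sin e ^ 2 * Real.sin_sq_add_cos_sq (A + B - Real.pi / 6)
  have : ratioThree e (A + B - Real.pi / 6) * ratioThree (-e) (A + B - Real.pi / 6) =
      (Real.cos (A + B - Real.pi / 6) ^ 2 - Real.sin e ^ 2) ^ 2 /
        Real.cos (A + B - Real.pi / 6) ^ 4 := by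
    rw [ratioThree, ratioThree, ← key]
    field_simp
  rw [this, coeffThree]
  generalize Real.cos (A + B - Real.pi / 6) = c at *
  field_simp
  ring

/-- The term of `glueSum` that collects the pairs of arcs at distance one and two. -/
noncomputable def nearTerm (k a b : ℕ) : ℝ :=
  3 * Real.log (1 + Real.sin (stepAngle k) ^ 2 *
    coeffOne (stepAngle k) (2 * stepAngle k * (a + 1)) (2 * stepAngle k * (b + 0))) +
  3 / 2 * (Real.log (1 + Real.sin (stepAngle k) ^ 2 *
      coeffTwo (stepAngle k) (2 * stepAngle k * (a + 0)) (2 * stepAngle k * (b + 1))) +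
    Real.log (1 + Real.sin (stepAngle k) ^ 2 *
      coeffTwo' (stepAngle k) (2 * stepAngle k * (a + 0)) (2 * stepAngle k * (b + 1))))

/-- The term of `glueSum` that collects the pairs of opposite arcs. -/
noncomputable def oppositeTerm (k a b : ℕ) : ℝ :=
  3 / 2 * Real.log (1 + Real.sin (stepAngle k) ^ 2 *
    coeffThree (stepAngle k) (2 * stepAngle k * (a + 0)) (2 * stepAngle k * (b + 1)))

section
variable {q k a b : ℕ}

theorem step_add_mem (hk : 0 < k) (ha : a < k) {i : ℝ} (h0 : 0 ≤ i) (h1 : i ≤ 1) :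
    2 * stepAngle k * (a + i) ∈ Set.Icc 0 (Real.pi / 6) := by
  have ha' : (a : ℝ) + 1 ≤ k := by exact_mod_cast ha
  exact two_mul_step_mem hk (by positivity) (by linarith)

theorem cos_add_pos {A B : ℝ} (hA : A ∈ Set.Icc 0 (Real.pi / 6)) (hB : B ∈ Set.Icc 0 (Real.pi / 6)) :
    0 < Real.cos (A + B) := by
  have := Real.pi_pos
  exact Real.cos_pos_of_mem_Ioo ⟨by linarith [hA.1, hB.1], by linarith [hA.2, hB.2]⟩

theorem cos_add_sub_pos {A B : ℝ} (hA : A ∈ Set.Icc 0 (Real.pi / 6))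
    (hB : B ∈ Set.Icc 0 (Real.pi / 6)) : 0 < Real.cos (A + B - Real.pi / 6) := by
  have := Real.pi_pos
  exact Real.cos_pos_of_mem_Ioo ⟨by linarith [hA.1, hB.1], by linarith [hA.2, hB.2]⟩

theorem glueSum_eq (hk : 0 < k) (hq : q ∣ 3) :
    glueSum q k =
      (∑ a ∈ Finset.range k, ∑ b ∈ Finset.range k,
        if (a + b : ZMod q) = -1 then nearTerm k a b else 0) +
      ∑ a ∈ Finset.range k, ∑ b ∈ Finset.range k,
        if (a + b : ZMod q) = k - 1 then oppositeTerm k a b else 0 := by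
  have hε := stepAngle_pos hk
  have a1 : |stepAngle k| = stepAngle k := abs_of_pos hε
  have a2 : |-stepAngle k| = stepAngle k := by rw [abs_neg, a1]
  have h1 : 6 * (arcPairSum q k 1 (stepAngle k) + arcPairSum q k 1 (-stepAngle k)) =
      ∑ a ∈ Finset.range k, ∑ b ∈ Finset.range k,
        if (a + b : ZMod q) = -1 then 3 * Real.log (1 + Real.sin (stepAngle k) ^ 2 *
          coeffOne (stepAngle k) (2 * stepAngle k * (a + 1)) (2 * stepAngle k * (b + 0)))
        else 0 := by
    rw [arcPairSum_one hk, arcPairSum_one hk, ← Finset.sum_add_distrib, Finset.mul_sum]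
    refine Finset.sum_congr rfl fun a ha => ?_
    rw [← Finset.sum_add_distrib, Finset.mul_sum]
    refine Finset.sum_congr rfl fun b hb => ?_
    rw [Finset.mem_range] at ha hb
    have p1 := sq_arcDist_div_pos hk (l := 1) (show k - 1 - a < k by omega) hb a1 (by omega)
      (by omega)
    have p2 := sq_arcDist_div_pos hk (l := 1) (show k - 1 - a < k by omega) hb a2 (by omega)
      (by omega)
    rw [ratioOne_eq hk ha] at p1 p2
    have hA := step_add_mem hk ha zero_le_one le_rfl
    have hB := step_add_mem hk hb le_rfl zero_le_one
    have hs : 0 < Real.sin (2 * stepAngle k * (a + 1) + 2 * stepAngle k * (b + 0)) := by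
      refine Real.sin_pos_of_pos_of_lt_pi ?_ (by linarith [hA.2, hB.2, Real.pi_pos])
      positivity
    rw [← ratioOne_mul hs.ne', Real.log_mul p1.ne' p2.ne']
    split_ifs <;> ring
  -- One argument for both rotations. The factor `3/2` is `6` times `1/2` from squaring the
  -- distances, times `1/2` from averaging over the swap.
  have h2 : ∀ δ : ℝ, |δ| = stepAngle k → ∀ C : ℝ → ℝ → ℝ → ℝ,
      (∀ {A B : ℝ}, Real.cos (A + B) ≠ 0 → ratioTwo δ A B *
        ratioTwo δ (B - 2 * stepAngle k) (A + 2 * stepAngle k) =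
          1 + Real.sin (stepAngle k) ^ 2 * C (stepAngle k) A B) →
      6 * arcPairSum q k 2 δ = ∑ a ∈ Finset.range k, ∑ b ∈ Finset.range k,
        if (a + b : ZMod q) = -1 then 3 / 2 * Real.log (1 + Real.sin (stepAngle k) ^ 2 *
          C (stepAngle k) (2 * stepAngle k * (a + 0)) (2 * stepAngle k * (b + 1)))
        else 0 := by
    intro δ hδ C hC
    rw [arcPairSum_two hk hq, sum_residue_swap, Finset.mul_sum]
    refine Finset.sum_congr rfl fun a ha => ?_
    rw [Finset.mul_sum]
    refine Finset.sum_congr rfl fun b hb => ?_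
    rw [Finset.mem_range] at ha hb
    have p1 := sq_arcDist_div_pos hk (l := 2) ha (show k - 1 - b < k by omega) hδ (by omega)
      (by omega)
    have p2 := sq_arcDist_div_pos hk (l := 2) hb (show k - 1 - a < k by omega) hδ (by omega)
      (by omega)
    rw [ratioTwo_eq hk _ hb] at p1
    rw [ratioTwo_eq hk _ ha] at p2
    have hA := step_add_mem hk ha le_rfl zero_le_one
    have hB := step_add_mem hk hb zero_le_one le_rfl
    have e1 : 2 * stepAngle k * ((b : ℝ) + 1) - 2 * stepAngle k = 2 * stepAngle k * (b + 0) := by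
      ring
    have e2 : 2 * stepAngle k * ((a : ℝ) + 0) + 2 * stepAngle k = 2 * stepAngle k * (a + 1) := by
      ring
    rw [← hC (cos_add_pos hA hB).ne', e1, e2, Real.log_mul p1.ne' p2.ne']
    split_ifs <;> ring
  have h3 : 3 * (arcPairSum q k 3 (stepAngle k) + arcPairSum q k 3 (-stepAngle k)) =
      ∑ a ∈ Finset.range k, ∑ b ∈ Finset.range k,
        if (a + b : ZMod q) = k - 1 then oppositeTerm k a b else 0 := by
    rw [arcPairSum_three hk hq, arcPairSum_three hk hq, ← Finset.sum_add_distrib, Finset.mul_sum]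
    refine Finset.sum_congr rfl fun a ha => ?_
    rw [← Finset.sum_add_distrib, Finset.mul_sum]
    refine Finset.sum_congr rfl fun b hb => ?_
    rw [Finset.mem_range] at ha hb
    have p1 := sq_arcDist_div_pos hk (l := 3) ha (show k - 1 - b < k by omega) a1 (by omega)
      (by omega)
    have p2 := sq_arcDist_div_pos hk (l := 3) ha (show k - 1 - b < k by omega) a2 (by omega)
      (by omega)
    rw [ratioThree_eq hk a hb] at p1 p2
    have hA := step_add_mem hk ha le_rfl zero_le_one
    have hB := step_add_mem hk hb zero_le_one le_rfl
    rw [oppositeTerm, ← ratioThree_mul (cos_add_sub_pos hA hB).ne', Real.log_mul p1.ne' p2.ne']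
    split_ifs <;> ring
  have h4 := h2 _ a1 coeffTwo ratioTwo_mul_swap
  have h5 := h2 _ a2 coeffTwo' ratioTwo_neg_mul_swap
  have h6 : ∑ a ∈ Finset.range k, ∑ b ∈ Finset.range k,
      (if (a + b : ZMod q) = -1 then nearTerm k a b else 0) =
      6 * (arcPairSum q k 1 (stepAngle k) + arcPairSum q k 1 (-stepAngle k)) +
        (6 * arcPairSum q k 2 (stepAngle k) + 6 * arcPairSum q k 2 (-stepAngle k)) := by
    rw [h1, h4, h5]
    simp only [← Finset.sum_add_distrib]
    refine Finset.sum_congr rfl fun a _ => Finset.sum_congr rfl fun b _ => ?_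
    rw [nearTerm]
    split_ifs <;> ring
  rw [h6, ← h3, glueSum_eq_arcPairSum (hq.trans ⟨2 * k, by ring⟩)]
  ring

end

/-! ### Scaling limits of the terms and of `glueSum` -/

theorem exists_bound_of_continuousAt {G : ℝ → ℝ → ℝ → ℝ}
    (hG : ∀ e : ℝ, ∀ A ∈ Set.Icc 0 (Real.pi / 6), ∀ B ∈ Set.Icc 0 (Real.pi / 6),
      ContinuousAt (fun p : ℝ × ℝ × ℝ => G p.1 p.2.1 p.2.2) (e, A, B)) :
    ∃ M, ∀ e ∈ Set.Icc 0 (Real.pi / 12), ∀ A ∈ Set.Icc 0 (Real.pi / 6),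
      ∀ B ∈ Set.Icc 0 (Real.pi / 6), |G e A B| ≤ M := by
  have hK : IsCompact (Set.Icc 0 (Real.pi / 12) ×ˢ Set.Icc 0 (Real.pi / 6) ×ˢ
      Set.Icc 0 (Real.pi / 6)) := isCompact_Icc.prod (isCompact_Icc.prod isCompact_Icc)
  obtain ⟨M, hM⟩ := hK.exists_bound_of_continuousOn
    (f := fun p : ℝ × ℝ × ℝ => G p.1 p.2.1 p.2.2)
    fun p hp => (hG p.1 p.2.1 hp.2.1 p.2.2 hp.2.2).continuousWithinAt
  exact ⟨M, fun e he A hA B hB => hM (e, A, B) ⟨he, hA, hB⟩⟩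

theorem isScaled_log_of_continuousAt {G : ℝ → ℝ → ℝ → ℝ}
    (hG : ∀ e : ℝ, ∀ A ∈ Set.Icc 0 (Real.pi / 6), ∀ B ∈ Set.Icc 0 (Real.pi / 6),
      ContinuousAt (fun p : ℝ × ℝ × ℝ => G p.1 p.2.1 p.2.2) (e, A, B)) :
    IsScaled (fun k a b => Real.log (1 + Real.sin (stepAngle k) ^ 2 *
        G (stepAngle k) (2 * stepAngle k * (a + 0)) (2 * stepAngle k * (b + 1))))
      (fun x y => (Real.pi / 12) ^ 2 * G 0 (Real.pi / 6 * x) (Real.pi / 6 * y)) := by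
  obtain ⟨M, hM⟩ := exists_bound_of_continuousAt hG
  exact isScaled_log 0 1 (fun k hk a ha b hb => hM _ ⟨(stepAngle_pos hk).le, stepAngle_le hk⟩ _
    (step_add_mem hk ha le_rfl zero_le_one) _ (step_add_mem hk hb zero_le_one le_rfl))
    fun A hA B hB => hG 0 A (Set.Ioo_subset_Icc_self hA) B (Set.Ioo_subset_Icc_self hB)

theorem isScaled_coeffTwo : IsScaled (fun k a b => Real.log (1 + Real.sin (stepAngle k) ^ 2 *
      coeffTwo (stepAngle k) (2 * stepAngle k * (a + 0)) (2 * stepAngle k * (b + 1))))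
    (fun x y => (Real.pi / 12) ^ 2 * coeffTwo 0 (Real.pi / 6 * x) (Real.pi / 6 * y)) := by
  refine isScaled_log_of_continuousAt (G := coeffTwo) ?_
  intro e A hA B hB
  have h := (cos_add_pos hA hB).ne'
  unfold coeffTwo
  fun_prop (disch := simpa using h)

theorem isScaled_coeffTwo' : IsScaled (fun k a b => Real.log (1 + Real.sin (stepAngle k) ^ 2 *
      coeffTwo' (stepAngle k) (2 * stepAngle k * (a + 0)) (2 * stepAngle k * (b + 1))))
    (fun x y => (Real.pi / 12) ^ 2 * coeffTwo' 0 (Real.pi / 6 * x) (Real.pi / 6 * y)) := by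
  refine isScaled_log_of_continuousAt (G := coeffTwo') ?_
  intro e A hA B hB
  have h := (cos_add_pos hA hB).ne'
  unfold coeffTwo'
  fun_prop (disch := simpa using h)

theorem isScaled_coeffThree : IsScaled (fun k a b => Real.log (1 + Real.sin (stepAngle k) ^ 2 *
      coeffThree (stepAngle k) (2 * stepAngle k * (a + 0)) (2 * stepAngle k * (b + 1))))
    (fun x y => (Real.pi / 12) ^ 2 * coeffThree 0 (Real.pi / 6 * x) (Real.pi / 6 * y)) := by
  refine isScaled_log_of_continuousAt (G := coeffThree) ?_
  intro e A hA B hB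
  have h := (cos_add_sub_pos hA hB).ne'
  unfold coeffThree
  fun_prop (disch := simpa using h)

/-- The denominator vanishes at `A = B = 0`, so compactness does not help. Instead `sin A` and `sin
B` are both at most `sin (A + B)`, which bounds the quotient by `2`. -/
theorem abs_coeffOne_le {e A B : ℝ} (hA : A ∈ Set.Ioc 0 (Real.pi / 6))
    (hB : B ∈ Set.Icc 0 (Real.pi / 6)) : |coeffOne e A B| ≤ 40 := by
  have hpi := Real.pi_pos
  have s0 : 0 < Real.sin (A + B) :=
    Real.sin_pos_of_pos_of_lt_pi (by linarith [hA.1, hB.1]) (by linarith [hA.2, hB.2])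
  have sA : Real.sin A ≤ Real.sin (A + B) := Real.sin_le_sin_of_le_of_le_pi_div_two
    (by linarith [hA.1]) (by linarith [hA.2, hB.2]) (by linarith [hB.1])
  have sB : Real.sin B ≤ Real.sin (A + B) := Real.sin_le_sin_of_le_of_le_pi_div_two
    (by linarith [hB.1]) (by linarith [hA.2, hB.2]) (by linarith [hA.1])
  have sA0 : 0 ≤ Real.sin A := Real.sin_nonneg_of_nonneg_of_le_pi hA.1.le (by linarith [hA.2])
  have sB0 : 0 ≤ Real.sin B := Real.sin_nonneg_of_nonneg_of_le_pi hB.1 (by linarith [hB.2])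
  set g := 2 * Real.sin A * Real.sin B / Real.sin (A + B) ^ 2 with hg
  have g0 : 0 ≤ g := by positivity
  have g2 : g ≤ 2 := by
    rw [hg, div_le_iff₀ (by positivity)]
    nlinarith
  rw [coeffOne, ← hg]
  have h1 : |-4 * g * Real.cos (A + B)| ≤ 8 := by
    rw [abs_mul, abs_mul, abs_of_nonneg g0]
    norm_num
    nlinarith [Real.abs_cos_le_one (A + B), abs_nonneg (Real.cos (A + B))]
  have h2 : |Real.cos (A + B) ^ 2 * Real.sin e ^ 2 - Real.sin (A + B) ^ 2 * Real.cos e ^ 2| ≤ 1 := by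
    have c1 := Real.sin_sq_add_cos_sq (A + B)
    have c2 := Real.sin_sq_add_cos_sq e
    rw [abs_le]
    constructor <;> nlinarith [mul_nonneg (sq_nonneg (Real.cos (A + B))) (sq_nonneg (Real.sin e)),
      mul_nonneg (sq_nonneg (Real.sin (A + B))) (sq_nonneg (Real.cos e)),
      mul_nonneg (sq_nonneg (Real.cos (A + B))) (sq_nonneg (Real.cos e)),
      mul_nonneg (sq_nonneg (Real.sin (A + B))) (sq_nonneg (Real.sin e))]
  have h3 : |4 * g ^ 2 *
      (Real.cos (A + B) ^ 2 * Real.sin e ^ 2 - Real.sin (A + B) ^ 2 * Real.cos e ^ 2)| ≤ 16 := by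
    rw [abs_mul, abs_of_nonneg (by positivity)]
    nlinarith [abs_nonneg
      (Real.cos (A + B) ^ 2 * Real.sin e ^ 2 - Real.sin (A + B) ^ 2 * Real.cos e ^ 2)]
  exact (abs_add_le _ _).trans (by linarith)

theorem isScaled_coeffOne : IsScaled (fun k a b => Real.log (1 + Real.sin (stepAngle k) ^ 2 *
      coeffOne (stepAngle k) (2 * stepAngle k * (a + 1)) (2 * stepAngle k * (b + 0))))
    (fun x y => (Real.pi / 12) ^ 2 * coeffOne 0 (Real.pi / 6 * x) (Real.pi / 6 * y)) := by
  refine isScaled_log 1 0 (M := 40) (fun k hk a ha b hb => abs_coeffOne_le ⟨?_, ?_⟩ ?_) ?_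
  · have := stepAngle_pos hk
    positivity
  · exact (step_add_mem hk ha zero_le_one le_rfl).2
  · exact step_add_mem hk hb le_rfl zero_le_one
  · intro A hA B hB
    have h : Real.sin (A + B) ≠ 0 := (Real.sin_pos_of_pos_of_lt_pi (by linarith [hA.1, hB.1])
      (by linarith [hA.2, hB.2, Real.pi_pos])).ne'
    unfold coeffOne
    fun_prop (disch := simpa using h)

/-- The limiting density of `nearTerm` in terms of the angles. -/
noncomputable def nearDensity (A B : ℝ) : ℝ :=
  (Real.pi / 12) ^ 2 * (3 * coeffOne 0 A B + 3 / 2 * (coeffTwo 0 A B + coeffTwo' 0 A B))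

/-- The limiting density of `oppositeTerm` in terms of the angles. -/
noncomputable def oppositeDensity (A B : ℝ) : ℝ :=
  (Real.pi / 12) ^ 2 * (3 / 2 * coeffThree 0 A B)

theorem isScaled_nearTerm :
    IsScaled nearTerm fun x y => nearDensity (Real.pi / 6 * x) (Real.pi / 6 * y) := by
  have h := (isScaled_coeffOne.const_mul 3).add
    ((isScaled_coeffTwo.add isScaled_coeffTwo').const_mul (3 / 2))
  refine ⟨h.bound, fun x hx y hy a b ha hb => ?_⟩
  refine (h.limit x hx y hy a b ha hb).trans (le_of_eq (congrArg 𝓝 ?_))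
  unfold nearDensity
  ring

theorem isScaled_oppositeTerm :
    IsScaled oppositeTerm fun x y => oppositeDensity (Real.pi / 6 * x) (Real.pi / 6 * y) := by
  have h := isScaled_coeffThree.const_mul (3 / 2)
  refine ⟨h.bound, fun x hx y hy a b ha hb => ?_⟩
  refine (h.limit x hx y hy a b ha hb).trans (le_of_eq (congrArg 𝓝 ?_))
  unfold oppositeDensity
  ring

theorem tendsto_glueSum {q : ℕ} [NeZero q] (hq : q ∣ 3) :
    Tendsto (glueSum q) atTop
      (𝓝 (((∫ x in (0 : ℝ)..1, ∫ y in (0 : ℝ)..1,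
          nearDensity (Real.pi / 6 * x) (Real.pi / 6 * y)) +
        ∫ x in (0 : ℝ)..1, ∫ y in (0 : ℝ)..1,
          oppositeDensity (Real.pi / 6 * x) (Real.pi / 6 * y)) / q)) := by
  rw [add_div]
  refine ((isScaled_nearTerm.tendsto_sum_residue q fun _ => -1).add
    (isScaled_oppositeTerm.tendsto_sum_residue q fun k => (k : ZMod q) - 1)).congr' ?_
  filter_upwards [eventually_gt_atTop 0] with k hk
  exact (glueSum_eq hk hq).symm

/-! ### Evaluation of the double integrals -/

theorem nearDensity_mul_sq (A B : ℝ) :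
    nearDensity A B = (Real.pi / 6) ^ 2 * (3 *
      (-(2 * Real.sin A * Real.sin B * Real.cos (B - A) / Real.sin (A + B) ^ 2) +
        (1 / 2 / Real.cos (A + B) ^ 2 - Real.cos (B - A) / Real.cos (A + B) -
          Real.sin (B - A) ^ 2 / Real.cos (A + B) ^ 2))) := by
  have hc : Real.cos (B - A) = Real.cos (A + B) + 2 * Real.sin A * Real.sin B := by
    rw [Real.cos_add, Real.cos_sub]
    ring
  rw [nearDensity, coeffOne, coeffTwo, coeffTwo', mul_zero, mul_zero, sub_zero, Real.sin_zero,
    Real.cos_zero]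
  -- With division by zero equal to zero the identity holds for all angles, so it can be rewritten
  -- under the integral without side conditions.
  rcases eq_or_ne (Real.sin (A + B)) 0 with h | h
  · simp only [h]
    ring
  · rw [hc]
    rcases eq_or_ne (Real.cos (A + B)) 0 with h' | h'
    · simp only [h']
      field_simp
      ring
    · generalize Real.cos (A + B) = c at *
      field_simp
      ring

theorem integral_integral_scale (f : ℝ → ℝ → ℝ) {c : ℝ} (hc : c ≠ 0) :
    ∫ x in (0 : ℝ)..1, ∫ y in (0 : ℝ)..1, c ^ 2 * f (c * x) (c * y) =
      ∫ x in (0 : ℝ)..c, ∫ y in (0 : ℝ)..c, f x y := by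
  have h1 : ∀ x : ℝ, ∫ y in (0 : ℝ)..1, c ^ 2 * f x (c * y) = c * ∫ y in (0 : ℝ)..c, f x y := by
    intro x
    rw [intervalIntegral.integral_const_mul,
      intervalIntegral.integral_comp_mul_left (fun y => f x y) hc, mul_zero, mul_one, smul_eq_mul]
    field_simp
  simp only [h1]
  rw [intervalIntegral.integral_comp_mul_left (fun x => c * ∫ y in (0 : ℝ)..c, f x y) hc,
    mul_zero, mul_one, intervalIntegral.integral_const_mul, smul_eq_mul]
  field_simp

theorem hasDerivAt_sin_const_add (u t : ℝ) :
    HasDerivAt (fun t => Real.sin (u + t)) (Real.cos (u + t)) t := by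
  simpa using ((hasDerivAt_id t).const_add u).sin

theorem hasDerivAt_cos_const_add (u t : ℝ) :
    HasDerivAt (fun t => Real.cos (u + t)) (-Real.sin (u + t)) t := by
  simpa using ((hasDerivAt_id t).const_add u).cos

/-- The integrand of `nearDensity`, up to a constant factor. -/
noncomputable def nearIntegrand (u t : ℝ) : ℝ :=
  -(2 * Real.sin u * Real.sin t * Real.cos (t - u) / Real.sin (u + t) ^ 2) +
    (1 / 2 / Real.cos (u + t) ^ 2 - Real.cos (t - u) / Real.cos (u + t) -
      Real.sin (t - u) ^ 2 / Real.cos (u + t) ^ 2)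

/-- A primitive of `nearIntegrand u`. -/
noncomputable def nearPrimitive (u t : ℝ) : ℝ :=
  -(Real.sin (4 * u) - Real.sin (2 * u)) *
      (Real.log (Real.sin (u + t)) + Real.log (Real.cos (u + t))) +
    2 * (u + t) * (Real.cos (4 * u) - Real.cos (2 * u)) -
    1 / 2 * Real.cos (4 * u) * (Real.sin (u + t) / Real.cos (u + t)) -
    2 * Real.sin u ^ 2 * Real.cos (2 * u) * (Real.cos (u + t) / Real.sin (u + t))

theorem sin_four_mul (u : ℝ) : Real.sin (4 * u) = 2 * Real.sin (2 * u) * Real.cos (2 * u) := by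
  rw [← Real.sin_two_mul]
  ring_nf

theorem cos_four_mul (u : ℝ) : Real.cos (4 * u) = 2 * Real.cos (2 * u) ^ 2 - 1 := by
  rw [← Real.cos_two_mul]
  ring_nf

/-- Written in `x = u + t` with `u` fixed, the integrand is a combination of `cot x`, `tan x`, `1`,
`1/sin² x` and `1/cos² x`; `p1` and `p2` are this decomposition. -/
theorem hasDerivAt_nearPrimitive {u t : ℝ} (hs : Real.sin (u + t) ≠ 0)
    (hc : Real.cos (u + t) ≠ 0) :
    HasDerivAt (nearPrimitive u) (nearIntegrand u t) t := by
  have ds := hasDerivAt_sin_const_add u t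
  have dc := hasDerivAt_cos_const_add u t
  have d := (((((ds.log hs).add (dc.log hc)).const_mul
    (-(Real.sin (4 * u) - Real.sin (2 * u)))).add
    ((((hasDerivAt_id t).const_add u).const_mul 2).mul_const
      (Real.cos (4 * u) - Real.cos (2 * u)))).sub
    ((ds.div dc hc).const_mul (1 / 2 * Real.cos (4 * u)))).sub
    ((dc.div ds hs).const_mul (2 * Real.sin u ^ 2 * Real.cos (2 * u)))
  refine d.congr_deriv ?_
  have et : Real.sin t = Real.sin (u + t) * Real.cos u - Real.cos (u + t) * Real.sin u := by
    rw [← Real.sin_sub]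
    ring_nf
  have ec : Real.cos (t - u) = Real.cos (u + t) * Real.cos (2 * u) +
      Real.sin (u + t) * Real.sin (2 * u) := by
    rw [← Real.cos_sub]
    ring_nf
  have es : Real.sin (t - u) = Real.sin (u + t) * Real.cos (2 * u) -
      Real.cos (u + t) * Real.sin (2 * u) := by
    rw [← Real.sin_sub]
    ring_nf
  have hsc : Real.sin u * Real.cos u = Real.sin (2 * u) / 2 := by
    rw [Real.sin_two_mul]
    ring
  have hss : Real.sin u ^ 2 = (1 - Real.cos (2 * u)) / 2 := by
    rw [Real.cos_two_mul_eq_one_sub]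
    ring
  have h1 := Real.sin_sq_add_cos_sq (2 * u)
  have hx := Real.sin_sq_add_cos_sq (u + t)
  rw [nearIntegrand, et, ec, es, sin_four_mul, cos_four_mul]
  generalize Real.sin (u + t) = sx at *
  generalize Real.cos (u + t) = cx at *
  generalize Real.sin (2 * u) = s2 at *
  generalize Real.cos (2 * u) = c2 at *
  generalize Real.sin u = su at *
  generalize Real.cos u = cu at *
  have p1 : 2 * su * (sx * cu - cx * su) * (cx * c2 + sx * s2) / sx ^ 2 =
      (2 * s2 * c2 - s2) * (cx / sx) + (c2 - (2 * c2 ^ 2 - 1)) - 2 * su ^ 2 * c2 / sx ^ 2 := by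
    field_simp
    linear_combination 2 * (cx * c2 + sx * s2) * (sx * hsc - cx * hss) + sx ^ 2 * h1 -
      (c2 - c2 ^ 2) * hx + 2 * c2 * hss
  have p2 : 1 / 2 / cx ^ 2 - (cx * c2 + sx * s2) / cx - (sx * c2 - cx * s2) ^ 2 / cx ^ 2 =
      (2 * s2 * c2 - s2) * (sx / cx) + (2 * c2 ^ 2 - 1 - c2) -
        1 / 2 * (2 * c2 ^ 2 - 1) / cx ^ 2 := by
    field_simp
    linear_combination -2 * c2 ^ 2 * hx - 2 * cx ^ 2 * h1
  rw [p1, p2]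
  field_simp
  linear_combination (-cx ^ 2 * 4 * su ^ 2 * c2 + sx ^ 2 * (2 * c2 ^ 2 - 1)) * (-hx)

/-- The function `u ↦ sin u * log (sin u)`, continuous also where `sin u = 0`. -/
noncomputable def sinMulLogSin (u : ℝ) : ℝ := Real.sin u * Real.log (Real.sin u)

@[fun_prop]
theorem continuous_sinMulLogSin : Continuous sinMulLogSin :=
  Real.continuous_mul_log.comp Real.continuous_sin

/-- The inner integral of `nearIntegrand`. -/
noncomputable def innerNear (u : ℝ) : ℝ :=
  -(Real.sin (4 * u) - Real.sin (2 * u)) * (Real.log (Real.sin (u + Real.pi / 6)) +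
      Real.log (Real.cos (u + Real.pi / 6)) - Real.log (Real.cos u)) +
    (2 * Real.cos (2 * u) - 1) * (2 * Real.cos u) * sinMulLogSin u +
    2 * (Real.pi / 6) * (Real.cos (4 * u) - Real.cos (2 * u)) -
    1 / 2 * Real.cos (4 * u) * (Real.sin (u + Real.pi / 6) / Real.cos (u + Real.pi / 6) -
      Real.sin u / Real.cos u) -
    2 * Real.sin u ^ 2 * Real.cos (2 * u) * (Real.cos (u + Real.pi / 6) /
      Real.sin (u + Real.pi / 6)) + 2 * Real.sin u * Real.cos u * Real.cos (2 * u)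

/-- A primitive of `innerNear`. -/
noncomputable def outerNear (u : ℝ) : ℝ :=
  -(Real.cos (2 * u) * Real.sin u ^ 2) * (Real.log (Real.sin (u + Real.pi / 6)) +
      Real.log (Real.cos (u + Real.pi / 6)) - Real.log (Real.cos u)) +
    Real.cos (2 * u) * Real.sin u * sinMulLogSin u +
    Real.pi / 6 * (Real.sin (4 * u) / 2 - Real.sin (2 * u)) - Real.cos (4 * u) / 8 +
    1 / 2 * Real.log (Real.cos u) - 1 / 8 * Real.log (Real.sin (u + Real.pi / 6)) -
    5 / 8 * Real.log (Real.cos (u + Real.pi / 6)) - Real.cos (4 * (u + Real.pi / 6)) / 16 -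
    √3 / 4 * ((u + Real.pi / 6) - Real.sin (4 * (u + Real.pi / 6)) / 4)

theorem sin_cos_shift_pos {u : ℝ} (hu : u ∈ Set.Icc 0 (Real.pi / 6)) :
    0 < Real.sin (u + Real.pi / 6) ∧ 0 < Real.cos (u + Real.pi / 6) ∧ 0 < Real.cos u := by
  have := Real.pi_pos
  exact ⟨Real.sin_pos_of_pos_of_lt_pi (by linarith [hu.1]) (by linarith [hu.2]),
    Real.cos_pos_of_mem_Ioo ⟨by linarith [hu.1], by linarith [hu.2]⟩,
    Real.cos_pos_of_mem_Ioo ⟨by linarith [hu.1], by linarith [hu.2]⟩⟩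

/-- At `t = 0` the primitive contains `log (sin u)`, singular as `u → 0`. Its coefficient `sin 4u -
sin 2u` has a factor `sin u`, so the result can be written with the continuous `sinMulLogSin`. -/
theorem integral_nearIntegrand {u : ℝ} (hu : u ∈ Set.Ioc 0 (Real.pi / 6)) :
    ∫ t in (0 : ℝ)..(Real.pi / 6), nearIntegrand u t = innerNear u := by
  have hpi := Real.pi_pos
  have hs : ∀ t ∈ Set.Icc 0 (Real.pi / 6), Real.sin (u + t) ≠ 0 := fun t ht =>
    (Real.sin_pos_of_pos_of_lt_pi (by linarith [hu.1, ht.1]) (by linarith [hu.2, ht.2])).ne'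
  have hc : ∀ t ∈ Set.Icc 0 (Real.pi / 6), Real.cos (u + t) ≠ 0 := fun t ht =>
    (Real.cos_pos_of_mem_Ioo ⟨by linarith [hu.1, ht.1], by linarith [hu.2, ht.2]⟩).ne'
  have hle : (0 : ℝ) ≤ Real.pi / 6 := by positivity
  have hcont : ContinuousOn (nearIntegrand u) (Set.uIcc 0 (Real.pi / 6)) := by
    rw [Set.uIcc_of_le hle]
    intro t ht
    have h1 := hs t ht
    have h2 := hc t ht
    refine ContinuousAt.continuousWithinAt ?_
    unfold nearIntegrand
    fun_prop (disch := simp [*])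
  rw [intervalIntegral.integral_eq_sub_of_hasDerivAt (f := nearPrimitive u) (fun t ht => by
    rw [Set.uIcc_of_le hle] at ht
    exact hasDerivAt_nearPrimitive (hs t ht) (hc t ht)) hcont.intervalIntegrable]
  have su : Real.sin u ≠ 0 := by simpa using hs 0 ⟨le_rfl, hle⟩
  rw [nearPrimitive, nearPrimitive, innerNear, sinMulLogSin, add_zero, sin_four_mul,
    Real.sin_two_mul]
  field_simp
  ring

theorem continuousOn_innerNear : ContinuousOn innerNear (Set.Icc 0 (Real.pi / 6)) := by
  intro u hu
  obtain ⟨h1, h2, h3⟩ := sin_cos_shift_pos hu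
  have h1 := h1.ne'
  have h2 := h2.ne'
  have h3 := h3.ne'
  refine ContinuousAt.continuousWithinAt ?_
  unfold innerNear
  fun_prop (disch := simp [*])

theorem continuousOn_outerNear : ContinuousOn outerNear (Set.Icc 0 (Real.pi / 6)) := by
  intro u hu
  obtain ⟨h1, h2, h3⟩ := sin_cos_shift_pos hu
  have h1 := h1.ne'
  have h2 := h2.ne'
  have h3 := h3.ne'
  refine ContinuousAt.continuousWithinAt ?_
  unfold outerNear
  fun_prop (disch := simp [*])

/-- The trigonometric remainder of the next derivative, for `c = cos 2u` and `C`, `S` the cosine and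
sine of `2u + π/3`. -/
theorem outerNear_trig {c C S : ℝ} (hc : c = C / 2 + √3 / 2 * S) (hCS : S ^ 2 + C ^ 2 = 1) :
    (c - c ^ 2) / 2 - (1 + C) / 16 + 5 * (1 - C) / 16 + S ^ 2 * C / 4 - √3 / 4 * S ^ 3 +
      (2 * c ^ 2 - 1) * (1 - C) / 4 = 0 := by
  have h3 : √3 ^ 2 = 3 := Real.sq_sqrt (by norm_num)
  subst hc
  linear_combination (-√3 / 4 * S - C / 8) * hCS - C * S ^ 2 / 8 * h3

/-- Integration by parts: `cos 2u sin² u` has derivative `sin 4u - sin 2u` (`dW`), which accounts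
for the logarithms. The rest splits into `zpart`, with denominators at `u + π/6`, and `upart`, with
denominator `cos u`. The endpoint `u = 0` is left to continuity. -/
theorem hasDerivAt_outerNear {u : ℝ} (hu : u ∈ Set.Ioo 0 (Real.pi / 6)) :
    HasDerivAt outerNear (innerNear u) u := by
  obtain ⟨h1, h2, h3⟩ := sin_cos_shift_pos (Set.Ioo_subset_Icc_self hu)
  have h0 : 0 < Real.sin u :=
    Real.sin_pos_of_pos_of_lt_pi hu.1 (by linarith [hu.2, Real.pi_pos])
  have ds := Real.hasDerivAt_sin u
  have dc := Real.hasDerivAt_cos u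
  have dS : HasDerivAt (fun u => Real.sin (u + Real.pi / 6)) (Real.cos (u + Real.pi / 6)) u := by
    simpa using ((hasDerivAt_id u).add_const (Real.pi / 6)).sin
  have dC : HasDerivAt (fun u => Real.cos (u + Real.pi / 6)) (-Real.sin (u + Real.pi / 6)) u := by
    simpa using ((hasDerivAt_id u).add_const (Real.pi / 6)).cos
  have dz := (hasDerivAt_id u).add_const (Real.pi / 6)
  have s2 := ((hasDerivAt_id u).const_mul 2).sin
  have c2 := ((hasDerivAt_id u).const_mul 2).cos
  have s4 := ((hasDerivAt_id u).const_mul 4).sin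
  have c4 := ((hasDerivAt_id u).const_mul 4).cos
  have S4 := (dz.const_mul 4).sin
  have C4 := (dz.const_mul 4).cos
  have d := (((((((((c2.mul (ds.pow 2)).neg.mul
      (((dS.log h1.ne').add (dC.log h2.ne')).sub (dc.log h3.ne'))).add
    ((c2.mul ds).mul (ds.mul (ds.log h0.ne')))).add
    (((s4.div_const 2).sub s2).const_mul (Real.pi / 6))).sub (c4.div_const 8)).add
    ((dc.log h3.ne').const_mul (1 / 2))).sub ((dS.log h1.ne').const_mul (1 / 8))).sub
    ((dC.log h2.ne').const_mul (5 / 8))).sub (C4.div_const 16)).sub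
    ((dz.sub (S4.div_const 4)).const_mul (√3 / 4))
  refine d.congr_deriv ?_
  simp only [id_eq, innerNear, sinMulLogSin]
  have e1 : Real.sin (4 * (u + Real.pi / 6)) =
      2 * Real.sin (2 * (u + Real.pi / 6)) * Real.cos (2 * (u + Real.pi / 6)) := sin_four_mul _
  have e2 := cos_four_mul (u + Real.pi / 6)
  have e3 : Real.cos (2 * u) = Real.cos (2 * (u + Real.pi / 6)) / 2 +
      √3 / 2 * Real.sin (2 * (u + Real.pi / 6)) := by
    rw [show 2 * u = 2 * (u + Real.pi / 6) - Real.pi / 3 by ring, Real.cos_sub,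
      Real.cos_pi_div_three, Real.sin_pi_div_three]
    ring
  have key := outerNear_trig e3 (Real.sin_sq_add_cos_sq _)
  have hCS := Real.sin_sq_add_cos_sq (2 * (u + Real.pi / 6))
  have k1 : Real.sin (u + Real.pi / 6) ^ 2 = (1 - Real.cos (2 * (u + Real.pi / 6))) / 2 := by
    rw [Real.cos_two_mul_eq_one_sub]
    ring
  have k2 : Real.cos (u + Real.pi / 6) ^ 2 = (1 + Real.cos (2 * (u + Real.pi / 6))) / 2 := by
    rw [Real.cos_two_mul]
    ring
  have k3 : Real.sin (u + Real.pi / 6) * Real.cos (u + Real.pi / 6) =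
      Real.sin (2 * (u + Real.pi / 6)) / 2 := by
    rw [Real.sin_two_mul]
    ring
  have m1 : Real.sin u ^ 2 = (1 - Real.cos (2 * u)) / 2 := by
    rw [Real.cos_two_mul_eq_one_sub]
    ring
  have m2 : Real.cos u ^ 2 = (1 + Real.cos (2 * u)) / 2 := by
    rw [Real.cos_two_mul]
    ring
  have m3 := Real.sin_two_mul u
  rw [e1, e2, sin_four_mul, cos_four_mul]
  have zpart : Real.cos (2 * u) * Real.sin u ^ 2 *
      (Real.cos (u + Real.pi / 6) / Real.sin (u + Real.pi / 6) +
        Real.sin (u + Real.pi / 6) / Real.cos (u + Real.pi / 6)) -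
      1 / 8 * (Real.cos (u + Real.pi / 6) / Real.sin (u + Real.pi / 6)) +
      5 / 8 * (Real.sin (u + Real.pi / 6) / Real.cos (u + Real.pi / 6)) +
      Real.sin (2 * (u + Real.pi / 6)) * Real.cos (2 * (u + Real.pi / 6)) / 2 -
      √3 / 2 * Real.sin (2 * (u + Real.pi / 6)) ^ 2 +
      1 / 2 * (2 * Real.cos (2 * u) ^ 2 - 1) *
        (Real.sin (u + Real.pi / 6) / Real.cos (u + Real.pi / 6)) = 0 := by
    rw [m1]
    clear e3 e1 e2 m1 m2 m3 d S4 C4 s4 c4 s2 c2 dz dS dC ds dc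
    generalize Real.sin (2 * (u + Real.pi / 6)) = S at *
    generalize Real.cos (2 * (u + Real.pi / 6)) = C at *
    generalize Real.sin (u + Real.pi / 6) = sz at *
    generalize Real.cos (u + Real.pi / 6) = cz at *
    generalize Real.cos (2 * u) = c at *
    have : (c * ((1 - c) / 2) * (cz / sz + sz / cz) - 1 / 8 * (cz / sz) + 5 / 8 * (sz / cz) +
      S * C / 2 - √3 / 2 * S ^ 2 + 1 / 2 * (2 * c ^ 2 - 1) * (sz / cz)) * (sz * cz) = 0 := by
      have : (c * ((1 - c) / 2) * (cz / sz + sz / cz) - 1 / 8 * (cz / sz) + 5 / 8 * (sz / cz) +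
        S * C / 2 - √3 / 2 * S ^ 2 + 1 / 2 * (2 * c ^ 2 - 1) * (sz / cz)) * (sz * cz) =
        c * ((1 - c) / 2) * (cz ^ 2 + sz ^ 2) - 1 / 8 * cz ^ 2 + 5 / 8 * sz ^ 2 +
        (S * C / 2 - √3 / 2 * S ^ 2) * (sz * cz) + 1 / 2 * (2 * c ^ 2 - 1) * sz ^ 2 := by
        field_simp
        ring
      rw [this, k1, k2, k3]
      linear_combination key
    exact (mul_eq_zero.1 this).resolve_right (mul_pos h1 h2).ne'
  have upart : Real.cos (2 * u) * Real.sin u ^ 2 * (Real.sin u / Real.cos u) +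
      Real.cos (2 * u) * (Real.sin u * Real.cos u) -
      Real.sin (2 * u) * Real.cos (2 * u) + 1 / 2 * (Real.sin u / Real.cos u) +
      1 / 2 * (2 * Real.cos (2 * u) ^ 2 - 1) * (Real.sin u / Real.cos u) = 0 := by
    rw [m3]
    have hq : Real.cos (2 * u) = 2 * Real.cos u ^ 2 - 1 := Real.cos_two_mul u
    have h5 := Real.sin_sq_add_cos_sq u
    rw [hq]
    field_simp
    linear_combination Real.sin u * (2 * Real.cos u ^ 2 - 1) * 2 * h5
  have dW : -2 * Real.sin (2 * u) * Real.sin u ^ 2 +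
      2 * Real.cos (2 * u) * Real.sin u * Real.cos u =
      2 * Real.sin (2 * u) * Real.cos (2 * u) - Real.sin (2 * u) := by
    linear_combination -2 * Real.sin (2 * u) * m1 - Real.cos (2 * u) * m3
  have hsc : Real.sin u * (Real.cos u / Real.sin u) = Real.cos u := by
    field_simp
  simp only [Pi.mul_apply, Pi.neg_apply, Pi.pow_apply, Pi.add_apply, Pi.sub_apply, hsc]
  clear d
  linear_combination -dW * (Real.log (Real.sin (u + Real.pi / 6)) +
      Real.log (Real.cos (u + Real.pi / 6)) - Real.log (Real.cos u)) +
    dW * Real.log (Real.sin u) + m3 * (2 * Real.cos (2 * u) - 1) * Real.log (Real.sin u) + zpart -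
    upart + √3 / 2 * hCS

theorem integral_innerNear :
    ∫ u in (0 : ℝ)..(Real.pi / 6), innerNear u =
      1 / 2 * Real.log 3 - 1 / 2 * Real.log 2 - √3 * Real.pi / 12 := by
  have hle : (0 : ℝ) ≤ Real.pi / 6 := by positivity
  have h3 : √3 * √3 = 3 := Real.mul_self_sqrt (by norm_num)
  rw [intervalIntegral.integral_eq_sub_of_hasDerivAt_of_le hle continuousOn_outerNear
    (fun u hu => hasDerivAt_outerNear hu)
    (by
      refine ContinuousOn.intervalIntegrable ?_
      rw [Set.uIcc_of_le hle]
      exact continuousOn_innerNear)]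
  have a1 : Real.pi / 6 + Real.pi / 6 = Real.pi / 3 := by ring
  have a2 : 2 * (Real.pi / 6) = Real.pi / 3 := by ring
  have a4 : 4 * (Real.pi / 6) = Real.pi - Real.pi / 3 := by ring
  have a5 : 4 * (Real.pi / 3) = Real.pi / 3 + Real.pi := by ring
  have l1 : Real.log (√3 / 2) = 1 / 2 * Real.log 3 - Real.log 2 := by
    rw [Real.log_div (by positivity) (by norm_num), Real.log_sqrt (by norm_num)]
    ring
  have l2 : Real.log (1 / 2) = -Real.log 2 := by
    rw [one_div, Real.log_inv]
  rw [outerNear, outerNear, sinMulLogSin, sinMulLogSin]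
  simp only [a1, a2, a4, a5, zero_add, mul_zero, Real.sin_zero, Real.cos_zero, Real.log_one,
    Real.sin_add_pi, Real.cos_add_pi, Real.sin_pi_sub, Real.cos_pi_sub, Real.sin_pi_div_three,
    Real.cos_pi_div_three, Real.sin_pi_div_six, Real.cos_pi_div_six, l1, l2]
  linear_combination (-1 / 16) * h3

theorem integral_nearDensity :
    ∫ x in (0 : ℝ)..1, ∫ y in (0 : ℝ)..1, nearDensity (Real.pi / 6 * x) (Real.pi / 6 * y) =
      3 * (1 / 2 * Real.log 3 - 1 / 2 * Real.log 2 - √3 * Real.pi / 12) := by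
  have hpi := Real.pi_pos
  have hle : (0 : ℝ) ≤ Real.pi / 6 := by positivity
  have h : ∀ A B, nearDensity A B = (Real.pi / 6) ^ 2 * (3 * nearIntegrand A B) :=
    nearDensity_mul_sq
  simp only [h]
  rw [integral_integral_scale (fun A B => 3 * nearIntegrand A B) (by positivity)]
  simp only [intervalIntegral.integral_const_mul]
  rw [← integral_innerNear]
  congr 1
  refine intervalIntegral.integral_congr_ae (Eventually.of_forall fun u hu => ?_)
  rw [Set.uIoc_of_le hle] at hu
  exact integral_nearIntegrand hu

/-- Integrating `1/cos²` gives a difference of tangents, and integrating these gives logarithms of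
cosines. -/
theorem integral_oppositeDensity :
    ∫ x in (0 : ℝ)..1, ∫ y in (0 : ℝ)..1, oppositeDensity (Real.pi / 6 * x) (Real.pi / 6 * y) =
      3 / 4 * Real.log 3 - 3 / 2 * Real.log 2 := by
  have hpi := Real.pi_pos
  have hle : (0 : ℝ) ≤ Real.pi / 6 := by positivity
  have h : ∀ A B, oppositeDensity A B =
      (Real.pi / 6) ^ 2 * (-3 / 4 * (1 / Real.cos (A + B - Real.pi / 6) ^ 2)) := by
    intro A B
    rw [oppositeDensity, coeffThree, Real.sin_zero]
    ring
  simp only [h]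
  rw [integral_integral_scale
    (fun A B => -3 / 4 * (1 / Real.cos (A + B - Real.pi / 6) ^ 2)) (by positivity)]
  simp only [intervalIntegral.integral_const_mul]
  have inner : ∀ u ∈ Set.Icc 0 (Real.pi / 6),
      ∫ t in (0 : ℝ)..(Real.pi / 6), 1 / Real.cos (u + t - Real.pi / 6) ^ 2 =
        Real.tan u - Real.tan (u - Real.pi / 6) := by
    intro u hu
    have hc : ∀ t ∈ Set.uIcc 0 (Real.pi / 6), Real.cos (u + t - Real.pi / 6) ≠ 0 := by
      intro t ht
      rw [Set.uIcc_of_le hle] at ht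
      exact (cos_add_sub_pos hu ht).ne'
    rw [intervalIntegral.integral_eq_sub_of_hasDerivAt
      (f := fun t => Real.tan (u + t - Real.pi / 6))]
    · simp
    · intro t ht
      have d := (Real.hasDerivAt_tan (hc t ht)).comp t
        (((hasDerivAt_id t).const_add u).sub_const (Real.pi / 6))
      exact d.congr_deriv (by simp)
    · refine ContinuousOn.intervalIntegrable fun t ht => ContinuousAt.continuousWithinAt ?_
      have := hc t ht
      fun_prop (disch := simp [*])
  have e : ∫ u in (0 : ℝ)..(Real.pi / 6), ∫ t in (0 : ℝ)..(Real.pi / 6),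
      1 / Real.cos (u + t - Real.pi / 6) ^ 2 =
      ∫ u in (0 : ℝ)..(Real.pi / 6), (Real.tan u - Real.tan (u - Real.pi / 6)) := by
    refine intervalIntegral.integral_congr fun u hu => ?_
    rw [Set.uIcc_of_le hle] at hu
    exact inner u hu
  have hc1 : ∀ u ∈ Set.uIcc 0 (Real.pi / 6), Real.cos u ≠ 0 := by
    intro u hu
    rw [Set.uIcc_of_le hle] at hu
    exact (sin_cos_shift_pos hu).2.2.ne'
  have hc2 : ∀ u ∈ Set.uIcc 0 (Real.pi / 6), Real.cos (u - Real.pi / 6) ≠ 0 := by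
    intro u hu
    rw [Set.uIcc_of_le hle] at hu
    have := (cos_add_sub_pos hu ⟨le_rfl, hle⟩).ne'
    rwa [add_zero] at this
  rw [e, intervalIntegral.integral_eq_sub_of_hasDerivAt
    (f := fun u => Real.log (Real.cos (u - Real.pi / 6)) - Real.log (Real.cos u))]
  · have l1 : Real.log (√3 / 2) = 1 / 2 * Real.log 3 - Real.log 2 := by
      rw [Real.log_div (by positivity) (by norm_num), Real.log_sqrt (by norm_num)]
      ring
    simp only [sub_self, zero_sub, Real.cos_neg, Real.cos_zero, Real.log_one, sub_zero,
      Real.cos_pi_div_six, l1]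
    ring
  · intro u hu
    have d1 := (((hasDerivAt_id u).sub_const (Real.pi / 6)).cos.log (hc2 u hu))
    have d2 := (Real.hasDerivAt_cos u).log (hc1 u hu)
    refine (d1.sub d2).congr_deriv ?_
    rw [Real.tan_eq_sin_div_cos, Real.tan_eq_sin_div_cos]
    simp only [id_eq]
    ring
  · refine ContinuousOn.intervalIntegrable fun u hu => ContinuousAt.continuousWithinAt ?_
    have h1 := Real.continuousAt_tan.2 (hc1 u hu)
    have h2 : ContinuousAt (fun u => Real.tan (u - Real.pi / 6)) u :=
      (Real.continuousAt_tan.2 (hc2 u hu)).comp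
        (f := fun u => u - Real.pi / 6) (by fun_prop)
    exact h1.sub h2

/-- The limit of the sum of the logarithms of all distance ratios. -/
theorem tendsto_glueSum_log {q : ℕ} [NeZero q] (hq : q ∣ 3) :
    Tendsto (glueSum q) atTop
      (𝓝 ((9 / 4 * Real.log 3 - 3 * Real.log 2 - √3 * Real.pi / 4) / q)) := by
  have h := tendsto_glueSum hq
  rw [integral_nearDensity, integral_oppositeDensity] at h
  convert h using 3
  ring

/-! ### Numerical value and logarithm of the constant -/

/-- Form suited to numerics: only square roots, and the exponential of a small positive number, for
which two-sided Taylor bounds are at hand. -/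
theorem Cstar_eq : Cstar =
    9 / 8 * √√3 / Real.exp ((2 * √3 * Real.pi - Real.pi ^ 2) / 8) := by
  have h : (3 : ℝ) ^ ((9 : ℝ) / 4) = 9 * √√3 := by
    rw [Real.sqrt_eq_rpow, Real.sqrt_eq_rpow, ← Real.rpow_mul (by norm_num),
      show (9 : ℝ) / 4 = 2 + 1 / 2 * (1 / 2) by norm_num, Real.rpow_add (by norm_num)]
    norm_num
  rw [Cstar, h, show (Real.pi ^ 2 - 2 * √3 * Real.pi) / 8 =
    -((2 * √3 * Real.pi - Real.pi ^ 2) / 8) by ring, Real.exp_neg]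
  ring

theorem abs_Cstar_sub_lt : |Cstar - 1.304457| < 5 / 10 ^ 7 := by
  have p1 := Real.pi_gt_d20
  have p2 := Real.pi_lt_d20
  have s1 : (1.73205080756 : ℝ) < √3 := Real.lt_sqrt_of_sq_lt (by norm_num)
  have s2 : √3 < (1.73205080757 : ℝ) := (Real.sqrt_lt' (by norm_num)).2 (by norm_num)
  have t1 : (1.316074012 : ℝ) < √√3 := Real.lt_sqrt_of_sq_lt (lt_trans (by norm_num) s1)
  have t2 : √√3 < (1.316074014 : ℝ) := (Real.sqrt_lt' (by norm_num)).2 (lt_trans s2 (by norm_num))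
  set y : ℝ := (2 * √3 * Real.pi - Real.pi ^ 2) / 8 with hy
  have y1 : (0.12664897 : ℝ) < y := by
    rw [hy]
    nlinarith
  have y2 : y < (0.12664898 : ℝ) := by
    rw [hy]
    nlinarith
  have e1 : (1.13501852 : ℝ) < Real.exp y := by
    refine lt_of_lt_of_le ?_ ((Real.sum_le_exp_of_nonneg (by norm_num) 7).trans
      (Real.exp_le_exp.2 y1.le))
    simp only [Finset.sum_range_succ, Finset.sum_range_zero, Nat.factorial]
    norm_num
  have e2 : Real.exp y < (1.13501854 : ℝ) := by
    refine lt_of_le_of_lt ((Real.exp_le_exp.2 y2.le).trans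
      (Real.exp_bound' (by norm_num) (by norm_num) (n := 7) (by norm_num))) ?_
    simp only [Finset.sum_range_succ, Finset.sum_range_zero, Nat.factorial]
    norm_num
  have e0 := Real.exp_pos y
  rw [Cstar_eq, ← hy, abs_lt]
  constructor
  · rw [lt_sub_iff_add_lt, lt_div_iff₀ e0]
    nlinarith
  · rw [sub_lt_iff_lt_add, div_lt_iff₀ e0]
    nlinarith

theorem one_lt_Cstar : 1 < Cstar := by
  have := (abs_lt.1 abs_Cstar_sub_lt).1
  norm_num at this
  linarith

theorem Cstar_lt : Cstar < 1.31 := by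
  have := (abs_lt.1 abs_Cstar_sub_lt).2
  norm_num at this ⊢
  linarith

theorem log_Cstar : Real.log Cstar =
    Real.pi ^ 2 / 8 + (9 / 4 * Real.log 3 - 3 * Real.log 2 - √3 * Real.pi / 4) := by
  rw [Cstar, Real.log_mul (by positivity) (Real.exp_ne_zero _), Real.log_exp,
    Real.log_div (by positivity) (by positivity), Real.log_rpow (by norm_num), Real.log_pow]
  push_cast
  ring

/-! ### Gain from the circumradius and the limit `C_*` -/

/-- Both bounds are `1 - 1/y ≤ log y ≤ y - 1` at `y = cos² x`. -/
theorem log_inv_cos_bounds {x : ℝ} (hx : 0 < Real.cos x) :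
    Real.sin x ^ 2 / 2 ≤ Real.log (1 / Real.cos x) ∧
      Real.log (1 / Real.cos x) ≤ Real.sin x ^ 2 / (2 * Real.cos x ^ 2) := by
  have h := Real.sin_sq_add_cos_sq x
  have hl : Real.log (1 / Real.cos x) = -(1 / 2 * Real.log (Real.cos x ^ 2)) := by
    rw [one_div, Real.log_inv, Real.log_pow]
    push_cast
    ring
  have h1 := Real.log_le_sub_one_of_pos (pow_pos hx 2)
  have h2 := Real.one_sub_inv_le_log_of_pos (pow_pos hx 2)
  rw [hl]
  refine ⟨by linarith, ?_⟩
  have : Real.sin x ^ 2 / (2 * Real.cos x ^ 2) = 1 / 2 * ((Real.cos x ^ 2)⁻¹ - 1) := by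
    field_simp
    linarith
  rw [this]
  linarith

theorem tendsto_sq_mul_log_inv_cos : Tendsto
    (fun k : ℕ => (k : ℝ) ^ 2 * Real.log (1 / Real.cos (stepAngle k))) atTop
    (𝓝 ((Real.pi / 12) ^ 2 / 2)) := by
  have h1 := (tendsto_mul_sin_stepAngle.pow 2).div_const 2
  have h0 : Tendsto (fun k : ℕ => Real.cos (stepAngle k)) atTop (𝓝 1) := by
    have := (Real.continuous_cos.tendsto 0).comp tendsto_stepAngle
    rwa [Real.cos_zero] at this
  have h2 := h1.div (h0.pow 2) (by norm_num)
  rw [one_pow, div_one] at h2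
  refine tendsto_of_tendsto_of_tendsto_of_le_of_le' h1 h2 ?_ ?_
  · filter_upwards [eventually_gt_atTop 0] with k hk
    have := mul_le_mul_of_nonneg_left (log_inv_cos_bounds (cos_stepAngle_pos hk)).1
      (sq_nonneg (k : ℝ))
    refine le_trans (le_of_eq ?_) this
    ring
  · filter_upwards [eventually_gt_atTop 0] with k hk
    have hc := cos_stepAngle_pos hk
    have := mul_le_mul_of_nonneg_left (log_inv_cos_bounds hc).2 (sq_nonneg (k : ℝ))
    refine this.trans (le_of_eq ?_)
    rw [Pi.div_apply]
    field_simp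

/-- The contribution of the circumradius to the normalized discriminant. -/
theorem tendsto_mul_log_inv_cos (m : ℕ) : Tendsto
    (fun k : ℕ => ((m * k * (m * k - 1) : ℕ) : ℝ) * Real.log (1 / Real.cos (stepAngle k))) atTop
    (𝓝 (m ^ 2 * ((Real.pi / 12) ^ 2 / 2))) := by
  have h := tendsto_sq_mul_log_inv_cos
  have h2 := h.mul (tendsto_one_div_atTop_nhds_zero_nat (𝕜 := ℝ))
  have h3 := (h.const_mul ((m : ℝ) ^ 2)).sub (h2.const_mul (m : ℝ))
  rw [mul_zero, mul_zero, sub_zero] at h3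
  refine h3.congr' ?_
  filter_upwards [eventually_gt_atTop 0] with k hk
  rcases Nat.eq_zero_or_pos m with rfl | hm
  · simp
  have hk' : (k : ℝ) ≠ 0 := by exact_mod_cast hk.ne'
  have : 1 ≤ m * k := Nat.mul_pos hm hk
  push_cast [Nat.cast_sub this]
  field_simp

theorem tendsto_normDiscr_sixArcVertex :
    Tendsto (fun k : ℕ => normDiscr (fun i : Fin (6 * k) => sixArcVertex k i)) atTop
      (𝓝 Cstar) := by
  have h := (tendsto_mul_log_inv_cos 6).add (tendsto_glueSum_log (q := 1) (one_dvd 3))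
  have hC : Real.log Cstar = ((6 : ℕ) : ℝ) ^ 2 * ((Real.pi / 12) ^ 2 / 2) +
      (9 / 4 * Real.log 3 - 3 * Real.log 2 - √3 * Real.pi / 4) / (1 : ℕ) := by
    rw [log_Cstar]
    push_cast
    ring
  rw [← hC] at h
  have h2 := (Real.continuous_exp.tendsto _).comp h
  rw [Real.exp_log (zero_lt_one.trans one_lt_Cstar)] at h2
  refine h2.congr' ?_
  filter_upwards [eventually_gt_atTop 0] with k hk
  have hc := cos_stepAngle_pos hk
  have hd := prod_discr_sixArcVertex (q := 1) (n := 6 * k) hk one_pos (mul_one _)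
  simp only [Finset.prod_range_one, mul_one, add_zero, pow_one] at hd
  have hn : ((6 * k : ℕ) : ℝ) ≠ 0 := by
    have : 6 * k ≠ 0 := by omega
    exact_mod_cast this
  rw [normDiscr, hd, Function.comp_apply, Real.exp_add, ← Real.log_pow,
    Real.exp_log (by positivity)]
  field_simp

/-! ### Lower bounds for the maximal discriminant -/

theorem discr_le_discrMax {n : ℕ} {z : Fin n → ℂ} (hz : ∀ i j, ‖z i - z j‖ ≤ 2) :
    discr z ≤ discrMax n := by
  refine le_csSup ⟨∏ i : Fin n, ∏ _j ∈ Finset.univ.erase i, (2 : ℝ), ?_⟩ ⟨z, hz, rfl⟩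
  rintro _ ⟨w, hw, rfl⟩
  exact Finset.prod_le_prod (fun i _ => Finset.prod_nonneg fun j _ => norm_nonneg _)
    fun i _ => Finset.prod_le_prod (fun j _ => norm_nonneg _) fun j _ => hw i j

theorem discr_nonneg {n : ℕ} (z : Fin n → ℂ) : 0 ≤ discr z :=
  Finset.prod_nonneg fun _ _ => Finset.prod_nonneg fun _ _ => norm_nonneg _

/-- The lower bound for an even number `2 * k` of points, from the best residue class modulo `3`
of the vertices of the six-arc polygon with `6 * k` vertices. -/
theorem exp_le_normDiscrMax_two_mul {k : ℕ} (hk : 0 < k) :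
    Real.exp (((2 * k * (2 * k - 1) : ℕ) : ℝ) * Real.log (1 / Real.cos (stepAngle k)) +
      glueSum 3 k / 3) ≤ normDiscrMax (2 * k) := by
  have hc := cos_stepAngle_pos hk
  have hd := prod_discr_sixArcVertex (q := 3) (n := 2 * k) hk (by norm_num) (by ring)
  have hn : (0 : ℝ) < ((2 * k : ℕ) : ℝ) ^ (2 * k) := by
    have : 0 < 2 * k := by omega
    positivity
  -- All three classes have diameter at most `2`, so the geometric mean of their discriminants
  -- bounds the maximum from below and no best class need be chosen.
  have hle : ∏ c ∈ Finset.range 3, discr (fun i : Fin (2 * k) => sixArcVertex k (i * 3 + c)) ≤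
      discrMax (2 * k) ^ 3 := by
    rw [← Finset.card_range 3, ← Finset.prod_const, Finset.card_range]
    refine Finset.prod_le_prod (fun c _ => discr_nonneg _) fun c hc3 => discr_le_discrMax ?_
    intro i j
    have := Finset.mem_range.1 hc3
    exact norm_sixArcVertex_sub_le hk (by omega) (by omega)
  have h0 : 0 ≤ discrMax (2 * k) :=
    (discr_nonneg _).trans (discr_le_discrMax (z := fun _ => 0) (by simp))
  have e : (((2 * k : ℕ) : ℝ) ^ (2 * k) * Real.exp (((2 * k * (2 * k - 1) : ℕ) : ℝ) *
      Real.log (1 / Real.cos (stepAngle k)) + glueSum 3 k / 3)) ^ 3 =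
      ∏ c ∈ Finset.range 3, discr (fun i : Fin (2 * k) => sixArcVertex k (i * 3 + c)) := by
    rw [hd, mul_pow, ← Real.exp_nat_mul, mul_add, Real.exp_add, mul_pow, Real.exp_nat_mul,
      ← Real.log_pow, Real.exp_log (by positivity)]
    push_cast
    rw [mul_div_cancel₀ _ (by norm_num : (3 : ℝ) ≠ 0)]
    ring
  rw [normDiscrMax, le_div_iff₀ hn, mul_comm]
  refine (pow_le_pow_iff_left₀ (by positivity) h0 three_ne_zero).1 ?_
  rw [e]
  exact hle

/-- For odd `n` half the central angle differs from `π/2` by `n - 2(i - j)` steps of `π/(2n)`, an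
odd number and so never zero. -/
theorem norm_regularVertex_sub_le {n : ℕ} (hn : Odd n) (i j : Fin n) :
    ‖regularVertex n 1 i - regularVertex n 1 j‖ ≤ 2 * Real.cos (Real.pi / (2 * n)) := by
  have hpi := Real.pi_pos
  have hn0 : 0 < n := hn.pos
  have hn' : (0 : ℝ) < n := by exact_mod_cast hn0
  wlog hij : (j : ℕ) ≤ i generalizing i j
  · rw [norm_sub_rev]
    exact this j i (by omega)
  have hd := arcDist_zero_sq 0 (2 * Real.pi * i / n) (2 * Real.pi * j / n)
  have e : ‖regularVertex n 1 i - regularVertex n 1 j‖ =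
      arcDist 0 0 (2 * Real.pi * i / n) (2 * Real.pi * j / n) := by
    rw [arcDist, regularVertex, regularVertex, mul_zero, arcPoint_zero, arcPoint_zero, pow_zero,
      one_mul, Complex.ofReal_one, one_mul, one_mul]
  have hang : (2 * Real.pi * i / n - 2 * Real.pi * j / n) / 2 =
      Real.pi / 2 - Real.pi / (2 * n) * (n - 2 * ((i : ℕ) - (j : ℕ) : ℕ)) := by
    rw [Nat.cast_sub hij]
    field_simp
    ring
  obtain ⟨m, hm⟩ := hn
  set z : ℝ := n - 2 * ((i : ℕ) - (j : ℕ) : ℕ) with hz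
  have hz1 : 1 ≤ |z| := by
    have h : (1 : ℤ) ≤ |(n : ℤ) - 2 * (((i : ℕ) - (j : ℕ) : ℕ) : ℤ)| := Int.one_le_abs (by omega)
    have : z = ((n : ℤ) - 2 * (((i : ℕ) - (j : ℕ) : ℕ) : ℤ) : ℤ) := by
      rw [hz]
      push_cast
      ring
    rw [this]
    exact_mod_cast h
  have hzn : |z| ≤ n := by
    have h1 : (((i : ℕ) - (j : ℕ) : ℕ) : ℝ) ≤ n := by
      exact_mod_cast (by have := i.2; omega : (i : ℕ) - (j : ℕ) ≤ n)
    rw [hz, abs_le]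
    constructor <;> linarith [Nat.cast_nonneg (α := ℝ) ((i : ℕ) - (j : ℕ))]
  have hp : 0 < Real.pi / (2 * n) := by positivity
  have hp2 : Real.pi / (2 * n) * n = Real.pi / 2 := by field_simp
  have hc : 0 ≤ Real.cos (Real.pi / (2 * n)) := by
    refine Real.cos_nonneg_of_neg_pi_div_two_le_of_le (by linarith) ?_
    nlinarith
  have hc1 : |Real.cos (Real.pi / (2 * n) * z)| ≤ Real.cos (Real.pi / (2 * n)) := by
    rw [← Real.cos_abs (_ * z), abs_mul, abs_of_pos hp]
    have h1 : 0 ≤ Real.cos (Real.pi / (2 * n) * |z|) :=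
      Real.cos_nonneg_of_neg_pi_div_two_le_of_le (by nlinarith [abs_nonneg z]) (by nlinarith)
    rw [abs_of_nonneg h1]
    exact Real.cos_le_cos_of_nonneg_of_le_pi hp.le (by nlinarith) (by nlinarith)
  rw [e]
  refine (pow_le_pow_iff_left₀ (arcDist_nonneg _ _ _ _) (by linarith) two_ne_zero).1 ?_
  rw [hd, hang, Real.sin_pi_div_two_sub, mul_pow, ← sq_abs (Real.cos (_ * z))]
  have := pow_le_pow_left₀ (abs_nonneg _) hc1 2
  linarith

/-- The lower bound for an odd number of points, from the regular polygon. -/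
theorem le_normDiscrMax_of_odd {n : ℕ} (hn : Odd n) (h5 : 5 ≤ n) : 1.4 ≤ normDiscrMax n := by
  have hpi := Real.pi_pos
  have hn' : (5 : ℝ) ≤ n := by exact_mod_cast h5
  have hx : Real.pi / (2 * n) ≤ Real.pi / 10 := by
    gcongr
    linarith
  have hx0 : 0 < Real.pi / (2 * n) := by positivity
  have hc : 0 < Real.cos (Real.pi / (2 * n)) :=
    Real.cos_pos_of_mem_Ioo ⟨by linarith, by linarith⟩
  set r : ℝ := 1 / Real.cos (Real.pi / (2 * n)) with hr
  have hr0 : 0 < r := by positivity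
  have hsub : ∀ i j : Fin n, ‖(r : ℂ) * regularVertex n 1 i - r * regularVertex n 1 j‖ =
      r * ‖regularVertex n 1 i - regularVertex n 1 j‖ := by
    intro i j
    rw [← mul_sub, norm_mul, Complex.norm_real, Real.norm_of_nonneg hr0.le]
  have hd : discr (fun i : Fin n => (r : ℂ) * regularVertex n 1 i) =
      (n : ℝ) ^ n * r ^ (n * (n - 1)) := by
    rw [discr_eq_of_norm_sub (r := r) (ρ := fun _ _ => 0) (fun _ => rfl)]
    · simp
    · intro i j _
      rw [hsub, Real.exp_zero, mul_one]
  have hmax : (n : ℝ) ^ n * r ^ (n * (n - 1)) ≤ discrMax n := by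
    rw [← hd]
    refine discr_le_discrMax fun i j => ?_
    rw [hsub, hr, one_div, inv_mul_le_iff₀ hc, mul_comm]
    exact norm_regularVertex_sub_le hn i j
  -- Jordan's inequality `sin x ≥ 2x/π`.
  have hs : 1 / (n : ℝ) ≤ Real.sin (Real.pi / (2 * n)) := by
    have := Real.mul_le_sin hx0.le (by linarith)
    refine le_trans (le_of_eq ?_) this
    field_simp
  have hl : (1 / (n : ℝ)) ^ 2 / 2 ≤ Real.log r := by
    refine le_trans ?_ (log_inv_cos_bounds hc).1
    gcongr
  -- The exponent is at least `1/2 - 1/(2n)`, hence at least `2/5` for `n ≥ 5`, and `exp t ≥ 1 + t`.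
  have hpow : 1.4 ≤ r ^ (n * (n - 1)) := by
    rw [← Real.exp_log hr0, ← Real.exp_nat_mul]
    refine le_trans ?_ (Real.add_one_le_exp _)
    have h1 : ((n * (n - 1) : ℕ) : ℝ) * ((1 / (n : ℝ)) ^ 2 / 2) = 1 / 2 - 1 / n / 2 := by
      rw [Nat.cast_mul, Nat.cast_sub (by omega)]
      push_cast
      field_simp
    have h2 := mul_le_mul_of_nonneg_left hl (Nat.cast_nonneg (α := ℝ) (n * (n - 1)))
    have h3 : 1 / (n : ℝ) ≤ 1 / 5 := by gcongr
    norm_num at h3 ⊢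
    norm_num at h1 h2
    linarith
  rw [normDiscrMax, le_div_iff₀ (by positivity), mul_comm]
  exact (mul_le_mul_of_nonneg_left hpow (by positivity)).trans hmax

theorem one_lt_Cstar_rpow : 1 < Cstar ^ ((1 : ℝ) / 9) :=
  Real.one_lt_rpow one_lt_Cstar (by norm_num)

theorem Cstar_rpow_le_liminf : ((Cstar ^ ((1 : ℝ) / 9) : ℝ) : EReal) ≤
    liminf (fun n : ℕ => ((normDiscrMax n : ℝ) : EReal)) atTop := by
  have hC0 : 0 < Cstar := zero_lt_one.trans one_lt_Cstar
  have h := (tendsto_mul_log_inv_cos 2).add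
    ((tendsto_glueSum_log (q := 3) (dvd_refl 3)).div_const 3)
  -- One ninth arises twice: `2²` against `6²` in the gain from the radius, and `1/3` for a residue
  -- class times `1/3` for the geometric mean.
  have hlog : Real.log (Cstar ^ ((1 : ℝ) / 9)) = ((2 : ℕ) : ℝ) ^ 2 * ((Real.pi / 12) ^ 2 / 2) +
      (9 / 4 * Real.log 3 - 3 * Real.log 2 - √3 * Real.pi / 4) / (3 : ℕ) / 3 := by
    rw [Real.log_rpow hC0, log_Cstar]
    push_cast
    ring
  rw [← hlog] at h
  have h2 := (Real.continuous_exp.tendsto _).comp h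
  rw [Real.exp_log (Real.rpow_pos_of_pos hC0 _)] at h2
  have hle : Cstar ^ ((1 : ℝ) / 9) ≤ 1.31 :=
    (Real.rpow_le_self_of_one_le one_lt_Cstar.le (by norm_num)).trans Cstar_lt.le
  refine le_of_forall_lt fun c hc => ?_
  obtain ⟨d, hcd, hd⟩ := EReal.lt_iff_exists_real_btwn.1 hc
  refine lt_of_lt_of_le hcd (le_liminf_of_le (by isBoundedDefault) ?_)
  have hd' : d < Cstar ^ ((1 : ℝ) / 9) := by exact_mod_cast hd
  obtain ⟨K, hK⟩ := eventually_atTop.1 (h2.eventually_const_lt hd')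
  -- For even `n = 2k` this ensures `k ≥ K` and `k > 0`; for odd `n` it ensures `n ≥ 5`.
  filter_upwards [eventually_ge_atTop (2 * K + 5)] with n hn
  rw [EReal.coe_le_coe_iff]
  rcases Nat.even_or_odd' n with ⟨k, rfl | rfl⟩
  · exact (hK k (by omega)).le.trans (exp_le_normDiscrMax_two_mul (by omega))
  · refine le_trans ?_ (le_normDiscrMax_of_odd ⟨k, rfl⟩ (by omega))
    norm_num at hle ⊢
    linarith

theorem theorem2 :
    (∃ B : ℕ → ℕ → ℂ,
      (∀ k : ℕ, 1 ≤ k →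
        IsSixArcPolygon k (1 / Real.cos (Real.pi / (2 * (6 * k)))) (B k) ∧
        Function.Injective (fun i : Fin (6 * k) => B k i) ∧
        Metric.diam (Set.range fun i : Fin (6 * k) => B k i) = 2) ∧
      Tendsto (fun k : ℕ => normDiscr (fun i : Fin (6 * k) => B k i)) atTop (𝓝 Cstar)) ∧
    |Cstar - 1.304457| < 5 / 10 ^ 7 ∧
    ((Cstar ^ ((1 : ℝ) / 9) : ℝ) : EReal) ≤
      liminf (fun n : ℕ => ((normDiscrMax n : ℝ) : EReal)) atTop ∧
    1 < Cstar ^ ((1 : ℝ) / 9) :=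
  ⟨⟨sixArcVertex, fun _ hk => ⟨isSixArcPolygon_sixArcVertex hk, sixArcVertex_injective hk,
    diam_sixArcVertex hk⟩, tendsto_normDiscr_sixArcVertex⟩, abs_Cstar_sub_lt,
    Cstar_rpow_le_liminf, one_lt_Cstar_rpow⟩
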